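/- Let $X$ be a smooth complex variety, in the algebraic setting (a smooth integral separated scheme of finite type over $\mathbb C$) or in the analytic setting (a complex manifold). Let $\mathcal F$ be a foliation on $X$, that is, a coherent involutive subsheaf $T_{\mathcal F}\subset T_X$ with $T_X/T_{\mathcal F}$ torsion free, let $N^*_{\mathcal F}\subset\Omega^1_X$ be the sheaf of 1-forms vanishing on $T_{\mathcal F}$; the codimension of $\mathcal F$ is the rank of $N^*_{\mathcal F}$. Let $\mathcal E$ be a coherent reflexive sheaf on $X$ with a flat $\mathcal F$-partial connection $\nabla$, that is, a $\mathbb C$-linear map $\nabla:\mathcal E\to\mathcal Hom(T_{\mathcal F},\mathcal E)$, $s\mapsto(v\mapsto\nabla_v(s))$, with $\nabla_v(fs)=v(f)s+f\nabla_v(s)$ and $\nabla_{[v,w]}=\nabla_v\nabla_w-\nabla_w\nabla_v$. Let $D\ge 0$ be a divisor on $X$. Let $\mathcal D^1(\mathcal E,\mathcal O_X)$ be the sheaf of differential operators $\mathcal E\to\mathcal O_X$ of order $\le 1$, and $S^1(\nabla)$ its $\mathcal O_X$-submodule generated by the operators $\phi\circ\nabla_v$ with $\phi\in\mathcal E^*$,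 $v\in T_{\mathcal F}$. The first sheaf of transverse jets is $\mathcal P^1_{X/\mathcal F}(\nabla)=\big(\mathcal D^1(\mathcal E,\mathcal O_X)/S^1(\nabla)\big)^*$, with the flat partial connection $\nabla^1_v(\xi)(P)=v(\xi(P))-\xi(v\circ P-P\circ\nabla_v)$; restriction to operators of order $0$ gives the projection $\pi:\mathcal P^1_{X/\mathcal F}(\nabla)\to\mathcal E^{**}=\mathcal E$ in the exact sequence $0\to\mathcal Hom(T_X/T_{\mathcal F},\mathcal E)\to\mathcal P^1_{X/\mathcal F}(\nabla)\xrightarrow{\pi}\mathcal E$. A meromorphic splitting with poles on $D$ is an $\mathcal O_X$-linear morphism $\sigma:\mathcal E(-D)\to\mathcal P^1_{X/\mathcal F}(\nabla)$ such that $\pi\circ\sigma$ is the inclusion $\mathcal E(-D)\subset\mathcal E$. A meromorphic connection with poles on $D$ is a $\mathbb C$-linear map $\widehat\nabla:\mathcal E\to\Omega^1_X(D)\otimes\mathcal E$ satisfying the Leibniz rule; it extends $\nabla$ if $\widehat\nabla_v(s)=\nabla_v(s)$ in $\mathcal E(D)$ for all $v\in T_{\mathcal F}$, $s\in\mathcal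 E$. Then there is a bijection $\widehat\nabla\mapsto\sigma_{\widehat\nabla}$ between (a) the meromorphic connections with poles on $D$ extending $\nabla$, and (b) the meromorphic splittings $\sigma:\mathcal E(-D)\to\mathcal P^1_{X/\mathcal F}(\nabla)$ with poles on $D$, characterized by $\sigma_{\widehat\nabla}=d^1-\widehat\nabla$: if $s\in\mathcal E(-D)$ and $\widehat\nabla(s)=\sum_i\omega_i\otimes t_i$ locally, with $\omega_i\in\Omega^1_X$ and $t_i\in\mathcal E$, then $\sigma_{\widehat\nabla}(s)(P)=P(s)-\sum_i\omega_i\big(f\mapsto P(ft_i)-fP(t_i)\big)$ for every $P\in\mathcal D^1(\mathcal E,\mathcal O_X)$, where $f\mapsto P(ft_i)-fP(t_i)$ is regarded as a vector field. If moreover $\mathcal F$ has codimension one and $D$ is $\mathcal F$-invariant, that is, $v(f)\in\mathcal O_X(-D)$ for all $v\in T_{\mathcal F}$ and $f\in\mathcal O_X(-D)$, then $\widehat\nabla$ is flat if and only if $\sigma_{\widehat\nabla}$ is horizontal, that is, $\sigma_{\widehat\nabla}(\nabla_v(s))=\nabla^1_v(\sigma_{\widehat\nabla}(s))$ for all $v\in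 T_{\mathcal F}$ and $s\in\mathcal E(-D)$. Hence the bijection restricts to one between the flat meromorphic connections with poles on $D$ extending $\nabla$ and the horizontal meromorphic splittings with poles on $D$. -/

import Mathlib

open CategoryTheory TopologicalSpace Opposite

/-! ## Ringed spaces over the complex numbers and smooth complex varieties -/

/-- A ringed space whose structure sheaf is a sheaf of `ℂ`-algebras; `const` gives the
constant functions. -/
structure ComplexRingedSpace where
  toRingedSpace : AlgebraicGeometry.RingedSpace.{0}
  const : ∀ U : Opens toRingedSpace, ℂ →+* toRingedSpace.presheaf.obj (op U)
  const_res : ∀ {U V : Opens toRingedSpace} (h : V ≤ U) (c : ℂ),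
    (toRingedSpace.presheaf.map (homOfLE h).op).hom (const U c) = const V c

namespace ComplexRingedSpace

variable (X : ComplexRingedSpace)

/-- The open subsets of `X`. -/
abbrev Op : Type := Opens X.toRingedSpace

/-- The ring `𝒪_X(U)`. -/
abbrev O (U : X.Op) : Type := X.toRingedSpace.presheaf.obj (op U)

/-- Restriction of functions. -/
def resO {U V : X.Op} (h : V ≤ U) : X.O U →+* X.O V :=
  (X.toRingedSpace.presheaf.map (homOfLE h).op).hom

theorem resO_id {U : X.Op} (f : X.O U) : X.resO le_rfl f = f := by
  simp [resO]

theorem resO_comp {U V W : X.Op} (hV : V ≤ U) (hW : W ≤ V) (f : X.O U) :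
    X.resO hW (X.resO hV f) = X.resO (hW.trans hV) f := by
  have : (homOfLE (hW.trans hV)).op = (homOfLE hV).op ≫ (homOfLE hW).op := rfl
  simp [resO, this]

/-- The structure sheaf as a sheaf of (not necessarily commutative) rings, as needed for Mathlib's
sheaves of modules. -/
abbrev ringSheaf : TopCat.Sheaf RingCat.{0} X.toRingedSpace :=
  (sheafCompose _ (forget₂ CommRingCat RingCat)).obj X.toRingedSpace.sheaf

end ComplexRingedSpace

section Varieties

open scoped Manifold ContDiff

/-- A smooth complex variety, in the algebraic or in the analytic setting. -/
inductive SmoothComplexVariety : Type 1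
  /-- A smooth integral separated scheme of finite type over `ℂ`. -/
  | algebraic (X : AlgebraicGeometry.Scheme.{0})
      (f : X ⟶ AlgebraicGeometry.Spec (CommRingCat.of ℂ))
      [AlgebraicGeometry.IsIntegral X] [AlgebraicGeometry.Smooth f]
      [AlgebraicGeometry.IsSeparated f] [AlgebraicGeometry.QuasiCompact f] :
      SmoothComplexVariety
  /-- A complex manifold of dimension `n`. -/
  | analytic (n : ℕ) (M : Type) [TopologicalSpace M] [T2Space M] [SecondCountableTopology M]
      [ChartedSpace (EuclideanSpace ℂ (Fin n)) M]
      [IsManifold 𝓘(ℂ, EuclideanSpace ℂ (Fin n)) ω M] :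
      SmoothComplexVariety

/-- The ringed space over `ℂ` underlying a scheme over `ℂ`. -/
noncomputable def ComplexRingedSpace.ofScheme (X : AlgebraicGeometry.Scheme.{0})
    (f : X ⟶ AlgebraicGeometry.Spec (CommRingCat.of ℂ)) : ComplexRingedSpace where
  toRingedSpace := X.toSheafedSpace
  const U := ((AlgebraicGeometry.Scheme.ΓSpecIso (CommRingCat.of ℂ)).inv ≫ f.appTop ≫
    X.presheaf.map (homOfLE (le_top : U ≤ ⊤)).op).hom
  const_res {U V} h c := by
    have : (homOfLE (le_top : V ≤ ⊤)).op = (homOfLE (le_top : U ≤ ⊤)).op ≫ (homOfLE h).op := rfl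
    rw [this, X.presheaf.map_comp]
    rfl

/-- The constant functions on an open subset of a complex manifold. -/
noncomputable def manifoldConst (n : ℕ) (M : Type) [TopologicalSpace M]
    [ChartedSpace (EuclideanSpace ℂ (Fin n)) M] (U : Opens M) :
    ℂ →+* C^∞⟮𝓘(ℂ, EuclideanSpace ℂ (Fin n)), U; 𝓘(ℂ, ℂ), ℂ⟯ :=
  algebraMap ℂ _

/-- The ringed space over `ℂ` underlying a complex manifold: its structure sheaf is the sheaf of
holomorphic functions (smoothness over `ℂ` is holomorphy). -/
noncomputable def ComplexRingedSpace.ofManifold (n : ℕ) (M : Type) [TopologicalSpace M]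
    [ChartedSpace (EuclideanSpace ℂ (Fin n)) M] : ComplexRingedSpace where
  toRingedSpace :=
    (ChartedSpace.locallyRingedSpace 𝓘(ℂ, EuclideanSpace ℂ (Fin n)) M).toSheafedSpace
  const U := manifoldConst n M U
  const_res _ _ := rfl

/-- The ringed space over `ℂ` underlying a smooth complex variety. -/
noncomputable def SmoothComplexVariety.space : SmoothComplexVariety → ComplexRingedSpace
  | @SmoothComplexVariety.algebraic X f _ _ _ _ => ComplexRingedSpace.ofScheme X f
  | @SmoothComplexVariety.analytic n M _ _ _ _ _ => ComplexRingedSpace.ofManifold n M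

end Varieties

/-! ## Presheaves of modules, with their sections made explicit -/

/-- A presheaf of `𝒪_X`-modules. -/
structure PMod (X : ComplexRingedSpace) where
  sec : X.Op → Type
  [acg : ∀ U, AddCommGroup (sec U)]
  [mod : ∀ U, Module (X.O U) (sec U)]
  res : ∀ {U V : X.Op}, V ≤ U → sec U →+ sec V
  res_smul : ∀ {U V : X.Op} (h : V ≤ U) (f : X.O U) (s : sec U),
    res h (f • s) = X.resO h f • res h s
  res_id : ∀ {U : X.Op} (s : sec U), res le_rfl s = s
  res_comp : ∀ {U V W : X.Op} (hV : V ≤ U) (hW : W ≤ V) (s : sec U),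
    res hW (res hV s) = res (hW.trans hV) s

attribute [instance] PMod.acg PMod.mod

/-- The presheaf of modules underlying a sheaf of modules on `X`. -/
noncomputable def SheafOfModules.toPMod {X : ComplexRingedSpace}
    (E : SheafOfModules.{0} X.ringSheaf) : PMod X where
  sec U := E.val.obj (op U)
  acg U := inferInstance
  mod U := (E.val.obj (op U)).isModule
  res h := (E.val.restrictₛₗ (homOfLE h).op).toAddMonoidHom
  res_smul h f s := (E.val.restrictₛₗ (homOfLE h).op).map_smulₛₗ f s
  res_id {U} s := by
    have : (homOfLE (le_refl U)).op = 𝟙 (op U) := rfl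
    change E.val.map (homOfLE (le_refl U)).op s = s
    rw [this, E.val.map_id]
    rfl
  res_comp hV hW s := (E.val.map_comp_apply (homOfLE hV).op (homOfLE hW).op s).symm

variable {X : ComplexRingedSpace}

/-- The structure sheaf as a module over itself. -/
abbrev PMod.unit (X : ComplexRingedSpace) : PMod X where
  sec U := X.O U
  res h := (X.resO h).toAddMonoidHom
  res_smul h f s := map_mul (X.resO h) f s
  res_id := X.resO_id
  res_comp := X.resO_comp

/-- A family of submodules stable under restriction. -/
structure SubPMod (M : PMod X) where
  carrier : ∀ U : X.Op, Submodule (X.O U) (M.sec U)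
  res_mem : ∀ {U V : X.Op} (h : V ≤ U) {s : M.sec U}, s ∈ carrier U → M.res h s ∈ carrier V

namespace SubPMod

variable {M : PMod X}

/-- A sub-presheaf as a presheaf of modules. -/
abbrev toPMod (S : SubPMod M) : PMod X where
  sec U := S.carrier U
  res h := ((M.res h).comp (S.carrier _).toAddSubgroup.subtype).codRestrict
    (S.carrier _).toAddSubgroup (fun s => S.res_mem h s.2)
  res_smul h f s := Subtype.ext (M.res_smul h f s.1)
  res_id s := Subtype.ext (M.res_id s.1)
  res_comp hV hW s := Subtype.ext (M.res_comp hV hW s.1)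

/-- Membership is local; for `M` a sheaf this says that `S` is a subsheaf. -/
def IsSubsheaf (S : SubPMod M) : Prop :=
  ∀ (U : X.Op) (s : M.sec U),
    (∀ x ∈ U, ∃ (V : X.Op) (h : V ≤ U), x ∈ V ∧ M.res h s ∈ S.carrier V) → s ∈ S.carrier U

/-- The quotient presheaf. -/
abbrev quot (S : SubPMod M) : PMod X where
  sec U := M.sec U ⧸ S.carrier U
  res {U V} h := QuotientAddGroup.map (S.carrier U).toAddSubgroup (S.carrier V).toAddSubgroup
    (M.res h) (fun _ hs => S.res_mem h hs)
  res_smul h f s := by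
    induction s using Submodule.Quotient.induction_on with
    | _ s => exact congrArg _ (M.res_smul h f s)
  res_id s := by
    induction s using Submodule.Quotient.induction_on with
    | _ s => exact congrArg _ (M.res_id s)
  res_comp hV hW s := by
    induction s using Submodule.Quotient.induction_on with
    | _ s => exact congrArg _ (M.res_comp hV hW s)

end SubPMod

/-! ## `ℂ`-linear morphisms and differential operators -/

/-- A `ℂ`-linear morphism `E|_U → G|_U`. -/
@[ext]
structure LocalOp (E G : PMod X) (U : X.Op) where
  app : ∀ V : X.Op, V ≤ U → E.sec V →+ G.sec V
  map_const : ∀ (V : X.Op) (h : V ≤ U) (c : ℂ) (s : E.sec V),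
    app V h (X.const V c • s) = X.const V c • app V h s
  map_res : ∀ {V W : X.Op} (hV : V ≤ U) (hW : W ≤ V) (s : E.sec V),
    app W (hW.trans hV) (E.res hW s) = G.res hW (app V hV s)

namespace LocalOp

variable {E G H : PMod X} {U : X.Op}

theorem ext' {D D' : LocalOp E G U} (h : ∀ V hV s, D.app V hV s = D'.app V hV s) : D = D' :=
  LocalOp.ext (funext fun V => funext fun hV => AddMonoidHom.ext (h V hV))

instance : Zero (LocalOp E G U) := ⟨⟨fun _ _ => 0, by simp, by simp⟩⟩

instance : Add (LocalOp E G U) :=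
  ⟨fun D D' => ⟨fun V h => D.app V h + D'.app V h,
    fun V h c s => by simp [D.map_const, D'.map_const],
    fun hV hW s => by simp [D.map_res hV hW, D'.map_res hV hW]⟩⟩

instance : Neg (LocalOp E G U) :=
  ⟨fun D => ⟨fun V h => -D.app V h, fun V h c s => by simp [D.map_const],
    fun hV hW s => by simp [D.map_res hV hW]⟩⟩

instance : Sub (LocalOp E G U) :=
  ⟨fun D D' => ⟨fun V h => D.app V h - D'.app V h,
    fun V h c s => by simp [D.map_const, D'.map_const, smul_sub],
    fun hV hW s => by simp [D.map_res hV hW, D'.map_res hV hW]⟩⟩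

@[simp] theorem zero_app (V : X.Op) (h : V ≤ U) (s : E.sec V) :
    (0 : LocalOp E G U).app V h s = 0 := rfl

@[simp] theorem add_app (D D' : LocalOp E G U) (V : X.Op) (h : V ≤ U) (s : E.sec V) :
    (D + D').app V h s = D.app V h s + D'.app V h s := rfl

@[simp] theorem neg_app (D : LocalOp E G U) (V : X.Op) (h : V ≤ U) (s : E.sec V) :
    (-D).app V h s = -D.app V h s := rfl

@[simp] theorem sub_app (D D' : LocalOp E G U) (V : X.Op) (h : V ≤ U) (s : E.sec V) :
    (D - D').app V h s = D.app V h s - D'.app V h s := rfl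

instance : AddCommGroup (LocalOp E G U) where
  add_assoc a b c := ext' fun _ _ _ => by simp [add_assoc]
  zero_add a := ext' fun _ _ _ => by simp
  add_zero a := ext' fun _ _ _ => by simp
  neg_add_cancel a := ext' fun _ _ _ => by simp
  add_comm a b := ext' fun _ _ _ => by simp [add_comm]
  sub_eq_add_neg a b := ext' fun _ _ _ => by simp [sub_eq_add_neg]
  nsmul := nsmulRec
  zsmul := zsmulRec

instance : SMul (X.O U) (LocalOp E G U) :=
  ⟨fun f D => ⟨fun V h => (DistribSMul.toAddMonoidHom _ (X.resO h f)).comp (D.app V h),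
    fun V h c s => by simp [D.map_const, smul_comm (X.resO h f)],
    fun hV hW s => by simp [D.map_res hV hW, G.res_smul, X.resO_comp]⟩⟩

@[simp] theorem smul_app (f : X.O U) (D : LocalOp E G U) (V : X.Op) (h : V ≤ U) (s : E.sec V) :
    (f • D).app V h s = X.resO h f • D.app V h s := rfl

/-- The left (canonical) module structure `(f • D)(s) = f • D(s)`. -/
instance : Module (X.O U) (LocalOp E G U) where
  one_smul D := ext' fun _ _ _ => by simp
  mul_smul f g D := ext' fun _ _ _ => by simp [mul_smul]
  smul_zero f := ext' fun _ _ _ => by simp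
  smul_add f D D' := ext' fun _ _ _ => by simp
  add_smul f g D := ext' fun _ _ _ => by simp [add_smul]
  zero_smul D := ext' fun _ _ _ => by simp

/-- Restriction to a smaller open set. -/
def restrict {V : X.Op} (h : V ≤ U) (D : LocalOp E G U) : LocalOp E G V :=
  ⟨fun W hW => D.app W (hW.trans h), fun W hW => D.map_const W _, fun hV hW => D.map_res _ hW⟩

@[simp] theorem restrict_app {V : X.Op} (h : V ≤ U) (D : LocalOp E G U) (W : X.Op) (hW : W ≤ V)
    (s : E.sec W) : (D.restrict h).app W hW s = D.app W (hW.trans h) s := rfl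

/-- Composition. -/
def comp (D' : LocalOp G H U) (D : LocalOp E G U) : LocalOp E H U :=
  ⟨fun V h => (D'.app V h).comp (D.app V h), fun V h c s => by simp [D.map_const, D'.map_const],
    fun hV hW s => by simp [D.map_res hV hW, D'.map_res hV hW]⟩

@[simp] theorem comp_app (D' : LocalOp G H U) (D : LocalOp E G U) (V : X.Op) (h : V ≤ U)
    (s : E.sec V) : (D'.comp D).app V h s = D'.app V h (D.app V h s) := rfl

/-- The commutator `[D, f] : s ↦ D(f • s) - f • D(s)`. -/
def comm (D : LocalOp E G U) (f : X.O U) : LocalOp E G U where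
  app V h := (D.app V h).comp (DistribSMul.toAddMonoidHom _ (X.resO h f)) - (f • D).app V h
  map_const V h c s := by
    simp [D.map_const, smul_comm (X.resO h f), smul_sub]
  map_res hV hW s := by
    simp only [AddMonoidHom.sub_apply, AddMonoidHom.comp_apply,
      DistribSMul.toAddMonoidHom_apply, smul_app, map_sub]
    rw [← D.map_res hV hW, E.res_smul, X.resO_comp, G.res_smul, X.resO_comp, D.map_res hV hW]

@[simp] theorem comm_app (D : LocalOp E G U) (f : X.O U) (V : X.Op) (h : V ≤ U) (s : E.sec V) :
    (D.comm f).app V h s = D.app V h (X.resO h f • s) - X.resO h f • D.app V h s := rfl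

/-- Differential operators of order `≤ k`: for `k = 0` the `𝒪`-linear morphisms, and `D` has order
`≤ k + 1` if all commutators `[D, f]` with local functions `f` have order `≤ k`. -/
def IsDiffOp : ℕ → ∀ {U : X.Op}, LocalOp E G U → Prop
  | 0, U, D => ∀ (V : X.Op) (h : V ≤ U) (f : X.O V) (s : E.sec V),
      D.app V h (f • s) = f • D.app V h s
  | k + 1, U, D => ∀ (V : X.Op) (h : V ≤ U) (f : X.O V), IsDiffOp k ((D.restrict h).comm f)

theorem IsDiffOp.zero (k : ℕ) : ∀ {U : X.Op}, IsDiffOp k (0 : LocalOp E G U) := by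
  induction k with
  | zero => intro U V h f s; simp
  | succ k ih =>
    intro U V h f
    have : ((0 : LocalOp E G U).restrict h).comm f = 0 := ext' fun _ _ _ => by simp
    rw [this]; exact ih

theorem IsDiffOp.add {k : ℕ} : ∀ {U : X.Op} {D D' : LocalOp E G U}, IsDiffOp k D →
    IsDiffOp k D' → IsDiffOp k (D + D') := by
  induction k with
  | zero => intro U D D' h h' V hV f s; simp [h V hV f s, h' V hV f s]
  | succ k ih =>
    intro U D D' h h' V hV f
    have : ((D + D').restrict hV).comm f = (D.restrict hV).comm f + (D'.restrict hV).comm f :=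
      ext' fun _ _ _ => by simp; abel
    rw [this]; exact ih (h V hV f) (h' V hV f)

theorem IsDiffOp.smul {k : ℕ} : ∀ {U : X.Op} (g : X.O U) {D : LocalOp E G U}, IsDiffOp k D →
    IsDiffOp k (g • D) := by
  induction k with
  | zero => intro U g D h V hV f s; simp [h V hV f s, smul_comm f]
  | succ k ih =>
    intro U g D h V hV f
    have : ((g • D).restrict hV).comm f = X.resO hV g • (D.restrict hV).comm f :=
      ext' fun W hW s => by
        simp [smul_sub, X.resO_comp, smul_comm (X.resO hW f)]
    rw [this]; exact ih _ (h V hV f)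

theorem IsDiffOp.restrict {k : ℕ} {U V : X.Op} (hV : V ≤ U) {D : LocalOp E G U}
    (h : IsDiffOp k D) : IsDiffOp k (D.restrict hV) := by
  cases k with
  | zero => intro W hW f s; exact h W _ f s
  | succ k => intro W hW f; exact h W (hW.trans hV) f

theorem IsDiffOp.one_of_zero {D : LocalOp E G U} (h : IsDiffOp 0 D) : IsDiffOp 1 D := by
  intro V hV f W hW g s
  have := h W (hW.trans hV)
  simp [this]

theorem isDiffOp_one_iff {D : LocalOp E G U} : IsDiffOp 1 D ↔
    ∀ (V : X.Op) (h : V ≤ U) (f g : X.O V) (s : E.sec V),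
      D.app V h (f • g • s) - f • D.app V h (g • s) =
        g • (D.app V h (f • s) - f • D.app V h s) := by
  constructor
  · intro h V hV f g s
    have := h V hV f V le_rfl g s
    simpa [X.resO_id] using this
  · intro h V hV f W hW g s
    have := h W (hW.trans hV) (X.resO hW f) g s
    simpa using this

end LocalOp

namespace PMod

/-- The presheaf `U ↦ Hom_ℂ(E|_U, G|_U)`. -/
abbrev cHom (E G : PMod X) : PMod X where
  sec U := LocalOp E G U
  res h := AddMonoidHom.mk' (LocalOp.restrict h) (fun _ _ => rfl)
  res_smul h f D := LocalOp.ext' fun W hW s => by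
    change X.resO (hW.trans h) f • D.app W (hW.trans h) s =
      X.resO hW (X.resO h f) • D.app W (hW.trans h) s
    rw [X.resO_comp]
  res_id _ := rfl
  res_comp _ _ _ := rfl

/-- The differential operators `𝒟^k_X(E, G)` inside all `ℂ`-linear morphisms. -/
def diffSub (k : ℕ) (E G : PMod X) : SubPMod (cHom E G) where
  carrier U :=
    { carrier := {D | D.IsDiffOp k}
      zero_mem' := LocalOp.IsDiffOp.zero k
      add_mem' := LocalOp.IsDiffOp.add
      smul_mem' := fun f _ h => h.smul f }
  res_mem h _ hD := hD.restrict h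

/-- The sheaf `𝒟^k_X(E, G)` of differential operators of order `≤ k`. -/
abbrev Diff (k : ℕ) (E G : PMod X) : PMod X := (diffSub k E G).toPMod

/-- The sheaf `ℋom_{𝒪_X}(E, G)` of `𝒪_X`-linear morphisms. -/
abbrev Hom (E G : PMod X) : PMod X := Diff 0 E G

/-- Linear morphisms are differential operators of order `≤ 1`. -/
def ofHom {E G : PMod X} {U : X.Op} (φ : (Hom E G).sec U) : (Diff 1 E G).sec U :=
  ⟨φ.1, LocalOp.IsDiffOp.one_of_zero φ.2⟩

/-- The dual sheaf. -/
abbrev dual (E : PMod X) : PMod X := Hom E (unit X)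

/-- The value of a section of `ℋom(E, G)` over `U` on a section of `E` over `U`. -/
def Hom.eval {E G : PMod X} {U : X.Op} (φ : (Hom E G).sec U) (s : E.sec U) : G.sec U :=
  φ.1.app U le_rfl s

/-- The evaluation map `E → E^{**}`. -/
def evBidual (E : PMod X) (U : X.Op) (s : E.sec U) : E.dual.dual.sec U :=
  ⟨{ app := fun V h =>
      { toFun := fun φ => φ.1.app V le_rfl (E.res h s)
        map_zero' := rfl
        map_add' := fun _ _ => rfl }
     map_const := fun V h c φ =>
      congrArg (· • φ.1.app V le_rfl (E.res h s)) (X.resO_id (X.const V c))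
     map_res := fun {V W} hV hW φ => by
      have := φ.1.map_res (le_refl V) hW (E.res hV s)
      rw [E.res_comp] at this
      exact this },
    fun V h f φ => congrArg (· • φ.1.app V le_rfl (E.res h s)) (X.resO_id f)⟩

/-- `E` is reflexive: `E → E^{**}` is an isomorphism of sheaves. -/
def IsReflexive (E : PMod X) : Prop := ∀ U : X.Op, Function.Bijective (E.evBidual U)

/-- The sections `m i` over `U` generate `M|_U` as a sheaf. -/
def Generates (M : PMod X) {U : X.Op} {n : ℕ} (m : Fin n → M.sec U) : Prop :=
  ∀ (V : X.Op) (hV : V ≤ U) (s : M.sec V), ∀ x ∈ V, ∃ (W : X.Op) (hW : W ≤ V), x ∈ W ∧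
    M.res hW s ∈ Submodule.span (X.O W) (Set.range fun i => M.res (hW.trans hV) (m i))

/-- `M` is of finite type: locally generated by finitely many sections. -/
def IsFiniteType (M : PMod X) : Prop :=
  ∀ x : X.toRingedSpace, ∃ (U : X.Op) (n : ℕ) (m : Fin n → M.sec U), x ∈ U ∧ M.Generates m

/-- The sheaf of relations of finitely many sections `m i` over `U` is of finite type. -/
def RelationsFiniteType (M : PMod X) {U : X.Op} {n : ℕ} (m : Fin n → M.sec U) : Prop :=
  ∀ x ∈ U, ∃ (V : X.Op) (hV : V ≤ U) (k : ℕ) (r : Fin k → Fin n → X.O V), x ∈ V ∧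
    (∀ j, ∑ i, r j i • M.res hV (m i) = 0) ∧
    ∀ (W : X.Op) (hW : W ≤ V) (a : Fin n → X.O W),
      ∑ i, a i • M.res (hW.trans hV) (m i) = 0 →
      ∀ y ∈ W, ∃ (W' : X.Op) (hW' : W' ≤ W), y ∈ W' ∧
        (fun i => X.resO hW' (a i)) ∈ Submodule.span (X.O W')
          (Set.range fun j => fun i => X.resO (hW'.trans hW) (r j i))

/-- Coherence: finite type, and the relations between finitely many local sections are of finite
type. -/
def IsCoherent (M : PMod X) : Prop :=
  M.IsFiniteType ∧
    ∀ (U : X.Op) (n : ℕ) (m : Fin n → M.sec U), M.RelationsFiniteType m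

/-- The (generic) rank of a coherent sheaf is `r`: it is locally free of rank `r` on a dense open
subset. -/
def HasRank (M : PMod X) (r : ℕ) : Prop :=
  ∃ U₀ : X.Op, Dense (U₀ : Set X.toRingedSpace) ∧ ∀ x ∈ U₀,
    ∃ (U : X.Op) (e : Fin r → M.sec U), x ∈ U ∧ ∀ (V : X.Op) (hV : V ≤ U),
      LinearIndependent (X.O V) (fun i => M.res hV (e i)) ∧
      Submodule.span (X.O V) (Set.range fun i => M.res hV (e i)) = ⊤

/-- An `𝒪_X`-linear morphism of presheaves of modules. -/
@[ext]
structure Mor (E G : PMod X) where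
  app : ∀ U : X.Op, E.sec U →ₗ[X.O U] G.sec U
  map_res : ∀ {U V : X.Op} (h : V ≤ U) (s : E.sec U), app V (E.res h s) = G.res h (app U s)

end PMod

/-! ## Vector fields and one-forms -/

variable (X) in
/-- `T_X`: the derivations of the structure sheaf. -/
def tangentSub : SubPMod (PMod.cHom (PMod.unit X) (PMod.unit X)) where
  carrier U :=
    { carrier := {D | ∀ (V : X.Op) (h : V ≤ U) (f g : X.O V),
        D.app V h (f * g) = f * D.app V h g + g * D.app V h f}
      zero_mem' := fun V h f g => by
        change (0 : X.O V) = f * 0 + g * 0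
        simp
      add_mem' := fun {D D'} hD hD' V h f g => by
        change D.app V h (f * g) + D'.app V h (f * g) =
          f * (D.app V h g + D'.app V h g) + g * (D.app V h f + D'.app V h f)
        rw [hD V h f g, hD' V h f g]
        ring
      smul_mem' := fun a D hD V h f g => by
        change X.resO h a * D.app V h (f * g) =
          f * (X.resO h a * D.app V h g) + g * (X.resO h a * D.app V h f)
        rw [hD V h f g]
        ring }
  res_mem h _ hD := fun W hW f g => hD W (hW.trans h) f g

variable (X) in
/-- The tangent sheaf `T_X`. -/
abbrev tangent : PMod X := (tangentSub X).toPMod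

/-- The derivative `v(f)` of a function along a vector field. -/
def vderiv {U : X.Op} (v : (tangent X).sec U) (f : X.O U) : X.O U := v.1.app U le_rfl f

theorem vderiv_const {U : X.Op} (v : (tangent X).sec U) (c : ℂ) : vderiv v (X.const U c) = 0 := by
  have h1 : ∀ a b : X.O U, v.1.app U le_rfl (a * b) =
      a * v.1.app U le_rfl b + b * v.1.app U le_rfl a := v.2 U le_rfl
  have h2 : v.1.app U le_rfl (X.const U c * 1) = X.const U c * v.1.app U le_rfl 1 :=
    v.1.map_const U le_rfl c 1
  have h3 := h1 (X.const U c) 1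
  rw [h2] at h3
  have h4 : v.1.app U le_rfl (X.const U c) = 0 := by simpa using h3
  exact h4

/-- The Lie bracket `[v, w]` of vector fields. -/
def bracket {U : X.Op} (v w : (tangent X).sec U) : (tangent X).sec U :=
  ⟨v.1.comp w.1 - w.1.comp v.1, fun V h f g => by
    have hv := v.2 V h
    have hw := w.2 V h
    rw [LocalOp.sub_app, LocalOp.sub_app, LocalOp.sub_app]
    change v.1.app V h (w.1.app V h (f * g)) - w.1.app V h (v.1.app V h (f * g)) =
      f * (v.1.app V h (w.1.app V h g) - w.1.app V h (v.1.app V h g)) +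
      g * (v.1.app V h (w.1.app V h f) - w.1.app V h (v.1.app V h f))
    rw [hv f g, hw f g, map_add, map_add, hv, hv, hw, hw]
    ring⟩

variable (X) in
/-- The cotangent sheaf `Ω¹_X`, the dual of `T_X` (for `X` smooth this is the sheaf of Kähler
differentials, respectively of holomorphic one-forms). -/
abbrev Omega : PMod X := (tangent X).dual

/-! ## Foliations and partial connections -/

variable (X) in
/-- A (singular) foliation: a coherent involutive subsheaf `T_F ⊆ T_X` with torsion free
quotient. -/
structure Foliation where
  sub : SubPMod (tangent X)
  isSubsheaf : sub.IsSubsheaf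
  coherent : sub.toPMod.IsCoherent
  involutive : ∀ (U : X.Op) (v w : (tangent X).sec U), v ∈ sub.carrier U → w ∈ sub.carrier U →
    bracket v w ∈ sub.carrier U
  torsionFree : ∀ (U : X.Op) (f : X.O U) (v : (tangent X).sec U),
    (∀ (V : X.Op) (h : V ≤ U), X.resO h f ∈ nonZeroDivisors (X.O V)) →
    f • v ∈ sub.carrier U → v ∈ sub.carrier U

namespace Foliation

variable (F : Foliation X)

/-- The tangent sheaf `T_F` of the foliation. -/
abbrev T : PMod X := F.sub.toPMod

/-- The Lie bracket on `T_F`. -/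
def lie {U : X.Op} (v w : F.T.sec U) : F.T.sec U :=
  ⟨bracket v.1 w.1, F.involutive U v.1 w.1 v.2 w.2⟩

/-- The conormal sheaf `N*_F`: the one-forms vanishing on `T_F`. -/
def conormalSub : SubPMod (Omega X) where
  carrier U :=
    { carrier := {ω | ∀ (V : X.Op) (h : V ≤ U) (v : F.T.sec V), ω.1.app V h v.1 = 0}
      zero_mem' := fun V h v => rfl
      add_mem' := fun {a b} ha hb V h v => by
        change a.1.app V h v.1 + b.1.app V h v.1 = 0
        rw [ha, hb, add_zero]
      smul_mem' := fun f a ha V h v => by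
        change X.resO h f • a.1.app V h v.1 = 0
        rw [ha, smul_zero] }
  res_mem h _ ha := fun W hW v => ha W (hW.trans h) v

/-- The codimension of a foliation is the rank of its conormal sheaf. -/
def HasCodim (q : ℕ) : Prop := F.conormalSub.toPMod.HasRank q

end Foliation

/-- An `F`-partial connection `∇ : E → Ω¹_F(E) = ℋom(T_F, E)`: a `ℂ`-linear morphism satisfying
the Leibniz rule. -/
structure PartialConnection (F : Foliation X) (E : PMod X) where
  op : LocalOp E (PMod.Hom F.T E) ⊤
  leibniz : ∀ (U : X.Op) (f : X.O U) (s : E.sec U) (v : F.T.sec U),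
    PMod.Hom.eval (op.app U le_top (f • s)) v =
      vderiv v.1 f • s + f • PMod.Hom.eval (op.app U le_top s) v

namespace PartialConnection

variable {F : Foliation X} {E : PMod X} (C : PartialConnection F E)

/-- `∇_v(s)`. -/
def nabla {U : X.Op} (v : F.T.sec U) (s : E.sec U) : E.sec U :=
  PMod.Hom.eval (C.op.app U le_top s) v

/-- Flatness: `∇_{[v,w]} = ∇_v ∘ ∇_w - ∇_w ∘ ∇_v`. -/
def IsFlat : Prop :=
  ∀ (U : X.Op) (v w : F.T.sec U) (s : E.sec U),
    C.nabla (F.lie v w) s = C.nabla v (C.nabla w s) - C.nabla w (C.nabla v s)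

theorem nabla_smul {U : X.Op} (v : F.T.sec U) (f : X.O U) (s : E.sec U) :
    C.nabla v (f • s) = vderiv v.1 f • s + f • C.nabla v s := C.leibniz U f s v

theorem nabla_add {U : X.Op} (v : F.T.sec U) (s t : E.sec U) :
    C.nabla v (s + t) = C.nabla v s + C.nabla v t := by
  simp only [nabla, map_add]; rfl

theorem nabla_zero {U : X.Op} (v : F.T.sec U) : C.nabla v (0 : E.sec U) = 0 := by
  simp only [nabla, map_zero]; rfl

theorem nabla_res {U V : X.Op} (h : V ≤ U) (v : F.T.sec U) (s : E.sec U) :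
    C.nabla (F.T.res h v) (E.res h s) = E.res h (C.nabla v s) := by
  unfold nabla
  rw [C.op.map_res le_top h s]
  exact (C.op.app U le_top s).1.map_res le_rfl h v

/-- `∇_v` as a `ℂ`-linear morphism `E|_U → E|_U`. -/
def nablaOp {U : X.Op} (v : F.T.sec U) : LocalOp E E U where
  app V h := AddMonoidHom.mk' (C.nabla (F.T.res h v)) (C.nabla_add _)
  map_const V h c s := by
    change PMod.Hom.eval (C.op.app V le_top (X.const V c • s)) _ = _
    rw [C.op.map_const]
    exact congrArg (· • C.nabla (F.T.res h v) s) (X.resO_id (X.const V c))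
  map_res hV hW s := by
    change C.nabla _ _ = E.res hW (C.nabla _ _)
    rw [← C.nabla_res, F.T.res_comp]

theorem nablaOp_app {U V : X.Op} (v : F.T.sec U) (h : V ≤ U) (s : E.sec V) :
    (C.nablaOp v).app V h s = C.nabla (F.T.res h v) s := rfl

theorem nablaOp_smul {U V : X.Op} (v : F.T.sec U) (h : V ≤ U) (f : X.O V) (s : E.sec V) :
    (C.nablaOp v).app V h (f • s) =
      v.1.1.app V h f • s + f • (C.nablaOp v).app V h s := C.nabla_smul _ f s

/-! ### The first sheaf of transverse differential operators and its connection -/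

theorem isDiffOp_comp_nablaOp {G : PMod X} {U : X.Op} (D : (PMod.Hom E G).sec U)
    (v : F.T.sec U) : (D.1.comp (C.nablaOp v)).IsDiffOp 1 :=
  LocalOp.isDiffOp_one_iff.2 fun V h f g s => by
    have h0 := D.2 V h
    simp only [LocalOp.comp_app, nablaOp_smul, map_add, h0, smul_add, smul_sub]
    rw [smul_comm g f, smul_comm g (v.1.1.app V h f)]
    abel

/-- The operator `D ∘ ∇_v` of order `≤ 1`, for `D : E → 𝒪_X` linear. -/
def prolong {U : X.Op} (D : E.dual.sec U) (v : F.T.sec U) : (PMod.Diff 1 E (PMod.unit X)).sec U :=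
  ⟨D.1.comp (C.nablaOp v), C.isDiffOp_comp_nablaOp D v⟩

/-- `S¹(∇)`, the `𝒪_X`-submodule of the operators of order `≤ 1` generated by the `D ∘ ∇_v`. -/
def prolongSub : SubPMod (PMod.Diff 1 E (PMod.unit X)) where
  carrier U := Submodule.span (X.O U) {P | ∃ D v, P = C.prolong D v}
  res_mem {U V} h {s} hs := by
    induction hs using Submodule.span_induction with
    | mem P hP =>
      obtain ⟨D, v, rfl⟩ := hP
      refine Submodule.subset_span ⟨E.dual.res h D, F.T.res h v, ?_⟩
      refine Subtype.ext (LocalOp.ext' fun W hW t => ?_)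
      change D.1.app W _ (C.nabla _ t) = D.1.app W _ (C.nabla _ t)
      rw [F.T.res_comp]
    | zero => rw [map_zero]; exact zero_mem _
    | add P Q _ _ hP hQ => rw [map_add]; exact add_mem hP hQ
    | smul f P _ hP =>
      rw [(PMod.Diff 1 E (PMod.unit X)).res_smul]
      exact Submodule.smul_mem _ _ hP

/-- The transverse differential operators `𝒟¹_{X/F}(∇, 𝒪_X) = 𝒟¹_X(E, 𝒪_X) / S¹(∇)` (as a
presheaf quotient; its dual is that of the sheaf quotient). -/
abbrev transverseDiff : PMod X := C.prolongSub.quot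

/-- The first sheaf of transverse jets `𝒫¹_{X/F}(∇) = 𝒟¹_{X/F}(∇, 𝒪_X)^*`. -/
abbrev transverseJet : PMod X := C.transverseDiff.dual

/-- The value `ξ(D)` of a transverse jet on (the class of) a differential operator. -/
def jetEval {U : X.Op} (ξ : C.transverseJet.sec U) (D : (PMod.Diff 1 E (PMod.unit X)).sec U) :
    X.O U :=
  PMod.Hom.eval ξ (Submodule.Quotient.mk D)

/-- The operator `[v, D] = v ∘ D - D ∘ ∇_v` on differential operators of order `≤ 1`. -/
def ad {U : X.Op} (v : F.T.sec U) (D : (PMod.Diff 1 E (PMod.unit X)).sec U) :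
    (PMod.Diff 1 E (PMod.unit X)).sec U :=
  ⟨v.1.1.comp D.1 - D.1.comp (C.nablaOp v), LocalOp.isDiffOp_one_iff.2 fun V h f g s => by
    have h1 := fun a b t => LocalOp.isDiffOp_one_iff.1 D.2 V h a b t
    have hv : ∀ a b : X.O V, v.1.1.app V h (a * b) = a * v.1.1.app V h b + b * v.1.1.app V h a :=
      v.1.2 V h
    have hn := fun a t => C.nablaOp_smul v h a t
    rw [LocalOp.sub_app, LocalOp.sub_app, LocalOp.sub_app, LocalOp.sub_app]
    have e1 : D.1.app V h (f • g • s) = f * D.1.app V h (g • s) +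
        g * (D.1.app V h (f • s) - f * D.1.app V h s) := sub_eq_iff_eq_add'.1 (h1 f g s)
    have e2 : D.1.app V h (f • g • (C.nablaOp v).app V h s) =
        f * D.1.app V h (g • (C.nablaOp v).app V h s) +
        g * (D.1.app V h (f • (C.nablaOp v).app V h s) - f * D.1.app V h ((C.nablaOp v).app V h s)) :=
      sub_eq_iff_eq_add'.1 (h1 f g _)
    have e3 : D.1.app V h (f • v.1.1.app V h g • s) =
        f * D.1.app V h (v.1.1.app V h g • s) +
        v.1.1.app V h g * (D.1.app V h (f • s) - f * D.1.app V h s) :=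
      sub_eq_iff_eq_add'.1 (h1 f _ s)
    have e4 : D.1.app V h (g • v.1.1.app V h f • s) =
        g * D.1.app V h (v.1.1.app V h f • s) +
        v.1.1.app V h f * (D.1.app V h (g • s) - g * D.1.app V h s) :=
      sub_eq_iff_eq_add'.1 (h1 g _ s)
    change v.1.1.app V h (D.1.app V h (f • g • s)) -
        D.1.app V h ((C.nablaOp v).app V h (f • g • s)) -
      f * (v.1.1.app V h (D.1.app V h (g • s)) - D.1.app V h ((C.nablaOp v).app V h (g • s))) =
      g * (v.1.1.app V h (D.1.app V h (f • s)) - D.1.app V h ((C.nablaOp v).app V h (f • s)) -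
        f * (v.1.1.app V h (D.1.app V h s) - D.1.app V h ((C.nablaOp v).app V h s)))
    rw [hn, hn, hn, smul_add, smul_comm (v.1.1.app V h f) g s, map_add, map_add, map_add, map_add,
      e1, e2, e3, e4]
    have a1 := hv f (D.1.app V h (g • s))
    have a2 := hv g (D.1.app V h (f • s) - f * D.1.app V h s)
    have a3 := hv f (D.1.app V h s)
    rw [map_sub] at a2
    rw [map_add, a1, a2, a3]
    ring⟩

/-- For `D : E → 𝒪_X` linear, `[v, D] = v ∘ D - D ∘ ∇_v` is again linear. -/
def adLinear {U : X.Op} (v : F.T.sec U) (D : E.dual.sec U) : E.dual.sec U :=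
  ⟨v.1.1.comp D.1 - D.1.comp (C.nablaOp v), fun V h f s => by
    have h1 : ∀ (a : X.O V) (t : E.sec V), D.1.app V h (a • t) = a * D.1.app V h t := D.2 V h
    have hv : ∀ a b : X.O V, v.1.1.app V h (a * b) = a * v.1.1.app V h b + b * v.1.1.app V h a :=
      v.1.2 V h
    rw [LocalOp.sub_app, LocalOp.sub_app]
    change v.1.1.app V h (D.1.app V h (f • s)) - D.1.app V h ((C.nablaOp v).app V h (f • s)) =
      f * (v.1.1.app V h (D.1.app V h s) - D.1.app V h ((C.nablaOp v).app V h s))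
    rw [C.nablaOp_smul v h f s, map_add, h1, h1, h1, hv]
    ring⟩

theorem ad_smul {U : X.Op} (v : F.T.sec U) (f : X.O U)
    (D : (PMod.Diff 1 E (PMod.unit X)).sec U) :
    C.ad v (f • D) = vderiv v.1 f • D + f • C.ad v D := by
  refine Subtype.ext (LocalOp.ext' fun V h s => ?_)
  have hv : ∀ a b : X.O V, v.1.1.app V h (a * b) = a * v.1.1.app V h b + b * v.1.1.app V h a :=
    v.1.2 V h
  have hr : v.1.1.app V h (X.resO h f) = X.resO h (vderiv v.1 f) := v.1.1.map_res le_rfl h f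
  change (v.1.1.comp (f • D.1) - (f • D.1).comp (C.nablaOp v)).app V h s =
    (vderiv v.1 f • D.1).app V h s + (f • (v.1.1.comp D.1 - D.1.comp (C.nablaOp v))).app V h s
  rw [LocalOp.smul_app, LocalOp.smul_app, LocalOp.sub_app, LocalOp.sub_app]
  change v.1.1.app V h (X.resO h f * D.1.app V h s) -
      X.resO h f * D.1.app V h ((C.nablaOp v).app V h s) =
    X.resO h (vderiv v.1 f) * D.1.app V h s +
      X.resO h f * (v.1.1.app V h (D.1.app V h s) - D.1.app V h ((C.nablaOp v).app V h s))
  rw [hv, hr]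
  ring

theorem ad_add {U : X.Op} (v : F.T.sec U) (D D' : (PMod.Diff 1 E (PMod.unit X)).sec U) :
    C.ad v (D + D') = C.ad v D + C.ad v D' := by
  refine Subtype.ext (LocalOp.ext' fun V h s => ?_)
  change v.1.1.app V h (D.1.app V h s + D'.1.app V h s) -
      (D.1.app V h ((C.nablaOp v).app V h s) + D'.1.app V h ((C.nablaOp v).app V h s)) =
    (v.1.1.app V h (D.1.app V h s) - D.1.app V h ((C.nablaOp v).app V h s)) +
      (v.1.1.app V h (D'.1.app V h s) - D'.1.app V h ((C.nablaOp v).app V h s))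
  rw [map_add]
  abel

theorem ad_res {U V : X.Op} (h : V ≤ U) (v : F.T.sec U)
    (D : (PMod.Diff 1 E (PMod.unit X)).sec U) :
    C.ad (F.T.res h v) ((PMod.Diff 1 E (PMod.unit X)).res h D) =
      (PMod.Diff 1 E (PMod.unit X)).res h (C.ad v D) := by
  refine Subtype.ext (LocalOp.ext' fun W hW s => ?_)
  exact congrArg (fun u => v.1.1.app W (hW.trans h) (D.1.app W (hW.trans h) s) -
    D.1.app W (hW.trans h) (C.nabla u s)) (F.T.res_comp h hW v)

theorem ad_prolong (hC : C.IsFlat) {U : X.Op} (w v : F.T.sec U) (D : E.dual.sec U) :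
    C.ad w (C.prolong D v) = C.prolong (C.adLinear w D) v + C.prolong D (F.lie w v) := by
  refine Subtype.ext (LocalOp.ext' fun V h s => ?_)
  have hf := hC V (F.T.res h w) (F.T.res h v) s
  have hl : F.lie (F.T.res h w) (F.T.res h v) = F.T.res h (F.lie w v) := rfl
  rw [hl] at hf
  change w.1.1.app V h (D.1.app V h (C.nabla (F.T.res h v) s)) -
      D.1.app V h (C.nabla (F.T.res h v) (C.nabla (F.T.res h w) s)) =
    w.1.1.app V h (D.1.app V h (C.nabla (F.T.res h v) s)) -
      D.1.app V h (C.nabla (F.T.res h w) (C.nabla (F.T.res h v) s)) +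
      D.1.app V h (C.nabla (F.T.res h (F.lie w v)) s)
  rw [hf, map_sub]
  abel

/-- For `∇` flat, `[v, ·]` preserves `S¹(∇)`. -/
theorem ad_mem (hC : C.IsFlat) {U : X.Op} (w : F.T.sec U)
    {P : (PMod.Diff 1 E (PMod.unit X)).sec U} (hP : P ∈ C.prolongSub.carrier U) :
    C.ad w P ∈ C.prolongSub.carrier U := by
  change P ∈ Submodule.span _ _ at hP
  induction hP using Submodule.span_induction with
  | mem P hP =>
    obtain ⟨D, v, rfl⟩ := hP
    rw [C.ad_prolong hC]
    exact add_mem (Submodule.subset_span ⟨_, _, rfl⟩) (Submodule.subset_span ⟨_, _, rfl⟩)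
  | zero =>
    have : C.ad w 0 = 0 := by
      have := C.ad_add w 0 0
      rw [add_zero] at this
      exact left_eq_add.1 this
    rw [this]; exact zero_mem _
  | add P Q _ _ hP hQ => rw [ad_add]; exact add_mem hP hQ
  | smul f P h hP =>
    rw [ad_smul]
    exact add_mem (Submodule.smul_mem _ _ h) (Submodule.smul_mem _ _ hP)

/-- The partial connection `(∇, d_F)¹` on transverse differential operators in the direction `v`:
the class of `D` is sent to the class of `v ∘ D - D ∘ ∇_v`. -/
def transverseNabla (hC : C.IsFlat) {U : X.Op} (v : F.T.sec U) :
    LocalOp C.transverseDiff C.transverseDiff U where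
  app V h := QuotientAddGroup.map (C.prolongSub.carrier V).toAddSubgroup
    (C.prolongSub.carrier V).toAddSubgroup
    (AddMonoidHom.mk' (C.ad (F.T.res h v)) (C.ad_add _)) (fun _ hs => C.ad_mem hC _ hs)
  map_const V h c s := by
    induction s using Submodule.Quotient.induction_on with
    | _ s =>
      refine congrArg Submodule.Quotient.mk ?_
      change C.ad _ (X.const V c • s) = X.const V c • C.ad _ s
      rw [ad_smul, vderiv_const, zero_smul, zero_add]
  map_res hV hW s := by
    induction s using Submodule.Quotient.induction_on with
    | _ s =>
      refine congrArg Submodule.Quotient.mk ?_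
      rw [← F.T.res_comp hV hW]
      exact C.ad_res hW _ s

/-- The partial connection `∇¹` on the transverse jets, dual to the one on transverse differential
operators: `∇¹_v(ξ)(D) = v(ξ(D)) - ξ((∇, d_F)¹_v(D))`. -/
def jetNabla (hC : C.IsFlat) {U : X.Op} (v : F.T.sec U) (ξ : C.transverseJet.sec U) :
    C.transverseJet.sec U :=
  ⟨v.1.1.comp ξ.1 - ξ.1.comp (C.transverseNabla hC v), fun V h f s => by
    have hξ : ∀ (a : X.O V) (t : C.transverseDiff.sec V),
        ξ.1.app V h (a • t) = a * ξ.1.app V h t := ξ.2 V h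
    have hv : ∀ a b : X.O V, v.1.1.app V h (a * b) = a * v.1.1.app V h b + b * v.1.1.app V h a :=
      v.1.2 V h
    have ht : (C.transverseNabla hC v).app V h (f • s) =
        v.1.1.app V h f • s + f • (C.transverseNabla hC v).app V h s := by
      induction s using Submodule.Quotient.induction_on with
      | _ s => exact congrArg Submodule.Quotient.mk (C.ad_smul (F.T.res h v) f s)
    change v.1.1.app V h (ξ.1.app V h (f • s)) -
        ξ.1.app V h ((C.transverseNabla hC v).app V h (f • s)) =
      f * (v.1.1.app V h (ξ.1.app V h s) - ξ.1.app V h ((C.transverseNabla hC v).app V h s))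
    rw [ht, map_add, hξ, hξ, hξ, hv]
    ring⟩

end PartialConnection

/-! ## Effective divisors and twists -/

variable (X) in
/-- An effective divisor `D ≥ 0`, given by its ideal sheaf `𝒪_X(-D)`, which is locally generated by
a single nonzerodivisor. -/
structure EffectiveDivisor where
  ideal : SubPMod (PMod.unit X)
  isSubsheaf : ideal.IsSubsheaf
  locallyPrincipal : ∀ x : X.toRingedSpace, ∃ (U : X.Op) (f : X.O U), x ∈ U ∧
    ∀ (V : X.Op) (h : V ≤ U), X.resO h f ∈ nonZeroDivisors (X.O V) ∧
      ∀ g : X.O V, g ∈ ideal.carrier V ↔ ∃ a : X.O V, g = a * X.resO h f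

namespace EffectiveDivisor

variable (D : EffectiveDivisor X) (E : PMod X)

/-- The submodule of `E(U)` generated by the products of functions in `𝒪_X(-D)(U)` with
sections of `E`. -/
def mulSpan (U : X.Op) : Submodule (X.O U) (E.sec U) :=
  Submodule.span (X.O U) {m | ∃ f : X.O U, f ∈ D.ideal.carrier U ∧ ∃ t : E.sec U, m = f • t}

theorem mulSpan_res {U V : X.Op} (h : V ≤ U) {s : E.sec U} (hs : s ∈ D.mulSpan E U) :
    E.res h s ∈ D.mulSpan E V := by
  change s ∈ Submodule.span _ _ at hs
  induction hs using Submodule.span_induction with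
  | mem m hm =>
    obtain ⟨f, hf, t, rfl⟩ := hm
    rw [E.res_smul]
    exact Submodule.subset_span ⟨_, D.ideal.res_mem h hf, _, rfl⟩
  | zero => rw [map_zero]; exact zero_mem _
  | add a b _ _ ha hb => rw [map_add]; exact add_mem ha hb
  | smul f a _ ha => rw [E.res_smul]; exact Submodule.smul_mem _ _ ha

/-- `E(-D) ⊆ E`, for `E` torsion free: the sections of `E` that are locally combinations of products
of functions in `𝒪_X(-D)` with sections of `E`. -/
def twistDown : SubPMod E where
  carrier U :=
    { carrier := {s | ∀ x ∈ U, ∃ (V : X.Op) (h : V ≤ U), x ∈ V ∧ E.res h s ∈ D.mulSpan E V}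
      zero_mem' := fun x hx => ⟨U, le_rfl, hx, by rw [map_zero]; exact zero_mem _⟩
      add_mem' := fun {a b} ha hb x hx => by
        obtain ⟨V, hV, hxV, h1⟩ := ha x hx
        obtain ⟨W, hW, hxW, h2⟩ := hb x hx
        refine ⟨V ⊓ W, inf_le_left.trans hV, ⟨hxV, hxW⟩, ?_⟩
        rw [map_add]
        refine add_mem ?_ ?_
        · rw [← E.res_comp hV inf_le_left]; exact D.mulSpan_res E _ h1
        · rw [← E.res_comp hW inf_le_right]; exact D.mulSpan_res E _ h2
      smul_mem' := fun f a ha x hx => by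
        obtain ⟨V, hV, hxV, h1⟩ := ha x hx
        exact ⟨V, hV, hxV, by rw [E.res_smul]; exact Submodule.smul_mem _ _ h1⟩ }
  res_mem {U V} h s hs x hx := by
    obtain ⟨W, hW, hxW, h1⟩ := hs x (h hx)
    refine ⟨V ⊓ W, inf_le_left, ⟨hx, hxW⟩, ?_⟩
    rw [E.res_comp, ← E.res_comp hW inf_le_right]
    exact D.mulSpan_res E _ h1

/-- `E(D) = E ⊗ 𝒪_X(D)`, realized as `ℋom(𝒪_X(-D), E)`. -/
abbrev twistUp : PMod X := PMod.Hom D.ideal.toPMod E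

/-- The natural inclusion `E → E(D)`: a section `s` is sent to `f ↦ f • s`. -/
def incl {E : PMod X} {U : X.Op} (s : E.sec U) : (D.twistUp E).sec U :=
  ⟨{ app := fun V h => ((AddMonoidHom.flip (smulAddHom (X.O V) (E.sec V))) (E.res h s)).comp
        (D.ideal.carrier V).toAddSubgroup.subtype
     map_const := fun V h c f => mul_smul (X.const V c) f.1 (E.res h s)
     map_res := fun {V W} hV hW f => by
      change X.resO hW f.1 • E.res (hW.trans hV) s = E.res hW (f.1 • E.res hV s)
      rw [E.res_smul, E.res_comp] },
    fun V h a f => mul_smul a f.1 (E.res h s)⟩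

/-- `D` is `F`-invariant: `v(f) ∈ 𝒪_X(-D)` for `v ∈ T_F` and `f ∈ 𝒪_X(-D)`; for a local equation `f`
of `D` this says that `v(f)/f` is holomorphic. -/
def IsInvariant (F : Foliation X) : Prop :=
  ∀ (U : X.Op) (v : F.T.sec U) (f : X.O U), f ∈ D.ideal.carrier U →
    vderiv v.1 f ∈ D.ideal.carrier U

variable {D E}

/-- If `D` is `F`-invariant, then `∇_v` preserves `E(-D)`. -/
theorem nabla_mem_twistDown {F : Foliation X} (hD : D.IsInvariant F) (C : PartialConnection F E)
    {U : X.Op} (v : F.T.sec U) {s : E.sec U} (hs : s ∈ (D.twistDown E).carrier U) :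
    C.nabla v s ∈ (D.twistDown E).carrier U := by
  intro x hx
  obtain ⟨V, hV, hxV, h1⟩ := hs x hx
  refine ⟨V, hV, hxV, ?_⟩
  rw [← C.nabla_res hV]
  generalize E.res hV s = t at h1
  change t ∈ Submodule.span _ _ at h1
  induction h1 using Submodule.span_induction with
  | mem m hm =>
    obtain ⟨f, hf, t, rfl⟩ := hm
    rw [C.nabla_smul]
    exact add_mem (Submodule.subset_span ⟨_, hD V _ f hf, t, rfl⟩)
      (Submodule.subset_span ⟨f, hf, _, rfl⟩)
  | zero => rw [C.nabla_zero]; exact zero_mem _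
  | add a b _ _ ha hb => rw [C.nabla_add]; exact add_mem ha hb
  | smul f a h ha =>
    rw [C.nabla_smul]
    exact add_mem (Submodule.smul_mem _ _ h) (Submodule.smul_mem _ _ ha)

end EffectiveDivisor

/-! ## Meromorphic connections -/

/-- A meromorphic connection `E → Ω¹_X(D)(E)` with poles on `D`. As `T_X` is locally free,
`Ω¹_X(D) ⊗ E` is realized as `ℋom(T_X, E(D))`. -/
structure MeromorphicConnection (D : EffectiveDivisor X) (E : PMod X) where
  op : LocalOp E (PMod.Hom (tangent X) (D.twistUp E)) ⊤
  leibniz : ∀ (U : X.Op) (f : X.O U) (s : E.sec U) (v : (tangent X).sec U),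
    PMod.Hom.eval (op.app U le_top (f • s)) v =
      D.incl (vderiv v f • s) + f • PMod.Hom.eval (op.app U le_top s) v

namespace MeromorphicConnection

variable {D : EffectiveDivisor X} {E : PMod X} (N : MeromorphicConnection D E)

/-- `∇_v(s)`, a section of `E(D)`. -/
def nabla {U : X.Op} (v : (tangent X).sec U) (s : E.sec U) : (D.twistUp E).sec U :=
  PMod.Hom.eval (N.op.app U le_top s) v

/-- `N` extends the partial connection `C`: for `v ∈ T_F` the section `∇_v(s)` of `E(D)` is the
section `C_v(s)` of `E`. -/
def Extends {F : Foliation X} (C : PartialConnection F E) : Prop :=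
  ∀ (U : X.Op) (v : F.T.sec U) (s : E.sec U), N.nabla v.1 s = D.incl (C.nabla v s)

/-- The extension of `∇_v` to a map `E(D) → E(2D)` by the Leibniz rule: for a section `τ` of `E(D)`
and `f, g ∈ 𝒪_X(-D)`, the section `g f ∇_v(τ) = g (∇_v(f τ) - v(f) τ)` of `E`. -/
def nablaTwist {U : X.Op} (v : (tangent X).sec U) (τ : (D.twistUp E).sec U)
    (f g : D.ideal.toPMod.sec U) : E.sec U :=
  PMod.Hom.eval (N.nabla v (PMod.Hom.eval τ f)) g - vderiv v f.1 • PMod.Hom.eval τ g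

/-- Flatness: the curvature `E → Ω²_X(2D)(E)`,
`∇_{[v,w]} - ∇_v ∘ ∇_w + ∇_w ∘ ∇_v`, vanishes. The identity in `E(2D)` is expressed by multiplying
with sections `f, g` of `𝒪_X(-D)`. -/
def IsFlat : Prop :=
  ∀ (U : X.Op) (v w : (tangent X).sec U) (s : E.sec U) (f g : D.ideal.toPMod.sec U),
    (g.1 : X.O U) • PMod.Hom.eval (N.nabla (bracket v w) s) f =
      N.nablaTwist v (N.nabla w s) f g - N.nablaTwist w (N.nabla v s) f g

end MeromorphicConnection

/-- The meromorphic connections with poles on `D` that extend the partial connection `C`. -/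
structure MeromorphicExtension {F : Foliation X} {E : PMod X} (C : PartialConnection F E)
    (D : EffectiveDivisor X) where
  conn : MeromorphicConnection D E
  isExtension : conn.Extends C

/-! ## Meromorphic splittings -/

namespace PMod

variable {E : PMod X}

/-- The principal symbol of a differential operator `D : E → 𝒪_X` of order `≤ 1`, evaluated on a
section `s`: the vector field `f ↦ D(f • s) - f • D(s)`. -/
def symbol {U : X.Op} (D : (Diff 1 E (unit X)).sec U) (s : E.sec U) : (tangent X).sec U :=
  ⟨{ app := fun V h => AddMonoidHom.mk'
        (fun f => D.1.app V h (f • E.res h s) - f * D.1.app V h (E.res h s))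
        (fun a b => by
          rw [add_smul, map_add, add_mul]
          abel)
     map_const := fun V h c f => by
      have h1 : D.1.app V h (X.const V c • f • E.res h s) =
        X.const V c * D.1.app V h (f • E.res h s) := D.1.map_const V h c _
      change D.1.app V h ((X.const V c * f) • E.res h s) -
          X.const V c * f * D.1.app V h (E.res h s) =
        X.const V c * (D.1.app V h (f • E.res h s) - f * D.1.app V h (E.res h s))
      rw [mul_smul, h1]
      ring
     map_res := fun {V W} hV hW f => by
      have h1 : D.1.app W (hW.trans hV) (E.res hW (f • E.res hV s)) =
        X.resO hW (D.1.app V hV (f • E.res hV s)) := D.1.map_res hV hW _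
      have h2 : D.1.app W (hW.trans hV) (E.res hW (E.res hV s)) =
        X.resO hW (D.1.app V hV (E.res hV s)) := D.1.map_res hV hW _
      rw [E.res_smul, E.res_comp] at h1
      rw [E.res_comp] at h2
      change D.1.app W (hW.trans hV) (X.resO hW f • E.res (hW.trans hV) s) -
          X.resO hW f * D.1.app W (hW.trans hV) (E.res (hW.trans hV) s) =
        X.resO hW (D.1.app V hV (f • E.res hV s) - f * D.1.app V hV (E.res hV s))
      rw [h1, h2, map_sub, map_mul] },
    fun V h f g => by
      have h1 : D.1.app V h (f • g • E.res h s) - f * D.1.app V h (g • E.res h s) =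
          g * (D.1.app V h (f • E.res h s) - f * D.1.app V h (E.res h s)) :=
        LocalOp.isDiffOp_one_iff.1 D.2 V h f g (E.res h s)
      change D.1.app V h ((f * g) • E.res h s) - f * g * D.1.app V h (E.res h s) =
        f * (D.1.app V h (g • E.res h s) - g * D.1.app V h (E.res h s)) +
        g * (D.1.app V h (f • E.res h s) - f * D.1.app V h (E.res h s))
      rw [mul_smul, ← h1]
      ring⟩

end PMod

namespace PartialConnection

variable {F : Foliation X} {E : PMod X} (C : PartialConnection F E)

/-- The restriction of a transverse jet `ξ` to operators of order `0`, an element of `E^{**}`. -/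
def jetBidual {U : X.Op} (ξ : C.transverseJet.sec U) : E.dual.dual.sec U :=
  ⟨{ app := fun V h => AddMonoidHom.mk'
        (fun φ => ξ.1.app V h (Submodule.Quotient.mk (PMod.ofHom φ)))
        (fun a b => map_add (ξ.1.app V h) (Submodule.Quotient.mk (PMod.ofHom a))
          (Submodule.Quotient.mk (PMod.ofHom b)))
     map_const := fun V h c φ => ξ.1.map_const V h c (Submodule.Quotient.mk (PMod.ofHom φ))
     map_res := fun {V W} hV hW φ => ξ.1.map_res hV hW (Submodule.Quotient.mk (PMod.ofHom φ)) },
    fun V h f φ => ξ.2 V h f (Submodule.Quotient.mk (PMod.ofHom φ))⟩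

/-- The projection `π : 𝒫¹_{X/F}(∇) → E`, for `E` reflexive: the composition of
`𝒫¹_{X/F}(∇) → E^{**}` with the inverse of `E → E^{**}`. -/
noncomputable def jetProj (hE : E.IsReflexive) {U : X.Op} (ξ : C.transverseJet.sec U) : E.sec U :=
  (Equiv.ofBijective _ (hE U)).symm (C.jetBidual ξ)

end PartialConnection

/-- A meromorphic splitting with poles on `D` of `0 → N*_F(E) → 𝒫¹_{X/F}(∇) → E`: an `𝒪_X`-linear
morphism `σ : E(-D) → 𝒫¹_{X/F}(∇)` with `π ∘ σ` the inclusion `E(-D) ⊆ E`. -/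
structure MeromorphicSplitting {F : Foliation X} {E : PMod X} (C : PartialConnection F E)
    (hE : E.IsReflexive) (D : EffectiveDivisor X) where
  mor : PMod.Mor (D.twistDown E).toPMod C.transverseJet
  proj_comp : ∀ (U : X.Op) (s : (D.twistDown E).toPMod.sec U),
    C.jetProj hE (mor.app U s) = s.1

namespace MeromorphicSplitting

variable {F : Foliation X} {E : PMod X} {C : PartialConnection F E} {hE : E.IsReflexive}
  {D : EffectiveDivisor X}

/-- `σ` is horizontal: `σ(∇_v(s)) = ∇¹_v(σ(s))` for `v ∈ T_F` and `s ∈ E(-D)`, where `E(-D)` carries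
the restriction of `∇`. -/
def IsHorizontal (σ : MeromorphicSplitting C hE D) (hC : C.IsFlat) (hD : D.IsInvariant F) : Prop :=
  ∀ (U : X.Op) (v : F.T.sec U) (s : (D.twistDown E).toPMod.sec U),
    σ.mor.app U ⟨C.nabla v s.1, EffectiveDivisor.nabla_mem_twistDown hD C v s.2⟩ =
      C.jetNabla hC v (σ.mor.app U s)

/-- `σ` is the splitting `σ_N = d¹ - N` associated with the meromorphic connection `N`: whenever
`N(s) = ∑ ω_i ⊗ t_i` with `s ∈ E(-D)`, one has `σ(s) = 1 ⊗ s - ∑ ω_i ⊗ t_i`. Here jets are viewed as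
functionals on differential operators `P : E → 𝒪_X` of order `≤ 1`, where `1 ⊗ s` is `P ↦ P(s)` and
`ω ⊗ t` is `P ↦ ω(symbol of P at t)`, that is, `df ⊗ t` is `P ↦ P(f t) - f P(t)`. -/
def IsAssociated (σ : MeromorphicSplitting C hE D) (N : MeromorphicConnection D E) : Prop :=
  ∀ (U : X.Op) (s : (D.twistDown E).toPMod.sec U) (n : ℕ) (ω : Fin n → (Omega X).sec U)
    (t : Fin n → E.sec U),
    (∀ (V : X.Op) (h : V ≤ U) (v : (tangent X).sec V),
      N.nabla v (E.res h s.1) =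
        D.incl (∑ i, PMod.Hom.eval ((Omega X).res h (ω i)) v • E.res h (t i))) →
    ∀ P : (PMod.Diff 1 E (PMod.unit X)).sec U,
      C.jetEval (σ.mor.app U s) P =
        P.1.app U le_rfl s.1 - ∑ i, PMod.Hom.eval (ω i) (PMod.symbol P (t i))

end MeromorphicSplitting

/-! A connection and a splitting carry the same information, exchanged by the single formula σ(s)(w
∘ φ) = w(φ(s)) - φ(∇_w s), for w a vector field, φ a functional on E and s in E(-D). Since T_X is
locally free, an operator of order ≤ 1 is locally a functional plus a sum of operators e_i ∘ φ_i
(`PMod.frame_decomposition`). A jet is therefore determined by its values on functionals, which π ∘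
σ = inclusion prescribes, and on the operators w ∘ φ, which the formula prescribes
(`PartialConnection.jet_ext`).

From connection to splitting: on E(-D) the connection has values in E
(`MeromorphicConnection.exists_lift`). In a frame e_i with coframe e^i put σ(s)(P) = P(s) - ∑
e^i(symbol of P at ∇_{e_i} s). The sum is a trace, hence independent of the frame, and the values
glue. The Leibniz term of P and that of the connection cancel, so σ is 𝒪-linear (`smul_splitVal`).
It kills φ ∘ ∇_v because this operator has symbol φ ⊗ v and the connection extends the partial one
(`splitVal_prolong`).

From splitting to connection: for fixed w and s, φ ↦ w(φ(s)) - σ(s)(w ∘ φ) is 𝒪-linear, so by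
reflexivity it is evaluation at a section of E, the derivative of s
(`MeromorphicSplitting.exists_covariant`). For a section s of E and f in 𝒪_X(-D), the Leibniz rule
then forces f ∇_w s = ∇_w(f s) - w(f) s. In directions of F one recovers the partial connection,
because v ∘ φ differs from φ ∘ ∇_v by a functional (`covariant_foliation`).

Flatness: evaluated on w ∘ φ, the defect of horizontality is φ applied to ∇_{[v,w]} - ∇_v ∇_w + ∇_w
∇_v, so σ is horizontal exactly when the curvature vanishes as soon as one argument lies in T_F
(`isHorizontal_iff_curvature`). The curvature is alternating and 𝒪-bilinear in the vector fields. In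
codimension one, T_X generically has a frame with at most one member outside T_F, so the curvature
then vanishes generically, hence everywhere because E is reflexive
(`MeromorphicConnection.isFlat_of_curvature`).

Only two properties of X enter: local frames of T_X, and invertibility of nonzero functions on some
nonempty open set. On a manifold the frames come from a holomorphic Hadamard lemma. On a smooth
scheme they come from the free module of Kähler differentials of a standard smooth algebra, whose
dual derivations extend to the sheaf by the quotient rule. -/

/-! ## Gluing sections -/

namespace PMod

/-- The sheaf condition for a presheaf of modules, in terms of unique gluing. -/
def Glues (M : PMod X) : Prop :=
  ∀ {U : X.Op} {ι : Type} (V : ι → X.Op) (hV : ∀ i, V i ≤ U), (∀ x ∈ U, ∃ i, x ∈ V i) →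
    ∀ s : ∀ i, M.sec (V i),
      (∀ i j, M.res (inf_le_left : V i ⊓ V j ≤ V i) (s i) = M.res inf_le_right (s j)) →
      ∃! t : M.sec U, ∀ i, M.res (hV i) t = s i

namespace Glues

variable {M : PMod X}

/-- Both sections glue the local restrictions of `t`, so the uniqueness half of gluing applies. -/
theorem eq_of_locally_eq (hM : M.Glues) {U : X.Op} {s t : M.sec U}
    (h : ∀ x ∈ U, ∃ (V : X.Op) (hV : V ≤ U), x ∈ V ∧ M.res hV s = M.res hV t) : s = t := by
  choose V hV hx hst using h
  refine (hM (ι := U) (fun x => V x.1 x.2) (fun x => hV x.1 x.2)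
    (fun x hx' => ⟨⟨x, hx'⟩, hx x hx'⟩) (fun x => M.res (hV x.1 x.2) t)
    (fun i j => ?_)).unique (fun i => hst _ _) (fun i => rfl)
  rw [M.res_comp, M.res_comp]

/-- Sections characterized by a restrictive relation with unique local solutions glue. -/
theorem exists_of_locally (hM : M.Glues) {U : X.Op} (R : ∀ V : X.Op, V ≤ U → M.sec V → Prop)
    (hres : ∀ (V W : X.Op) (hV : V ≤ U) (hW : W ≤ V) (s : M.sec V), R V hV s →
      R W (hW.trans hV) (M.res hW s))
    (huniq : ∀ (V : X.Op) (hV : V ≤ U) (s t : M.sec V), R V hV s → R V hV t → s = t)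
    (hex : ∀ x ∈ U, ∃ (V : X.Op) (hV : V ≤ U) (s : M.sec V), x ∈ V ∧ R V hV s) :
    ∃ t : M.sec U, ∀ (V : X.Op) (hV : V ≤ U) (s : M.sec V), R V hV s → M.res hV t = s := by
  choose V hV s hx hs using hex
  obtain ⟨t, ht, -⟩ := hM (ι := U) (fun x => V x.1 x.2) (fun x => hV x.1 x.2)
    (fun x hx' => ⟨⟨x, hx'⟩, hx x hx'⟩) (fun x => s x.1 x.2)
    (fun i j => huniq _ (inf_le_left.trans (hV i.1 i.2)) _ _
      (hres _ _ _ _ _ (hs _ _)) (hres _ _ _ _ _ (hs _ _)))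
  refine ⟨t, fun W hW r hr => hM.eq_of_locally_eq fun x hx' =>
    ⟨W ⊓ V x (hW hx'), inf_le_left, ⟨hx', hx x _⟩, ?_⟩⟩
  have h1 := ht ⟨x, hW hx'⟩
  -- Over the intersection, `r` and the chosen local solution both restrict to solutions of `R`, so
  -- they agree there.
  refine huniq _ (inf_le_left.trans hW) _ _ ?_ (hres _ _ _ _ _ hr)
  rw [M.res_comp, ← M.res_comp (hV x (hW hx')) inf_le_right, h1]
  exact hres _ _ _ _ _ (hs _ _)

end Glues

theorem glues_unit : (PMod.unit X).Glues := by
  intro U ι V hV hU s hs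
  refine X.toRingedSpace.sheaf.existsUnique_gluing' V U (fun i => homOfLE (hV i))
    (fun x hx => ?_) s (fun i j => ?_)
  · obtain ⟨i, hi⟩ := hU x hx
    exact Opens.mem_iSup.2 ⟨i, hi⟩
  · exact hs i j

theorem _root_.SheafOfModules.glues (E : SheafOfModules.{0} X.ringSheaf) : E.toPMod.Glues := by
  intro U ι V hV hU s hs
  refine TopCat.Sheaf.existsUnique_gluing' (X := X.toRingedSpace) ⟨E.val.presheaf, E.isSheaf⟩ V U
    (fun i => homOfLE (hV i)) (fun x hx => ?_) s (fun i j => ?_)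
  · obtain ⟨i, hi⟩ := hU x hx
    exact Opens.mem_iSup.2 ⟨i, hi⟩
  · exact hs i j

/-! ## Evaluation of linear morphisms -/

section Eval

variable {E G : PMod X} {U V : X.Op}

theorem Hom.eval_smul (φ : (Hom E G).sec U) (f : X.O U) (s : E.sec U) :
    Hom.eval φ (f • s) = f • Hom.eval φ s := φ.2 U le_rfl f s

theorem Hom.eval_add (φ : (Hom E G).sec U) (s t : E.sec U) :
    Hom.eval φ (s + t) = Hom.eval φ s + Hom.eval φ t := map_add (φ.1.app U le_rfl) s t

theorem Hom.eval_sub (φ : (Hom E G).sec U) (s t : E.sec U) :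
    Hom.eval φ (s - t) = Hom.eval φ s - Hom.eval φ t := map_sub (φ.1.app U le_rfl) s t

theorem Hom.eval_zero (φ : (Hom E G).sec U) : Hom.eval φ (0 : E.sec U) = 0 :=
  map_zero (φ.1.app U le_rfl)

theorem Hom.eval_sum {ι : Type*} (a : Finset ι) (φ : (Hom E G).sec U) (s : ι → E.sec U) :
    Hom.eval φ (∑ i ∈ a, s i) = ∑ i ∈ a, Hom.eval φ (s i) := map_sum (φ.1.app U le_rfl) s a

theorem Hom.add_eval (φ ψ : (Hom E G).sec U) (s : E.sec U) :
    Hom.eval (φ + ψ) s = Hom.eval φ s + Hom.eval ψ s := rfl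

theorem Hom.sub_eval (φ ψ : (Hom E G).sec U) (s : E.sec U) :
    Hom.eval (φ - ψ) s = Hom.eval φ s - Hom.eval ψ s := rfl

theorem Hom.smul_eval (f : X.O U) (φ : (Hom E G).sec U) (s : E.sec U) :
    Hom.eval (f • φ) s = f • Hom.eval φ s := congrArg (· • Hom.eval φ s) (X.resO_id f)

theorem Hom.res_eval (h : V ≤ U) (φ : (Hom E G).sec U) (s : E.sec U) :
    G.res h (Hom.eval φ s) = Hom.eval ((Hom E G).res h φ) (E.res h s) :=
  (φ.1.map_res le_rfl h s).symm

theorem Hom.ext {φ ψ : (Hom E G).sec U}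
    (h : ∀ (V : X.Op) (hV : V ≤ U) (s : E.sec V),
      Hom.eval ((Hom E G).res hV φ) s = Hom.eval ((Hom E G).res hV ψ) s) : φ = ψ :=
  Subtype.ext (LocalOp.ext' h)

/-- A linear morphism from its values on sections. -/
def Hom.mk (a : ∀ V : X.Op, V ≤ U → E.sec V → G.sec V)
    (hadd : ∀ V h s t, a V h (s + t) = a V h s + a V h t)
    (hsmul : ∀ V h (f : X.O V) s, a V h (f • s) = f • a V h s)
    (hres : ∀ (V W : X.Op) (hV : V ≤ U) (hW : W ≤ V) (s : E.sec V),
      a W (hW.trans hV) (E.res hW s) = G.res hW (a V hV s)) : (Hom E G).sec U :=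
  ⟨{ app := fun V h => AddMonoidHom.mk' (a V h) (hadd V h)
     map_const := fun V h c s => hsmul V h _ s
     map_res := fun {V W} hV hW s => hres V W hV hW s }, hsmul⟩

end Eval

/-! ## Sections of reflexive sheaves -/

section Reflexive

variable {E : PMod X} {U : X.Op}

/-- Injectivity of E → E^{**}: equalities of sections of E become equalities of functions, tested by
functionals over all smaller open sets. -/
theorem IsReflexive.ext (hE : E.IsReflexive) {s t : E.sec U}
    (h : ∀ (V : X.Op) (hV : V ≤ U) (φ : E.dual.sec V),
      Hom.eval φ (E.res hV s) = Hom.eval φ (E.res hV t)) : s = t :=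
  (hE U).1 (Hom.ext fun V hV φ => h V hV φ)

/-- Surjectivity of E → E^{**}: the means of constructing sections of E from 𝒪-linear expressions in
a functional. -/
theorem IsReflexive.exists_section (hE : E.IsReflexive) (b : E.dual.dual.sec U) :
    ∃ s : E.sec U, ∀ (V : X.Op) (hV : V ≤ U) (φ : E.dual.sec V),
      Hom.eval φ (E.res hV s) = Hom.eval (E.dual.dual.res hV b) φ := by
  obtain ⟨s, hs⟩ := (hE U).2 b
  exact ⟨s, fun V hV φ => by rw [← hs]; rfl⟩

/-- Reflexive sheaves are torsion free: functionals take values in 𝒪, where `f` can be cancelled. -/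
theorem IsReflexive.smul_left_injective (hE : E.IsReflexive) {f : X.O U}
    (hf : ∀ (V : X.Op) (h : V ≤ U), X.resO h f ∈ nonZeroDivisors (X.O V)) {s t : E.sec U}
    (h : f • s = f • t) : s = t := by
  refine hE.ext fun V hV φ => ?_
  have h1 := congrArg (fun r => Hom.eval φ (E.res hV r)) h
  simp only [E.res_smul, Hom.eval_smul] at h1
  have h2 : X.resO hV f * (Hom.eval φ (E.res hV s) - Hom.eval φ (E.res hV t)) = 0 := by
    rw [mul_sub, sub_eq_zero]; exact h1
  exact sub_eq_zero.1 ((mul_left_mem_nonZeroDivisors_eq_zero_iff (hf V hV)).1 h2)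

end Reflexive

end PMod

/-! ## Vector fields -/

section VectorFields

variable {U V : X.Op}

theorem vderiv_mul (v : (tangent X).sec U) (f g : X.O U) :
    vderiv v (f * g) = f * vderiv v g + g * vderiv v f := v.2 U le_rfl f g

theorem vderiv_map_add (v : (tangent X).sec U) (f g : X.O U) :
    vderiv v (f + g) = vderiv v f + vderiv v g := map_add (v.1.app U le_rfl) f g

theorem vderiv_map_sub (v : (tangent X).sec U) (f g : X.O U) :
    vderiv v (f - g) = vderiv v f - vderiv v g := map_sub (v.1.app U le_rfl) f g

theorem vderiv_add (v w : (tangent X).sec U) (f : X.O U) :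
    vderiv (v + w) f = vderiv v f + vderiv w f := rfl

theorem vderiv_smul (a : X.O U) (v : (tangent X).sec U) (f : X.O U) :
    vderiv (a • v) f = a * vderiv v f := congrArg (· * vderiv v f) (X.resO_id a)

theorem vderiv_res (h : V ≤ U) (v : (tangent X).sec U) (f : X.O U) :
    vderiv ((tangent X).res h v) (X.resO h f) = X.resO h (vderiv v f) := v.1.map_res le_rfl h f

theorem vderiv_bracket (v w : (tangent X).sec U) (f : X.O U) :
    vderiv (bracket v w) f = vderiv v (vderiv w f) - vderiv w (vderiv v f) := rfl

theorem tangent_ext {v w : (tangent X).sec U}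
    (h : ∀ (V : X.Op) (hV : V ≤ U) (f : X.O V),
      vderiv ((tangent X).res hV v) f = vderiv ((tangent X).res hV w) f) : v = w :=
  Subtype.ext (LocalOp.ext' h)

theorem bracket_res (h : V ≤ U) (v w : (tangent X).sec U) :
    bracket ((tangent X).res h v) ((tangent X).res h w) = (tangent X).res h (bracket v w) := rfl

end VectorFields

/-! ## Operators of order at most one -/

namespace PMod

variable {E : PMod X} {U V : X.Op}

/-- The value of an operator `P : E → 𝒪_X` on a section. -/
def dapp (P : (Diff 1 E (unit X)).sec U) (s : E.sec U) : X.O U := P.1.app U le_rfl s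

theorem dapp_res (h : V ≤ U) (P : (Diff 1 E (unit X)).sec U) (s : E.sec U) :
    dapp ((Diff 1 E (unit X)).res h P) (E.res h s) = X.resO h (dapp P s) := P.1.map_res le_rfl h s

theorem dapp_map_add (P : (Diff 1 E (unit X)).sec U) (s t : E.sec U) :
    dapp P (s + t) = dapp P s + dapp P t := map_add (P.1.app U le_rfl) s t

theorem dapp_add (P Q : (Diff 1 E (unit X)).sec U) (s : E.sec U) :
    dapp (P + Q) s = dapp P s + dapp Q s := rfl

theorem dapp_smul (f : X.O U) (P : (Diff 1 E (unit X)).sec U) (s : E.sec U) :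
    dapp (f • P) s = f * dapp P s := congrArg (· * dapp P s) (X.resO_id f)

theorem dapp_ofHom (φ : E.dual.sec U) (s : E.sec U) : dapp (ofHom φ) s = Hom.eval φ s := rfl

theorem dapp_ext {P Q : (Diff 1 E (unit X)).sec U}
    (h : ∀ (V : X.Op) (hV : V ≤ U) (s : E.sec V),
      dapp ((Diff 1 E (unit X)).res hV P) s = dapp ((Diff 1 E (unit X)).res hV Q) s) : P = Q :=
  Subtype.ext (LocalOp.ext' h)

theorem vderiv_symbol (P : (Diff 1 E (unit X)).sec U) (s : E.sec U) (f : X.O U) :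
    vderiv (symbol P s) f = dapp P (f • s) - f * dapp P s := by
  change P.1.app U le_rfl (f • E.res le_rfl s) - f * P.1.app U le_rfl (E.res le_rfl s) = _
  rw [E.res_id]; rfl

theorem dapp_map_smul (P : (Diff 1 E (unit X)).sec U) (f : X.O U) (s : E.sec U) :
    dapp P (f • s) = f * dapp P s + vderiv (symbol P s) f := by
  rw [vderiv_symbol]; ring

theorem symbol_res (h : V ≤ U) (P : (Diff 1 E (unit X)).sec U) (s : E.sec U) :
    symbol ((Diff 1 E (unit X)).res h P) (E.res h s) = (tangent X).res h (symbol P s) :=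
  tangent_ext fun W hW f => by
    change P.1.app W _ (f • E.res hW (E.res h s)) - f * P.1.app W _ (E.res hW (E.res h s)) =
      P.1.app W _ (f • E.res _ s) - f * P.1.app W _ (E.res _ s)
    rw [E.res_comp]

theorem vderiv_res_symbol (h : V ≤ U) (P : (Diff 1 E (unit X)).sec U) (s : E.sec U) (f : X.O V) :
    vderiv ((tangent X).res h (symbol P s)) f =
      dapp ((Diff 1 E (unit X)).res h P) (f • E.res h s) -
        f * dapp ((Diff 1 E (unit X)).res h P) (E.res h s) := by
  rw [← symbol_res, vderiv_symbol]

theorem symbol_map_add (P : (Diff 1 E (unit X)).sec U) (s t : E.sec U) :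
    symbol P (s + t) = symbol P s + symbol P t :=
  tangent_ext fun W hW f => by
    rw [map_add, vderiv_add, vderiv_res_symbol, vderiv_res_symbol, vderiv_res_symbol, map_add,
      smul_add, dapp_map_add, dapp_map_add]
    ring

/-- This is where order ≤ 1 matters: the symbol at s is a derivation, and computing P((f a) s) by
the product rule in f a isolates the symbol at a s. -/
theorem symbol_map_smul (P : (Diff 1 E (unit X)).sec U) (a : X.O U) (s : E.sec U) :
    symbol P (a • s) = a • symbol P s :=
  tangent_ext fun W hW f => by
    rw [(tangent X).res_smul, vderiv_smul, vderiv_res_symbol, vderiv_res_symbol, E.res_smul]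
    have h1 := dapp_map_smul ((Diff 1 E (unit X)).res hW P) (f * X.resO hW a) (E.res hW s)
    rw [vderiv_mul, mul_smul] at h1
    rw [h1, dapp_map_smul _ (X.resO hW a), dapp_map_smul _ f]
    ring

theorem symbol_add (P Q : (Diff 1 E (unit X)).sec U) (s : E.sec U) :
    symbol (P + Q) s = symbol P s + symbol Q s :=
  tangent_ext fun W hW f => by
    rw [map_add, vderiv_add, vderiv_res_symbol, vderiv_res_symbol, vderiv_res_symbol, map_add,
      dapp_add, dapp_add]
    ring

theorem symbol_smul (a : X.O U) (P : (Diff 1 E (unit X)).sec U) (s : E.sec U) :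
    symbol (a • P) s = a • symbol P s :=
  tangent_ext fun W hW f => by
    rw [(tangent X).res_smul, vderiv_smul, vderiv_res_symbol, vderiv_res_symbol,
      (Diff 1 E (unit X)).res_smul, dapp_smul, dapp_smul]
    ring

theorem symbol_ofHom (φ : E.dual.sec U) (s : E.sec U) : symbol (ofHom φ) s = 0 :=
  tangent_ext fun W hW f => by
    rw [vderiv_res_symbol]
    change Hom.eval (E.dual.res hW φ) (f • E.res hW s) -
      f * Hom.eval (E.dual.res hW φ) (E.res hW s) = 0
    rw [Hom.eval_smul]
    exact sub_self _

/-- The operator `w ∘ φ` of order `≤ 1`, for `φ : E → 𝒪_X` linear and a vector field `w`. -/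
def vecComp (w : (tangent X).sec U) (φ : E.dual.sec U) : (Diff 1 E (unit X)).sec U :=
  ⟨w.1.comp φ.1, LocalOp.isDiffOp_one_iff.2 fun V h f g s => by
    have hφ : ∀ (a : X.O V) (t : E.sec V), φ.1.app V h (a • t) = a * φ.1.app V h t := φ.2 V h
    have hw : ∀ a b : X.O V, w.1.app V h (a * b) = a * w.1.app V h b + b * w.1.app V h a := w.2 V h
    change w.1.app V h (φ.1.app V h (f • g • s)) - f * w.1.app V h (φ.1.app V h (g • s)) =
      g * (w.1.app V h (φ.1.app V h (f • s)) - f * w.1.app V h (φ.1.app V h s))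
    rw [hφ, hφ, hφ, hw, hw, hw]
    ring⟩

theorem dapp_vecComp (w : (tangent X).sec U) (φ : E.dual.sec U) (s : E.sec U) :
    dapp (vecComp w φ) s = vderiv w (Hom.eval φ s) := rfl

theorem vecComp_res (h : V ≤ U) (w : (tangent X).sec U) (φ : E.dual.sec U) :
    (Diff 1 E (unit X)).res h (vecComp w φ) = vecComp ((tangent X).res h w) (E.dual.res h φ) := rfl

theorem ofHom_res (h : V ≤ U) (φ : E.dual.sec U) :
    (Diff 1 E (unit X)).res h (ofHom φ) = ofHom (E.dual.res h φ) := rfl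

/-- The product rule for w applied to f φ(s). Sums of operators w ∘ φ thus realize all symbols that
a frame can express. -/
theorem symbol_vecComp (w : (tangent X).sec U) (φ : E.dual.sec U) (s : E.sec U) :
    symbol (vecComp w φ) s = Hom.eval φ s • w :=
  tangent_ext fun W hW f => by
    rw [vderiv_res_symbol, (tangent X).res_smul, vderiv_smul, vecComp_res, dapp_vecComp,
      dapp_vecComp, Hom.eval_smul, ← Hom.res_eval]
    change vderiv _ (f * X.resO hW (Hom.eval φ s)) - f * vderiv _ (X.resO hW (Hom.eval φ s)) = _
    rw [vderiv_mul]
    ring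

theorem vecComp_add_left (v w : (tangent X).sec U) (φ : E.dual.sec U) :
    vecComp (v + w) φ = vecComp v φ + vecComp w φ := rfl

theorem vecComp_smul_left (a : X.O U) (w : (tangent X).sec U) (φ : E.dual.sec U) :
    vecComp (a • w) φ = a • vecComp w φ := rfl

theorem vecComp_add_right (w : (tangent X).sec U) (φ ψ : E.dual.sec U) :
    vecComp w (φ + ψ) = vecComp w φ + vecComp w ψ :=
  dapp_ext fun V hV s => vderiv_map_add ((tangent X).res hV w) (Hom.eval (E.dual.res hV φ) s)
    (Hom.eval (E.dual.res hV ψ) s)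

/-- The correction of order zero is what turns φ ↦ w(φ(s)) - σ(s)(w ∘ φ) into an 𝒪-linear map. -/
theorem vecComp_smul_right (w : (tangent X).sec U) (a : X.O U) (φ : E.dual.sec U) :
    vecComp w (a • φ) = ofHom (vderiv w a • φ) + a • vecComp w φ :=
  dapp_ext fun V hV s => by
    rw [map_add, dapp_add, vecComp_res, (Diff 1 E (unit X)).res_smul, dapp_smul, vecComp_res,
      dapp_vecComp, dapp_vecComp, ofHom_res, dapp_ofHom, E.dual.res_smul, E.dual.res_smul,
      Hom.smul_eval, Hom.smul_eval, ← vderiv_res]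
    change vderiv _ (X.resO hV a * _) = vderiv _ _ * _ + _
    rw [vderiv_mul]
    ring

end PMod

/-! ## Frames of the tangent sheaf -/

/-- A frame of `T_X` over `U`, with its coframe. -/
structure TangentFrame (U : X.Op) where
  n : ℕ
  vec : Fin n → (tangent X).sec U
  form : Fin n → (Omega X).sec U
  expand : ∀ (V : X.Op) (h : V ≤ U) (v : (tangent X).sec V),
    v = ∑ i, PMod.Hom.eval ((Omega X).res h (form i)) v • (tangent X).res h (vec i)
  pair : ∀ i j, PMod.Hom.eval (form i) (vec j) = if i = j then (1 : X.O U) else 0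

variable (X) in
/-- `T_X` is locally free of finite rank. -/
def HasTangentFrames : Prop :=
  ∀ x : X.toRingedSpace, ∃ U : X.Op, x ∈ U ∧ Nonempty (TangentFrame U)

namespace TangentFrame

variable {U V : X.Op}

theorem expand' (e : TangentFrame U) (v : (tangent X).sec U) :
    v = ∑ i, PMod.Hom.eval (e.form i) v • e.vec i :=
  e.expand U le_rfl v

/-- Restriction of a frame to a smaller open set. -/
def restrict (e : TangentFrame U) (h : V ≤ U) : TangentFrame V where
  n := e.n
  vec i := (tangent X).res h (e.vec i)
  form i := (Omega X).res h (e.form i)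
  expand W hW v := e.expand W (hW.trans h) v
  pair i j := by
    rw [← PMod.Hom.res_eval, e.pair]
    exact (apply_ite (X.resO h) _ _ _).trans (by rw [map_one, map_zero])

end TangentFrame

/-! ### Decomposition of operators of order at most one in a frame -/

namespace PMod

variable {E : PMod X} {U V : X.Op}

/-- The contraction of the symbol of `P` with a one-form, a linear functional on `E`. -/
def symbolForm (ω : (Omega X).sec U) (P : (Diff 1 E (unit X)).sec U) : E.dual.sec U :=
  Hom.mk (G := unit X)
    (fun V h s => Hom.eval ((Omega X).res h ω) (symbol ((Diff 1 E (unit X)).res h P) s))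
    (fun V h s t => by rw [symbol_map_add, Hom.eval_add])
    (fun V h f s => by rw [symbol_map_smul, Hom.eval_smul])
    (fun V W hV hW s => by
      rw [Hom.res_eval, ← symbol_res]
      rfl)

/-- The part of order zero of an operator with respect to a frame. -/
def linearPart (e : TangentFrame U) (P : (Diff 1 E (unit X)).sec U) : E.dual.sec U :=
  Hom.mk (G := unit X)
    (fun V h s => dapp ((Diff 1 E (unit X)).res h
      (P - ∑ i, vecComp (e.vec i) (symbolForm (e.form i) P))) s)
    (fun V h s t => dapp_map_add _ s t)
    (fun V h f s => by
      rw [dapp_map_smul]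
      -- Expanding the symbol of P in the frame shows that the operators e_i ∘ φ_i have together the
      -- same symbol as P. The difference has symbol zero, which means that it is linear.
      have h0 : symbol ((Diff 1 E (unit X)).res h
          (P - ∑ i, vecComp (e.vec i) (symbolForm (e.form i) P))) s = 0 := by
        have key : symbol ((Diff 1 E (unit X)).res h P) s =
            symbol (∑ i, (Diff 1 E (unit X)).res h
              (vecComp (e.vec i) (symbolForm (e.form i) P))) s := by
          have hs : ∀ a : Finset (Fin e.n), symbol (∑ i ∈ a, (Diff 1 E (unit X)).res h
              (vecComp (e.vec i) (symbolForm (e.form i) P))) s = ∑ i ∈ a,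
              symbol ((Diff 1 E (unit X)).res h
                (vecComp (e.vec i) (symbolForm (e.form i) P))) s := by
            intro a
            classical
            induction a using Finset.induction_on with
            | empty =>
              rw [Finset.sum_empty, Finset.sum_empty]
              exact symbol_ofHom (0 : E.dual.sec V) s
            | insert i a hi ih => rw [Finset.sum_insert hi, Finset.sum_insert hi, symbol_add, ih]
          rw [hs]
          refine (e.expand V h _).trans (Finset.sum_congr rfl fun i _ => ?_)
          rw [vecComp_res, symbol_vecComp]
          rfl
        have h2 := symbol_add ((Diff 1 E (unit X)).res h
          (P - ∑ i, vecComp (e.vec i) (symbolForm (e.form i) P)))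
          ((Diff 1 E (unit X)).res h (∑ i, vecComp (e.vec i) (symbolForm (e.form i) P))) s
        rw [← map_add, sub_add_cancel, map_sum, key] at h2
        exact right_eq_add.1 h2
      rw [h0]
      exact add_zero _)
    (fun V W hV hW s => by
      rw [← (Diff 1 E (unit X)).res_comp hV hW, dapp_res]
      rfl)

/-- Locally the symbol sequence of 𝒟¹(E, 𝒪_X) splits: composing functionals with the frame fields
lifts symbols to operators. -/
theorem frame_decomposition (e : TangentFrame U) (P : (Diff 1 E (unit X)).sec U) :
    P = ofHom (linearPart e P) + ∑ i, vecComp (e.vec i) (symbolForm (e.form i) P) := by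
  have : ofHom (linearPart e P) = P - ∑ i, vecComp (e.vec i) (symbolForm (e.form i) P) :=
    dapp_ext fun V hV s => rfl
  rw [this, sub_add_cancel]

end PMod

/-! ## Transverse jets -/

namespace PartialConnection

variable {F : Foliation X} {E : PMod X} (C : PartialConnection F E) {U V : X.Op}

theorem jetEval_add (ξ : C.transverseJet.sec U) (P Q : (PMod.Diff 1 E (PMod.unit X)).sec U) :
    C.jetEval ξ (P + Q) = C.jetEval ξ P + C.jetEval ξ Q :=
  PMod.Hom.eval_add (E := C.transverseDiff) ξ (Submodule.Quotient.mk P) (Submodule.Quotient.mk Q)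

theorem jetEval_sum {ι : Type*} (a : Finset ι) (ξ : C.transverseJet.sec U)
    (P : ι → (PMod.Diff 1 E (PMod.unit X)).sec U) :
    C.jetEval ξ (∑ i ∈ a, P i) = ∑ i ∈ a, C.jetEval ξ (P i) := by
  classical
  induction a using Finset.induction_on with
  | empty => exact PMod.Hom.eval_zero (E := C.transverseDiff) ξ
  | insert i a hi ih => rw [Finset.sum_insert hi, Finset.sum_insert hi, jetEval_add, ih]

theorem jetEval_smul (ξ : C.transverseJet.sec U) (f : X.O U)
    (P : (PMod.Diff 1 E (PMod.unit X)).sec U) :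
    C.jetEval ξ (f • P) = f * C.jetEval ξ P :=
  PMod.Hom.eval_smul (E := C.transverseDiff) ξ f (Submodule.Quotient.mk P)

theorem add_jetEval (ξ η : C.transverseJet.sec U) (P : (PMod.Diff 1 E (PMod.unit X)).sec U) :
    C.jetEval (ξ + η) P = C.jetEval ξ P + C.jetEval η P := rfl

theorem smul_jetEval (f : X.O U) (ξ : C.transverseJet.sec U)
    (P : (PMod.Diff 1 E (PMod.unit X)).sec U) :
    C.jetEval (f • ξ) P = f * C.jetEval ξ P := PMod.Hom.smul_eval f ξ _

theorem jetEval_res (h : V ≤ U) (ξ : C.transverseJet.sec U)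
    (P : (PMod.Diff 1 E (PMod.unit X)).sec U) :
    C.jetEval (C.transverseJet.res h ξ) ((PMod.Diff 1 E (PMod.unit X)).res h P) =
      X.resO h (C.jetEval ξ P) :=
  (PMod.Hom.res_eval h ξ (Submodule.Quotient.mk P)).symm

theorem jetEval_prolong (ξ : C.transverseJet.sec U) (φ : E.dual.sec U) (v : F.T.sec U) :
    C.jetEval ξ (C.prolong φ v) = 0 := by
  have : (Submodule.Quotient.mk (C.prolong φ v) : C.transverseDiff.sec U) = 0 :=
    (Submodule.Quotient.mk_eq_zero _).2 (Submodule.subset_span ⟨φ, v, rfl⟩)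
  rw [jetEval, this]
  exact PMod.Hom.eval_zero ξ

theorem jet_ext_of_eval {ξ η : C.transverseJet.sec U}
    (h : ∀ (V : X.Op) (hV : V ≤ U) (P : (PMod.Diff 1 E (PMod.unit X)).sec V),
      C.jetEval (C.transverseJet.res hV ξ) P = C.jetEval (C.transverseJet.res hV η) P) : ξ = η :=
  PMod.Hom.ext fun V hV s => by
    induction s using Submodule.Quotient.induction_on with
    | _ s => exact h V hV s

/-- A transverse jet is determined by its values on linear functionals and on the operators
`w ∘ φ`. -/
theorem jet_ext (hT : HasTangentFrames X) {ξ η : C.transverseJet.sec U}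
    (h0 : ∀ (V : X.Op) (hV : V ≤ U) (φ : E.dual.sec V),
      C.jetEval (C.transverseJet.res hV ξ) (PMod.ofHom φ) =
        C.jetEval (C.transverseJet.res hV η) (PMod.ofHom φ))
    (h1 : ∀ (V : X.Op) (hV : V ≤ U) (w : (tangent X).sec V) (φ : E.dual.sec V),
      C.jetEval (C.transverseJet.res hV ξ) (PMod.vecComp w φ) =
        C.jetEval (C.transverseJet.res hV η) (PMod.vecComp w φ)) : ξ = η := by
  refine C.jet_ext_of_eval fun V hV P => PMod.glues_unit.eq_of_locally_eq fun x hx => ?_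
  obtain ⟨W, hxW, ⟨e⟩⟩ := hT x
  refine ⟨V ⊓ W, inf_le_left, ⟨hx, hxW⟩, ?_⟩
  have hW : V ⊓ W ≤ V := inf_le_left
  -- In a frame, P is a functional plus operators e_i ∘ φ_i, the two kinds controlled by `h0` and
  -- `h1`.
  have e' := e.restrict (inf_le_right : V ⊓ W ≤ W)
  change X.resO hW _ = X.resO hW _
  rw [← jetEval_res, ← jetEval_res, PMod.res_comp, PMod.res_comp,
    PMod.frame_decomposition e' ((PMod.Diff 1 E (PMod.unit X)).res hW P), jetEval_add, jetEval_add,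
    jetEval_sum, jetEval_sum, h0]
  simp only [h1]

/-- A transverse jet from its values on operators. -/
def jetMk (a : ∀ V : X.Op, V ≤ U → (PMod.Diff 1 E (PMod.unit X)).sec V → X.O V)
    (hadd : ∀ V h P Q, a V h (P + Q) = a V h P + a V h Q)
    (hsmul : ∀ V h (f : X.O V) P, a V h (f • P) = f * a V h P)
    (hres : ∀ (V W : X.Op) (hV : V ≤ U) (hW : W ≤ V) (P : (PMod.Diff 1 E (PMod.unit X)).sec V),
      a W (hW.trans hV) ((PMod.Diff 1 E (PMod.unit X)).res hW P) = X.resO hW (a V hV P))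
    (hprolong : ∀ V h (φ : E.dual.sec V) (v : F.T.sec V), a V h (C.prolong φ v) = 0) :
    C.transverseJet.sec U :=
  PMod.Hom.mk (E := C.transverseDiff) (G := PMod.unit X)
    (fun V h => (C.prolongSub.carrier V).liftQ
      ({ toFun := a V h, map_add' := hadd V h, map_smul' := hsmul V h } :
        (PMod.Diff 1 E (PMod.unit X)).sec V →ₗ[X.O V] X.O V)
      (Submodule.span_le.2 (by
        rintro _ ⟨φ, v, rfl⟩
        exact hprolong V h φ v)))
    (fun V h s t => map_add _ s t)
    (fun V h f s => map_smul _ f s)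
    (fun V W hV hW s => by
      induction s using Submodule.Quotient.induction_on with
      | _ s => exact hres V W hV hW s)

/-- Removes the inverse of E → E^{**} from the definition of π: afterwards π is only used through
the values of jets on functionals. -/
theorem eval_jetProj (hE : E.IsReflexive) (ξ : C.transverseJet.sec U) (φ : E.dual.sec U) :
    PMod.Hom.eval φ (C.jetProj hE ξ) = C.jetEval ξ (PMod.ofHom φ) := by
  have h1 : E.evBidual U (C.jetProj hE ξ) = C.jetBidual ξ :=
    (Equiv.ofBijective _ (hE U)).apply_symm_apply _
  have h2 := congrArg (fun b => PMod.Hom.eval b φ) h1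
  refine Eq.trans ?_ h2
  change _ = PMod.Hom.eval φ (E.res le_rfl _)
  rw [E.res_id]

theorem jetProj_eq_iff (hE : E.IsReflexive) (ξ : C.transverseJet.sec U) (s : E.sec U) :
    C.jetProj hE ξ = s ↔ ∀ (V : X.Op) (hV : V ≤ U) (φ : E.dual.sec V),
      C.jetEval (C.transverseJet.res hV ξ) (PMod.ofHom φ) = PMod.Hom.eval φ (E.res hV s) := by
  refine Equiv.symm_apply_eq (Equiv.ofBijective _ (hE U)) |>.trans ⟨fun h V hV φ => ?_, fun h => ?_⟩
  · exact congrArg (fun b => PMod.Hom.eval (E.dual.dual.res hV b) φ) h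
  · exact PMod.Hom.ext fun V hV φ => h V hV φ

end PartialConnection

/-! ### Multiplication by sections of 𝒪_X(-D), and the inclusion of E in E(D) -/

namespace EffectiveDivisor

variable {D : EffectiveDivisor X} {E : PMod X} {U V : X.Op}

theorem exists_equation (D : EffectiveDivisor X) {x : X.toRingedSpace} {U : X.Op} (hx : x ∈ U) :
    ∃ (V : X.Op) (_ : V ≤ U) (f : D.ideal.toPMod.sec V), x ∈ V ∧
      ∀ (W : X.Op) (h : W ≤ V), X.resO h f.1 ∈ nonZeroDivisors (X.O W) := by
  obtain ⟨V, f, hxV, hf⟩ := D.locallyPrincipal x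
  refine ⟨U ⊓ V, inf_le_left, ⟨X.resO inf_le_right f, ?_⟩, ⟨hx, hxV⟩, fun W h => ?_⟩
  · exact ((hf _ inf_le_right).2 _).2 ⟨1, (one_mul _).symm⟩
  · change X.resO h (X.resO inf_le_right f) ∈ _
    rw [X.resO_comp]
    exact (hf W _).1

theorem eval_incl (s : E.sec U) (f : D.ideal.toPMod.sec U) :
    PMod.Hom.eval (D.incl s) f = (f.1 : X.O U) • s := by
  change f.1 • E.res le_rfl s = _
  rw [E.res_id]

theorem incl_res (h : V ≤ U) (s : E.sec U) :
    D.incl (E.res h s) = (D.twistUp E).res h (D.incl s) :=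
  PMod.Hom.ext fun W hW f => by
    change f.1 • E.res hW (E.res h s) = f.1 • E.res (hW.trans h) s
    rw [E.res_comp]

theorem incl_add (s t : E.sec U) : D.incl (s + t) = D.incl s + D.incl t :=
  PMod.Hom.ext fun W hW f => by
    change f.1 • E.res hW (s + t) = f.1 • E.res hW s + f.1 • E.res hW t
    rw [map_add, smul_add]

theorem incl_smul (a : X.O U) (s : E.sec U) : D.incl (a • s) = a • D.incl s :=
  PMod.Hom.ext fun W hW f => by
    change f.1 • E.res hW (a • s) = X.resO hW a • f.1 • E.res hW s
    rw [E.res_smul, smul_comm]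

/-- Near each point, f may be taken to be a local equation of D, which can be cancelled on a
reflexive sheaf. Identities with poles are thus checked after clearing denominators. -/
theorem section_ext (hE : E.IsReflexive) (hG : E.Glues) (D : EffectiveDivisor X) {s t : E.sec U}
    (h : ∀ (V : X.Op) (hV : V ≤ U) (f : D.ideal.toPMod.sec V),
      (f.1 : X.O V) • E.res hV s = (f.1 : X.O V) • E.res hV t) : s = t := by
  refine hG.eq_of_locally_eq fun x hx => ?_
  obtain ⟨V, hV, f, hxV, hf⟩ := D.exists_equation hx
  exact ⟨V, hV, hxV, hE.smul_left_injective hf (h V hV f)⟩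

theorem incl_injective (hE : E.IsReflexive) (hG : E.Glues) (D : EffectiveDivisor X)
    {s t : E.sec U} (h : D.incl s = D.incl t) : s = t :=
  section_ext hE hG D fun V hV f => by
    have := congrArg (fun τ => PMod.Hom.eval ((D.twistUp E).res hV τ) f) h
    beta_reduce at this
    rwa [← incl_res, ← incl_res, eval_incl, eval_incl] at this

/-- Both sides are τ(f g), by linearity of τ over 𝒪_X. -/
theorem smul_eval_comm (τ : (D.twistUp E).sec U) (f g : D.ideal.toPMod.sec U) :
    (f.1 : X.O U) • PMod.Hom.eval τ g = (g.1 : X.O U) • PMod.Hom.eval τ f := by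
  rw [← PMod.Hom.eval_smul, ← PMod.Hom.eval_smul]
  congr 1
  exact Subtype.ext (mul_comm f.1 g.1)

/-- Multiplication by f clears the pole of τ, and the regular section obtained is τ(f). -/
theorem smul_twistUp (τ : (D.twistUp E).sec U) (f : D.ideal.toPMod.sec U) :
    (f.1 : X.O U) • τ = D.incl (PMod.Hom.eval τ f) :=
  PMod.Hom.ext fun V hV g => by
    rw [← incl_res, eval_incl, PMod.res_smul, PMod.Hom.smul_eval, PMod.Hom.res_eval]
    exact smul_eval_comm _ (D.ideal.toPMod.res hV f) g

theorem mulSpan_le_twistDown (U : X.Op) : D.mulSpan E U ≤ (D.twistDown E).carrier U :=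
  fun s hs _ hx => ⟨U, le_rfl, hx, by rw [E.res_id]; exact hs⟩

/-- The product of a section of `𝒪_X(-D)` with a section of `E`, as a section of `E(-D)`. -/
def mulSection (f : D.ideal.toPMod.sec U) (s : E.sec U) : (D.twistDown E).toPMod.sec U :=
  ⟨(f.1 : X.O U) • s, mulSpan_le_twistDown U (Submodule.subset_span ⟨f.1, f.2, s, rfl⟩)⟩

theorem mulSection_add (f : D.ideal.toPMod.sec U) (s t : E.sec U) :
    mulSection f (s + t) = mulSection f s + mulSection f t := Subtype.ext (smul_add _ _ _)

theorem add_mulSection (f g : D.ideal.toPMod.sec U) (s : E.sec U) :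
    mulSection (f + g) s = mulSection f s + mulSection g s := Subtype.ext (add_smul _ _ _)

theorem smul_mulSection (a : X.O U) (f : D.ideal.toPMod.sec U) (s : E.sec U) :
    mulSection (a • f) s = a • mulSection f s := Subtype.ext (mul_smul a f.1 s)

theorem mulSection_smul (a : X.O U) (f : D.ideal.toPMod.sec U) (s : E.sec U) :
    mulSection f (a • s) = a • mulSection f s := Subtype.ext (smul_comm _ _ _)

theorem mulSection_res (h : V ≤ U) (f : D.ideal.toPMod.sec U) (s : E.sec U) :
    mulSection (D.ideal.toPMod.res h f) (E.res h s) =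
      (D.twistDown E).toPMod.res h (mulSection f s) := Subtype.ext (E.res_smul h _ _).symm

end EffectiveDivisor

/-! ### Restriction of a meromorphic connection to E(-D), and its reconstruction from products -/

namespace MeromorphicConnection

variable {D : EffectiveDivisor X} {E : PMod X} (N : MeromorphicConnection D E) {U V : X.Op}

theorem nabla_smul (v : (tangent X).sec U) (f : X.O U) (s : E.sec U) :
    N.nabla v (f • s) = D.incl (vderiv v f • s) + f • N.nabla v s := N.leibniz U f s v

theorem nabla_add (v : (tangent X).sec U) (s t : E.sec U) :
    N.nabla v (s + t) = N.nabla v s + N.nabla v t := by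
  unfold nabla
  rw [map_add]; rfl

theorem nabla_zero (v : (tangent X).sec U) : N.nabla v (0 : E.sec U) = 0 := by
  unfold nabla
  rw [map_zero]; rfl

theorem add_nabla (v w : (tangent X).sec U) (s : E.sec U) :
    N.nabla (v + w) s = N.nabla v s + N.nabla w s := PMod.Hom.eval_add _ _ _

theorem smul_nabla (a : X.O U) (v : (tangent X).sec U) (s : E.sec U) :
    N.nabla (a • v) s = a • N.nabla v s := PMod.Hom.eval_smul _ _ _

theorem nabla_res (h : V ≤ U) (v : (tangent X).sec U) (s : E.sec U) :
    N.nabla ((tangent X).res h v) (E.res h s) = (D.twistUp E).res h (N.nabla v s) := by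
  unfold nabla
  rw [PMod.Hom.res_eval, N.op.map_res le_top h s]

theorem ext_nabla {N N' : MeromorphicConnection D E}
    (h : ∀ (U : X.Op) (v : (tangent X).sec U) (s : E.sec U), N.nabla v s = N'.nabla v s) :
    N = N' := by
  obtain ⟨op, hl⟩ := N
  obtain ⟨op', hl'⟩ := N'
  have : op = op' := LocalOp.ext' fun V hV s => PMod.Hom.ext fun W hW v => by
    have h1 := h W v (E.res hW s)
    unfold nabla at h1
    change PMod.Hom.eval (op.app W le_top (E.res hW s)) v =
      PMod.Hom.eval (op'.app W le_top (E.res hW s)) v at h1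
    rwa [op.map_res le_top hW, op'.map_res le_top hW] at h1
  subst this
  rfl

/-- On `E(-D)` the connection `N` has values in `E`. -/
theorem exists_lift (hE : E.IsReflexive) (hG : E.Glues) (v : (tangent X).sec U)
    (s : (D.twistDown E).toPMod.sec U) : ∃ t : E.sec U, D.incl t = N.nabla v s.1 := by
  have hspan : ∀ (V : X.Op) (w : (tangent X).sec V) (r : E.sec V), r ∈ D.mulSpan E V →
      ∃ t : E.sec V, D.incl t = N.nabla w r := by
    intro V w r hr
    change r ∈ Submodule.span _ _ at hr
    induction hr using Submodule.span_induction with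
    | mem r hr =>
      obtain ⟨f, hf, t, rfl⟩ := hr
      -- The Leibniz rule for f t, in which f ∇_w(t) is regular and equal to (∇_w t)(f).
      refine ⟨vderiv w f • t + PMod.Hom.eval (N.nabla w t) ⟨f, hf⟩, ?_⟩
      rw [EffectiveDivisor.incl_add, nabla_smul, ← EffectiveDivisor.smul_twistUp]
    | zero =>
      refine ⟨0, ?_⟩
      rw [nabla_zero]
      exact PMod.Hom.ext fun W hW f => by
        rw [← EffectiveDivisor.incl_res, EffectiveDivisor.eval_incl, map_zero, map_zero, smul_zero]
        rfl
    | add a b _ _ ha hb =>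
      obtain ⟨a', ha⟩ := ha
      obtain ⟨b', hb⟩ := hb
      exact ⟨a' + b', by rw [EffectiveDivisor.incl_add, nabla_add, ha, hb]⟩
    | smul c a _ ha =>
      obtain ⟨a', ha⟩ := ha
      exact ⟨vderiv w c • a + c • a', by
        rw [EffectiveDivisor.incl_add, nabla_smul, EffectiveDivisor.incl_smul c, ha]⟩
  have hloc : ∀ x ∈ U, ∃ (V : X.Op) (hV : V ≤ U) (t : E.sec V), x ∈ V ∧
      D.incl t = (D.twistUp E).res hV (N.nabla v s.1) := by
    intro x hx
    obtain ⟨V, hV, hxV, h1⟩ := s.2 x hx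
    obtain ⟨t, ht⟩ := hspan V ((tangent X).res hV v) _ h1
    exact ⟨V, hV, t, hxV, by rw [ht, nabla_res]⟩
  -- The local lifts are unique because E → E(D) is injective, hence they glue.
  obtain ⟨t, ht⟩ := hG.exists_of_locally
    (fun V hV t => D.incl t = (D.twistUp E).res hV (N.nabla v s.1))
    (fun V W hV hW t ht => by rw [EffectiveDivisor.incl_res, ht, PMod.res_comp])
    (fun V hV t t' ht ht' => EffectiveDivisor.incl_injective hE hG D (ht.trans ht'.symm)) hloc
  refine ⟨t, PMod.Hom.ext fun W hW f => ?_⟩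
  rw [← EffectiveDivisor.incl_res, EffectiveDivisor.eval_incl]
  -- The glued section is known only on the neighbourhoods of `hloc`, so the identity, evaluated on
  -- f, is compared there.
  refine hG.eq_of_locally_eq fun x hx => ?_
  obtain ⟨V, hV, t', hxV, ht'⟩ := hloc x (hW hx)
  have hle : V ⊓ W ≤ W := inf_le_right
  refine ⟨V ⊓ W, hle, ⟨hxV, hx⟩, ?_⟩
  have h1 := ht V hV t' ht'
  have h2 := congrArg (fun τ => PMod.Hom.eval ((D.twistUp E).res (inf_le_left : V ⊓ W ≤ V) τ)
    (D.ideal.toPMod.res hle f)) ht'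
  beta_reduce at h2
  rw [← EffectiveDivisor.incl_res, EffectiveDivisor.eval_incl, ← h1, PMod.res_comp] at h2
  rw [E.res_smul, PMod.res_comp]
  refine Eq.trans h2 ?_
  rw [PMod.Hom.res_eval, PMod.res_comp, PMod.res_comp]

/-- The section `∇_v(s)` of `E`, for `s` a section of `E(-D)`. -/
noncomputable def lift (hE : E.IsReflexive) (hG : E.Glues) (v : (tangent X).sec U)
    (s : (D.twistDown E).toPMod.sec U) : E.sec U := (N.exists_lift hE hG v s).choose

variable (hE : E.IsReflexive) (hG : E.Glues)

theorem incl_lift (v : (tangent X).sec U) (s : (D.twistDown E).toPMod.sec U) :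
    D.incl (N.lift hE hG v s) = N.nabla v s.1 := (N.exists_lift hE hG v s).choose_spec

theorem lift_eq_iff (v : (tangent X).sec U) (s : (D.twistDown E).toPMod.sec U) (t : E.sec U) :
    N.lift hE hG v s = t ↔ N.nabla v s.1 = D.incl t := by
  rw [← N.incl_lift hE hG]
  exact ⟨fun h => by rw [h], EffectiveDivisor.incl_injective hE hG D⟩

theorem lift_add (v : (tangent X).sec U) (s t : (D.twistDown E).toPMod.sec U) :
    N.lift hE hG v (s + t) = N.lift hE hG v s + N.lift hE hG v t := by
  rw [lift_eq_iff, EffectiveDivisor.incl_add, incl_lift, incl_lift]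
  exact N.nabla_add v s.1 t.1

theorem lift_smul (v : (tangent X).sec U) (f : X.O U) (s : (D.twistDown E).toPMod.sec U) :
    N.lift hE hG v (f • s) = vderiv v f • s.1 + f • N.lift hE hG v s := by
  rw [lift_eq_iff, EffectiveDivisor.incl_add, EffectiveDivisor.incl_smul f, incl_lift]
  exact N.nabla_smul v f s.1

theorem add_lift (v w : (tangent X).sec U) (s : (D.twistDown E).toPMod.sec U) :
    N.lift hE hG (v + w) s = N.lift hE hG v s + N.lift hE hG w s := by
  rw [lift_eq_iff, EffectiveDivisor.incl_add, incl_lift, incl_lift, add_nabla]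

theorem smul_lift (a : X.O U) (v : (tangent X).sec U) (s : (D.twistDown E).toPMod.sec U) :
    N.lift hE hG (a • v) s = a • N.lift hE hG v s := by
  rw [lift_eq_iff, EffectiveDivisor.incl_smul, incl_lift, smul_nabla]

theorem lift_res (h : V ≤ U) (v : (tangent X).sec U) (s : (D.twistDown E).toPMod.sec U) :
    N.lift hE hG ((tangent X).res h v) ((D.twistDown E).toPMod.res h s) =
      E.res h (N.lift hE hG v s) := by
  rw [lift_eq_iff, EffectiveDivisor.incl_res, incl_lift, ← nabla_res]
  rfl

theorem lift_mulSection (v : (tangent X).sec U) (f : D.ideal.toPMod.sec U) (s : E.sec U) :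
    N.lift hE hG v (EffectiveDivisor.mulSection f s) =
      vderiv v f.1 • s + PMod.Hom.eval (N.nabla v s) f := by
  rw [lift_eq_iff, EffectiveDivisor.incl_add, ← EffectiveDivisor.smul_twistUp]
  exact N.nabla_smul v f.1 s

theorem zero_lift (s : (D.twistDown E).toPMod.sec U) : N.lift hE hG 0 s = 0 := by
  have := N.add_lift hE hG 0 0 s
  rw [add_zero] at this
  exact left_eq_add.1 this

theorem sum_lift {ι : Type*} (a : Finset ι) (v : ι → (tangent X).sec U)
    (s : (D.twistDown E).toPMod.sec U) :
    N.lift hE hG (∑ i ∈ a, v i) s = ∑ i ∈ a, N.lift hE hG (v i) s := by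
  classical
  induction a using Finset.induction_on with
  | empty => exact N.zero_lift hE hG s
  | insert i a hi ih => rw [Finset.sum_insert hi, Finset.sum_insert hi, add_lift, ih]

/-- A meromorphic connection from the sections `f ∇_v(s)` of `E`, for `f` a section of
`𝒪_X(-D)`. -/
def ofProducts (a : ∀ U : X.Op, (tangent X).sec U → E.sec U → D.ideal.toPMod.sec U → E.sec U)
    (hf : ∀ U v s f g, a U v s (f + g) = a U v s f + a U v s g)
    (hfs : ∀ U v s (c : X.O U) f, a U v s (c • f) = c • a U v s f)
    (hv : ∀ U v w s f, a U (v + w) s f = a U v s f + a U w s f)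
    (hvs : ∀ U (c : X.O U) v s f, a U (c • v) s f = c • a U v s f)
    (hs : ∀ U v s t f, a U v (s + t) f = a U v s f + a U v t f)
    (hl : ∀ U v (c : X.O U) s f,
      a U v (c • s) f = (f.1 : X.O U) • vderiv v c • s + c • a U v s f)
    (hr : ∀ (U V : X.Op) (h : V ≤ U) v s f,
      a V ((tangent X).res h v) (E.res h s) (D.ideal.toPMod.res h f) = E.res h (a U v s f)) :
    MeromorphicConnection D E where
  op :=
    { app := fun U _ => AddMonoidHom.mk'
        (fun s => PMod.Hom.mk (E := tangent X) (G := D.twistUp E)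
          (fun V hV v => PMod.Hom.mk (E := D.ideal.toPMod) (G := E)
            (fun W hW f => a W ((tangent X).res hW v) (E.res (hW.trans hV) s) f)
            (fun W hW f g => hf _ _ _ _ _) (fun W hW c f => hfs _ _ _ _ _)
            (fun W W' hW hW' f => by
              rw [← (tangent X).res_comp hW hW', ← E.res_comp (hW.trans hV) hW', hr]))
          (fun V hV v w => PMod.Hom.ext fun W hW f => by
            change a W ((tangent X).res hW (v + w)) _ f = a W ((tangent X).res hW v) _ f +
              a W ((tangent X).res hW w) _ f
            rw [map_add, hv])
          (fun V hV c v => PMod.Hom.ext fun W hW f => by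
            change a W ((tangent X).res hW (c • v)) _ f =
              X.resO hW c • a W ((tangent X).res hW v) _ f
            rw [(tangent X).res_smul, hvs])
          (fun V W hV hW v => PMod.Hom.ext fun W' hW' f => by
            change a W' ((tangent X).res hW' ((tangent X).res hW v)) _ f =
              a W' ((tangent X).res (hW'.trans hW) v) _ f
            rw [PMod.res_comp]))
        (fun s t => PMod.Hom.ext fun V hV v => PMod.Hom.ext fun W hW f => by
          change a W ((tangent X).res hW v) (E.res (hW.trans hV) (s + t)) f =
            a W ((tangent X).res hW v) (E.res (hW.trans hV) s) f +
              a W ((tangent X).res hW v) (E.res (hW.trans hV) t) f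
          rw [map_add, hs])
      map_const := fun U _ c s => PMod.Hom.ext fun V hV v => PMod.Hom.ext fun W hW f => by
        change a W ((tangent X).res hW v) (E.res (hW.trans hV) (X.const U c • s)) f =
          X.resO hW (X.resO hV (X.const U c)) • a W ((tangent X).res hW v) (E.res (hW.trans hV) s) f
        -- ℂ-linearity is the Leibniz hypothesis `hl` for a constant, whose derivative vanishes.
        have h1 : X.resO (hW.trans hV) (X.const U c) = X.const W c := X.const_res _ c
        rw [X.resO_comp, E.res_smul, hl, h1, vderiv_const, zero_smul, smul_zero, zero_add]
      map_res := fun {U V} _ hV s => PMod.Hom.ext fun W hW v => PMod.Hom.ext fun W' hW' f => by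
        change a W' ((tangent X).res hW' v) (E.res (hW'.trans hW) (E.res hV s)) f =
          a W' ((tangent X).res hW' v) (E.res ((hW'.trans hW).trans hV) s) f
        rw [E.res_comp] }
  leibniz U c s v := PMod.Hom.ext fun W hW f => by
    change a W ((tangent X).res hW v) (E.res (hW.trans le_rfl) (c • s)) f =
      f.1 • E.res hW (vderiv v c • s) +
        X.resO hW c • a W ((tangent X).res hW v) (E.res (hW.trans le_rfl) s) f
    rw [E.res_smul, hl, E.res_smul, vderiv_res]

theorem eval_nabla_ofProducts
    (a : ∀ U : X.Op, (tangent X).sec U → E.sec U → D.ideal.toPMod.sec U → E.sec U)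
    (hf hfs hv hvs hs hl hr) (v : (tangent X).sec U) (s : E.sec U) (f : D.ideal.toPMod.sec U) :
    PMod.Hom.eval ((ofProducts a hf hfs hv hvs hs hl hr).nabla v s) f = a U v s f := by
  change a U ((tangent X).res le_rfl v) (E.res le_rfl s) f = _
  rw [PMod.res_id, PMod.res_id]

end MeromorphicConnection

theorem PMod.symbol_sum {E : PMod X} {U : X.Op} {ι : Type*} (a : Finset ι)
    (P : (PMod.Diff 1 E (PMod.unit X)).sec U) (s : ι → E.sec U) :
    PMod.symbol P (∑ i ∈ a, s i) = ∑ i ∈ a, PMod.symbol P (s i) :=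
  map_sum (AddMonoidHom.mk' (PMod.symbol P) (PMod.symbol_map_add P)) s a

/-! ## The splitting associated with a connection -/

namespace MeromorphicConnection

variable {D : EffectiveDivisor X} {E : PMod X} (N : MeromorphicConnection D E) {U V : X.Op}
  (hE : E.IsReflexive) (hG : E.Glues)

/-- The value `P(s) - ∑ ω_i(symbol of P at ∇_{e_i}(s))` of `d¹ - N` in a frame `e` with coframe
`ω`. -/
noncomputable def frameVal (e : TangentFrame U) (s : (D.twistDown E).toPMod.sec U)
    (P : (PMod.Diff 1 E (PMod.unit X)).sec U) : X.O U :=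
  PMod.dapp P s.1 -
    ∑ i, PMod.Hom.eval (e.form i) (PMod.symbol P (N.lift hE hG (e.vec i) s))

theorem frameVal_res (e : TangentFrame U) (s : (D.twistDown E).toPMod.sec U)
    (P : (PMod.Diff 1 E (PMod.unit X)).sec U) (h : V ≤ U) :
    X.resO h (N.frameVal hE hG e s P) = N.frameVal hE hG (e.restrict h)
      ((D.twistDown E).toPMod.res h s) ((PMod.Diff 1 E (PMod.unit X)).res h P) := by
  unfold frameVal
  rw [map_sub, map_sum]
  refine congrArg₂ _ (PMod.dapp_res h P s.1).symm (Finset.sum_congr rfl fun i _ => ?_)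
  refine (PMod.Hom.res_eval h (e.form i) _).trans ?_
  rw [← PMod.symbol_res, ← lift_res]
  rfl

/-- Contractions do not depend on the frame. -/
theorem sum_form_symbol_eq (e e' : TangentFrame U) (s : (D.twistDown E).toPMod.sec U)
    (P : (PMod.Diff 1 E (PMod.unit X)).sec U) :
    ∑ i, PMod.Hom.eval (e.form i) (PMod.symbol P (N.lift hE hG (e.vec i) s)) =
      ∑ j, PMod.Hom.eval (e'.form j) (PMod.symbol P (N.lift hE hG (e'.vec j) s)) := by
  -- Both sums are the trace of the 𝒪-linear endomorphism of T_X sending w to the symbol of P at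
  -- ∇_w(s). The vectors of `e'` are expanded in `e`, and afterwards the symbols in `e'`.
  have h1 : ∀ j, PMod.Hom.eval (e'.form j) (PMod.symbol P (N.lift hE hG (e'.vec j) s)) =
      ∑ i, PMod.Hom.eval (e.form i) (e'.vec j) *
        PMod.Hom.eval (e'.form j) (PMod.symbol P (N.lift hE hG (e.vec i) s)) := by
    intro j
    conv_lhs => rw [e.expand' (e'.vec j)]
    rw [sum_lift, PMod.symbol_sum, PMod.Hom.eval_sum]
    refine Finset.sum_congr rfl fun i _ => ?_
    rw [smul_lift, PMod.symbol_map_smul, PMod.Hom.eval_smul]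
    rfl
  rw [Finset.sum_congr rfl fun j _ => h1 j, Finset.sum_comm]
  refine Finset.sum_congr rfl fun i _ => ?_
  conv_lhs => rw [e'.expand' (PMod.symbol P (N.lift hE hG (e.vec i) s))]
  rw [PMod.Hom.eval_sum]
  refine Finset.sum_congr rfl fun j _ => ?_
  rw [PMod.Hom.eval_smul]
  exact mul_comm _ _

/-- In terms of operators whose symbol is `φ ⊗ w`. -/
theorem frameVal_of_symbol (e : TangentFrame U) (s : (D.twistDown E).toPMod.sec U)
    (P : (PMod.Diff 1 E (PMod.unit X)).sec U) (φ : E.dual.sec U) (w : (tangent X).sec U)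
    (hP : ∀ t : E.sec U, PMod.symbol P t = PMod.Hom.eval φ t • w) :
    N.frameVal hE hG e s P = PMod.dapp P s.1 - PMod.Hom.eval φ (N.lift hE hG w s) := by
  unfold frameVal
  congr 1
  conv_rhs => rw [e.expand' w, sum_lift, PMod.Hom.eval_sum]
  refine Finset.sum_congr rfl fun i _ => ?_
  rw [hP, smul_lift, PMod.Hom.eval_smul, PMod.Hom.eval_smul]
  exact mul_comm _ _

variable (hT : HasTangentFrames X)

-- The values in different frames agree because they are traces, so they glue. The conclusion covers
-- every frame over every smaller open set, which allows each later identity to be checked in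
-- whatever frame is at hand.
include hT in
theorem exists_splitVal (s : (D.twistDown E).toPMod.sec U)
    (P : (PMod.Diff 1 E (PMod.unit X)).sec U) :
    ∃ r : X.O U, ∀ (V : X.Op) (h : V ≤ U) (e : TangentFrame V),
      X.resO h r = N.frameVal hE hG e ((D.twistDown E).toPMod.res h s)
        ((PMod.Diff 1 E (PMod.unit X)).res h P) := by
  obtain ⟨r, hr⟩ := PMod.glues_unit.exists_of_locally
    (fun V (h : V ≤ U) (r : X.O V) => ∃ e : TangentFrame V,
      r = N.frameVal hE hG e ((D.twistDown E).toPMod.res h s)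
        ((PMod.Diff 1 E (PMod.unit X)).res h P))
    (by
      rintro V W hV hW r ⟨e, rfl⟩
      refine ⟨e.restrict hW, ?_⟩
      refine (N.frameVal_res hE hG e _ _ hW).trans ?_
      rw [PMod.res_comp, PMod.res_comp])
    (by
      rintro V hV r t ⟨e, rfl⟩ ⟨e', rfl⟩
      unfold frameVal
      rw [N.sum_form_symbol_eq hE hG e e'])
    (fun x hx => by
      obtain ⟨V, hxV, ⟨e⟩⟩ := hT x
      exact ⟨U ⊓ V, inf_le_left, _, ⟨hx, hxV⟩, e.restrict inf_le_right, rfl⟩)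
  exact ⟨r, fun V h e => hr V h _ ⟨e, rfl⟩⟩

/-- The value of `d¹ - N` at `s` on the operator `P`. -/
noncomputable def splitVal (s : (D.twistDown E).toPMod.sec U)
    (P : (PMod.Diff 1 E (PMod.unit X)).sec U) : X.O U :=
  (N.exists_splitVal hE hG hT s P).choose

theorem resO_splitVal (s : (D.twistDown E).toPMod.sec U)
    (P : (PMod.Diff 1 E (PMod.unit X)).sec U) (h : V ≤ U) (e : TangentFrame V) :
    X.resO h (N.splitVal hE hG hT s P) = N.frameVal hE hG e ((D.twistDown E).toPMod.res h s)
      ((PMod.Diff 1 E (PMod.unit X)).res h P) :=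
  (N.exists_splitVal hE hG hT s P).choose_spec V h e

-- Every point has a neighbourhood carrying a frame, and frames restrict; so identities between
-- functions need only be checked where a frame is given.
include hT in
theorem eq_of_frames {r r' : X.O U}
    (h : ∀ (V : X.Op) (h : V ≤ U), TangentFrame V → X.resO h r = X.resO h r') : r = r' :=
  PMod.glues_unit.eq_of_locally_eq fun x hx => by
    obtain ⟨V, hxV, ⟨e⟩⟩ := hT x
    exact ⟨U ⊓ V, inf_le_left, ⟨hx, hxV⟩, h _ _ (e.restrict inf_le_right)⟩

theorem splitVal_res (h : V ≤ U) (s : (D.twistDown E).toPMod.sec U)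
    (P : (PMod.Diff 1 E (PMod.unit X)).sec U) :
    N.splitVal hE hG hT ((D.twistDown E).toPMod.res h s)
      ((PMod.Diff 1 E (PMod.unit X)).res h P) = X.resO h (N.splitVal hE hG hT s P) :=
  eq_of_frames hT fun W hW e => by
    rw [resO_splitVal (e := e), X.resO_comp, resO_splitVal (e := e), PMod.res_comp, PMod.res_comp]

/-- When the symbol is φ ⊗ w, the trace collapses to φ(∇_w s) and no frame is left in the formula.
Functionals, the operators w ∘ φ and the operators φ ∘ ∇_v are all of this kind. -/
theorem splitVal_of_symbol (s : (D.twistDown E).toPMod.sec U)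
    (P : (PMod.Diff 1 E (PMod.unit X)).sec U) (φ : E.dual.sec U) (w : (tangent X).sec U)
    (hP : ∀ (V : X.Op) (h : V ≤ U) (t : E.sec V),
      PMod.symbol ((PMod.Diff 1 E (PMod.unit X)).res h P) t =
        PMod.Hom.eval (E.dual.res h φ) t • (tangent X).res h w) :
    N.splitVal hE hG hT s P = PMod.dapp P s.1 - PMod.Hom.eval φ (N.lift hE hG w s) :=
  eq_of_frames hT fun V h e => by
    rw [resO_splitVal (e := e), N.frameVal_of_symbol hE hG e _ _ _ _ (hP V h), map_sub, lift_res]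
    exact congrArg₂ _ (PMod.dapp_res h P s.1) (PMod.Hom.res_eval h φ _).symm

theorem splitVal_ofHom (s : (D.twistDown E).toPMod.sec U) (φ : E.dual.sec U) :
    N.splitVal hE hG hT s (PMod.ofHom φ) = PMod.Hom.eval φ s.1 := by
  -- A functional has symbol zero, written here as φ ⊗ 0.
  refine (N.splitVal_of_symbol hE hG hT s _ φ 0 fun V h t => ?_).trans ?_
  · rw [map_zero, smul_zero, PMod.ofHom_res, PMod.symbol_ofHom]
  · rw [zero_lift, PMod.Hom.eval_zero]
    exact sub_zero _

/-- The formula on which the correspondence rests: read from right to left, it recovers ∇_w s from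
the splitting. -/
theorem splitVal_vecComp (s : (D.twistDown E).toPMod.sec U) (w : (tangent X).sec U)
    (φ : E.dual.sec U) :
    N.splitVal hE hG hT s (PMod.vecComp w φ) =
      vderiv w (PMod.Hom.eval φ s.1) - PMod.Hom.eval φ (N.lift hE hG w s) :=
  N.splitVal_of_symbol hE hG hT s _ φ w fun V h t => by
    rw [PMod.vecComp_res, PMod.symbol_vecComp]

theorem splitVal_add (s : (D.twistDown E).toPMod.sec U)
    (P Q : (PMod.Diff 1 E (PMod.unit X)).sec U) :
    N.splitVal hE hG hT s (P + Q) = N.splitVal hE hG hT s P + N.splitVal hE hG hT s Q :=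
  eq_of_frames hT fun V h e => by
    rw [map_add, resO_splitVal (e := e), resO_splitVal (e := e), resO_splitVal (e := e), map_add]
    unfold frameVal
    rw [PMod.dapp_add, Finset.sum_congr rfl fun i _ => by
      rw [PMod.symbol_add, PMod.Hom.eval_add], Finset.sum_add_distrib]
    ring

theorem splitVal_smul (s : (D.twistDown E).toPMod.sec U) (f : X.O U)
    (P : (PMod.Diff 1 E (PMod.unit X)).sec U) :
    N.splitVal hE hG hT s (f • P) = f * N.splitVal hE hG hT s P :=
  eq_of_frames hT fun V h e => by
    rw [map_mul, resO_splitVal (e := e), resO_splitVal (e := e), PMod.res_smul]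
    unfold frameVal
    rw [PMod.dapp_smul, mul_sub, Finset.mul_sum]
    refine congrArg _ (Finset.sum_congr rfl fun i _ => ?_)
    rw [PMod.symbol_smul, PMod.Hom.eval_smul]
    rfl

theorem add_splitVal (s t : (D.twistDown E).toPMod.sec U)
    (P : (PMod.Diff 1 E (PMod.unit X)).sec U) :
    N.splitVal hE hG hT (s + t) P = N.splitVal hE hG hT s P + N.splitVal hE hG hT t P :=
  eq_of_frames hT fun V h e => by
    rw [map_add, resO_splitVal (e := e), resO_splitVal (e := e), resO_splitVal (e := e), map_add]
    unfold frameVal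
    rw [Finset.sum_congr rfl fun i _ => by
      rw [lift_add, PMod.symbol_map_add, PMod.Hom.eval_add], Finset.sum_add_distrib]
    refine (congrArg (· - _) (PMod.dapp_map_add _ _ _)).trans ?_
    ring

/-- Two Leibniz terms cancel. P(f s) exceeds f P(s) by the symbol of P at s applied to f, and the
terms e_i(f) s in ∇_{e_i}(f s) contribute the expansion of that same derivative in the frame. -/
theorem smul_splitVal (f : X.O U) (s : (D.twistDown E).toPMod.sec U)
    (P : (PMod.Diff 1 E (PMod.unit X)).sec U) :
    N.splitVal hE hG hT (f • s) P = f * N.splitVal hE hG hT s P :=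
  eq_of_frames hT fun V h e => by
    rw [map_mul, resO_splitVal (e := e), resO_splitVal (e := e), PMod.res_smul]
    unfold frameVal
    rw [Finset.sum_congr rfl fun i _ => by
      rw [lift_smul, PMod.symbol_map_add, PMod.symbol_map_smul, PMod.symbol_map_smul,
        PMod.Hom.eval_add, PMod.Hom.eval_smul, PMod.Hom.eval_smul], Finset.sum_add_distrib]
    refine (congrArg (· - _) (PMod.dapp_map_smul _ _ _)).trans ?_
    rw [mul_sub, Finset.mul_sum]
    have h1 : vderiv (PMod.symbol ((PMod.Diff 1 E (PMod.unit X)).res h P)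
        ((D.twistDown E).toPMod.res h s).1) (X.resO h f) =
        ∑ i, vderiv (e.vec i) (X.resO h f) * PMod.Hom.eval (e.form i)
          (PMod.symbol ((PMod.Diff 1 E (PMod.unit X)).res h P)
            ((D.twistDown E).toPMod.res h s).1) := by
      conv_lhs => rw [e.expand' (PMod.symbol _ _)]
      have h2 : ∀ (a : Finset (Fin e.n)) (v : Fin e.n → (tangent X).sec V),
          vderiv (∑ i ∈ a, v i) (X.resO h f) = ∑ i ∈ a, vderiv (v i) (X.resO h f) := by
        intro a v
        exact map_sum (AddMonoidHom.mk' (fun v : (tangent X).sec V => vderiv v (X.resO h f))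
          (fun v w => vderiv_add v w _)) v a
      rw [h2]
      exact Finset.sum_congr rfl fun i _ => (vderiv_smul _ _ _).trans (mul_comm _ _)
    rw [h1]
    simp only [smul_eq_mul]
    ring

/-- The operator φ ∘ ∇_v has symbol φ ⊗ v, so its value is φ of the difference between the partial
connection and N in the direction v. This is where N has to extend the partial connection, and it
lets the values descend to the quotient by S¹(∇). -/
theorem splitVal_prolong {F : Foliation X} {C : PartialConnection F E} (hN : N.Extends C)
    (s : (D.twistDown E).toPMod.sec U) (φ : E.dual.sec U) (v : F.T.sec U) :
    N.splitVal hE hG hT s (C.prolong φ v) = 0 := by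
  have hdapp : ∀ (V : X.Op) (h : V ≤ U) (t : E.sec V),
      PMod.dapp ((PMod.Diff 1 E (PMod.unit X)).res h (C.prolong φ v)) t =
        PMod.Hom.eval (E.dual.res h φ) (C.nabla (F.T.res h v) t) := fun V h t => rfl
  rw [N.splitVal_of_symbol hE hG hT s _ φ v.1]
  · have h1 : N.lift hE hG v.1 s = C.nabla v s.1 := (N.lift_eq_iff hE hG _ _ _).2 (hN U v s.1)
    rw [h1]
    have h2 : PMod.dapp (C.prolong φ v) s.1 =
      PMod.Hom.eval φ (C.nabla (F.T.res le_rfl v) s.1) := rfl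
    rw [h2, PMod.res_id]
    exact sub_self _
  · intro V h t
    refine tangent_ext fun W hW f => ?_
    rw [PMod.vderiv_res_symbol, PMod.res_comp, hdapp, hdapp, C.nabla_smul, PMod.Hom.eval_add,
      PMod.Hom.eval_smul, PMod.Hom.eval_smul, PMod.res_smul, vderiv_smul, PMod.res_comp]
    have h1 : (tangent X).res (hW.trans h) v.1 = (F.T.res (hW.trans h) v).1 := rfl
    have h2 : X.resO hW (PMod.Hom.eval (E.dual.res h φ) t) =
        PMod.Hom.eval (E.dual.res (hW.trans h) φ) (E.res hW t) :=
      PMod.Hom.res_eval (G := PMod.unit X) hW (E.dual.res h φ) t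
    rw [h1, h2]
    simp only [smul_eq_mul]
    ring

/-- The transverse jet `(d¹ - N)(s)`. -/
noncomputable def splitJet {F : Foliation X} {C : PartialConnection F E} (hN : N.Extends C)
    (s : (D.twistDown E).toPMod.sec U) : C.transverseJet.sec U :=
  C.jetMk (fun V h P => N.splitVal hE hG hT ((D.twistDown E).toPMod.res h s) P)
    (fun V h P Q => N.splitVal_add hE hG hT _ P Q) (fun V h f P => N.splitVal_smul hE hG hT _ f P)
    (fun V W hV hW P => by rw [← splitVal_res, PMod.res_comp])
    (fun V h φ v => N.splitVal_prolong hE hG hT hN _ φ v)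

theorem jetEval_splitJet {F : Foliation X} {C : PartialConnection F E} (hN : N.Extends C)
    (s : (D.twistDown E).toPMod.sec U) (P : (PMod.Diff 1 E (PMod.unit X)).sec U) :
    C.jetEval (N.splitJet hE hG hT hN s) P = N.splitVal hE hG hT s P := by
  change N.splitVal hE hG hT ((D.twistDown E).toPMod.res le_rfl s) P = _
  rw [PMod.res_id]

theorem splitJet_res {F : Foliation X} {C : PartialConnection F E} (hN : N.Extends C)
    (h : V ≤ U) (s : (D.twistDown E).toPMod.sec U) :
    N.splitJet hE hG hT hN ((D.twistDown E).toPMod.res h s) =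
      C.transverseJet.res h (N.splitJet hE hG hT hN s) :=
  C.jet_ext_of_eval fun W hW P => by
    change N.splitVal hE hG hT ((D.twistDown E).toPMod.res hW ((D.twistDown E).toPMod.res h s)) P =
      N.splitVal hE hG hT ((D.twistDown E).toPMod.res (hW.trans h) s) P
    rw [PMod.res_comp]

/-- The splitting `d¹ - N`. -/
noncomputable def splitting {F : Foliation X} {C : PartialConnection F E} (hN : N.Extends C) :
    MeromorphicSplitting C hE D where
  mor :=
    { app := fun U =>
        { toFun := N.splitJet hE hG hT hN
          map_add' := fun s t => C.jet_ext_of_eval fun V h P => by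
            change N.splitVal hE hG hT ((D.twistDown E).toPMod.res h (s + t)) P =
              N.splitVal hE hG hT ((D.twistDown E).toPMod.res h s) P +
                N.splitVal hE hG hT ((D.twistDown E).toPMod.res h t) P
            rw [map_add, add_splitVal]
          map_smul' := fun f s => C.jet_ext_of_eval fun V h P => by
            change N.splitVal hE hG hT ((D.twistDown E).toPMod.res h (f • s)) P =
              X.resO h f * N.splitVal hE hG hT ((D.twistDown E).toPMod.res h s) P
            rw [PMod.res_smul, smul_splitVal] }
      map_res := fun h s => N.splitJet_res hE hG hT hN h s }
  proj_comp U s := (C.jetProj_eq_iff hE _ _).2 fun V hV φ => N.splitVal_ofHom hE hG hT _ φ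

theorem splitting_mor_app {F : Foliation X} {C : PartialConnection F E} (hN : N.Extends C)
    (s : (D.twistDown E).toPMod.sec U) :
    (N.splitting hE hG hT hN).mor.app U s = N.splitJet hE hG hT hN s := rfl

end MeromorphicConnection

/-! ## The connection associated with a splitting -/

namespace MeromorphicSplitting

variable {F : Foliation X} {E : PMod X} {C : PartialConnection F E} {hE : E.IsReflexive}
  {D : EffectiveDivisor X} (σ : MeromorphicSplitting C hE D) {U V : X.Op}

/-- The condition π ∘ σ = inclusion, tested against functionals. -/
theorem jetEval_ofHom (s : (D.twistDown E).toPMod.sec U) (φ : E.dual.sec U) :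
    C.jetEval (σ.mor.app U s) (PMod.ofHom φ) = PMod.Hom.eval φ s.1 := by
  rw [← C.eval_jetProj hE, σ.proj_comp]

theorem jetEval_res (h : V ≤ U) (s : (D.twistDown E).toPMod.sec U)
    (P : (PMod.Diff 1 E (PMod.unit X)).sec U) :
    C.jetEval (σ.mor.app V ((D.twistDown E).toPMod.res h s))
      ((PMod.Diff 1 E (PMod.unit X)).res h P) = X.resO h (C.jetEval (σ.mor.app U s) P) := by
  rw [σ.mor.map_res, C.jetEval_res]

/-- The functional `φ ↦ w(φ(s)) - σ(s)(w ∘ φ)`. -/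
theorem exists_covariant (w : (tangent X).sec U) (s : (D.twistDown E).toPMod.sec U) :
    ∃ t : E.sec U, ∀ (V : X.Op) (h : V ≤ U) (φ : E.dual.sec V),
      PMod.Hom.eval φ (E.res h t) =
        vderiv ((tangent X).res h w) (PMod.Hom.eval φ ((D.twistDown E).toPMod.res h s).1) -
          C.jetEval (σ.mor.app V ((D.twistDown E).toPMod.res h s))
            (PMod.vecComp ((tangent X).res h w) φ) := by
  -- Reflexivity turns the functional on E^* into evaluation at a section of E.
  refine ⟨_, (hE.exists_section (PMod.Hom.mk (E := E.dual) (G := PMod.unit X)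
    (fun V h φ =>
      vderiv ((tangent X).res h w) (PMod.Hom.eval φ ((D.twistDown E).toPMod.res h s).1) -
          C.jetEval (σ.mor.app V ((D.twistDown E).toPMod.res h s))
            (PMod.vecComp ((tangent X).res h w) φ))
    (fun V h φ ψ => ?_) (fun V h f φ => ?_) (fun V W hV hW φ => ?_))).choose_spec⟩
  · rw [PMod.vecComp_add_right, C.jetEval_add, PMod.Hom.add_eval]
    refine (congrArg (· - _) (vderiv_map_add _ _ _)).trans ?_
    ring
  -- The term w(f) φ(s) produced by differentiating f φ(s) cancels against σ(s)(w(f) φ), since σ(s)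
  -- takes the value φ(s) on φ.
  · rw [PMod.vecComp_smul_right, C.jetEval_add, C.jetEval_smul, jetEval_ofHom, PMod.Hom.smul_eval,
      PMod.Hom.smul_eval]
    refine (congrArg (· - _) (vderiv_mul _ _ _)).trans ?_
    simp only [smul_eq_mul]
    ring
  · have h1 := σ.jetEval_res hW ((D.twistDown E).toPMod.res hV s)
      (PMod.vecComp ((tangent X).res hV w) φ)
    rw [PMod.vecComp_res, PMod.res_comp, PMod.res_comp] at h1
    have h2 : vderiv ((tangent X).res (hW.trans hV) w)
        (PMod.Hom.eval (E.dual.res hW φ) ((D.twistDown E).toPMod.res (hW.trans hV) s).1) =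
        X.resO hW (vderiv ((tangent X).res hV w)
          (PMod.Hom.eval φ ((D.twistDown E).toPMod.res hV s).1)) := by
      rw [← vderiv_res, ← (tangent X).res_comp hV hW, ← (D.twistDown E).toPMod.res_comp hV hW]
      exact congrArg _ (PMod.Hom.res_eval (G := PMod.unit X) hW φ _).symm
    rw [h1, h2]
    exact (map_sub (X.resO hW) _ _).symm

/-- The covariant derivative on `E(-D)` defined by `σ`. -/
noncomputable def covariant (w : (tangent X).sec U) (s : (D.twistDown E).toPMod.sec U) : E.sec U :=
  (σ.exists_covariant w s).choose

theorem eval_res_covariant (w : (tangent X).sec U) (s : (D.twistDown E).toPMod.sec U)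
    (h : V ≤ U) (φ : E.dual.sec V) :
    PMod.Hom.eval φ (E.res h (σ.covariant w s)) =
      vderiv ((tangent X).res h w) (PMod.Hom.eval φ ((D.twistDown E).toPMod.res h s).1) -
        C.jetEval (σ.mor.app V ((D.twistDown E).toPMod.res h s))
          (PMod.vecComp ((tangent X).res h w) φ) :=
  (σ.exists_covariant w s).choose_spec V h φ

theorem eval_covariant (w : (tangent X).sec U) (s : (D.twistDown E).toPMod.sec U)
    (φ : E.dual.sec U) :
    PMod.Hom.eval φ (σ.covariant w s) =
      vderiv w (PMod.Hom.eval φ s.1) - C.jetEval (σ.mor.app U s) (PMod.vecComp w φ) := by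
  have h := σ.eval_res_covariant w s le_rfl φ
  rwa [PMod.res_id, PMod.res_id, PMod.res_id] at h

theorem covariant_res (h : V ≤ U) (w : (tangent X).sec U) (s : (D.twistDown E).toPMod.sec U) :
    σ.covariant ((tangent X).res h w) ((D.twistDown E).toPMod.res h s) =
      E.res h (σ.covariant w s) :=
  hE.ext fun W hW φ => by
    rw [eval_res_covariant, E.res_comp h hW, eval_res_covariant, PMod.res_comp, PMod.res_comp]

theorem eq_covariant_of_eval {w : (tangent X).sec U} {s : (D.twistDown E).toPMod.sec U}
    {t : E.sec U} (h : ∀ (V : X.Op) (hV : V ≤ U) (φ : E.dual.sec V),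
      PMod.Hom.eval φ (E.res hV t) =
        PMod.Hom.eval φ (σ.covariant ((tangent X).res hV w) ((D.twistDown E).toPMod.res hV s))) :
    σ.covariant w s = t :=
  (hE.ext fun V hV φ => by rw [h, covariant_res]).symm

theorem covariant_add (w : (tangent X).sec U) (s t : (D.twistDown E).toPMod.sec U) :
    σ.covariant w (s + t) = σ.covariant w s + σ.covariant w t :=
  σ.eq_covariant_of_eval fun V hV φ => by
    rw [map_add, map_add, PMod.Hom.eval_add, ← covariant_res, ← covariant_res, eval_covariant,
      eval_covariant, eval_covariant, map_add, C.add_jetEval]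
    have h1 : ∀ a b : (D.twistDown E).toPMod.sec V, PMod.Hom.eval φ (a + b).1 =
        PMod.Hom.eval φ a.1 + PMod.Hom.eval φ b.1 := fun a b => PMod.Hom.eval_add φ a.1 b.1
    rw [h1]
    refine Eq.trans ?_ (congrArg (· - _) (vderiv_map_add _ _ _)).symm
    ring

/-- As σ is linear over 𝒪_X, the only Leibniz term is the one from w(f φ(s)). -/
theorem covariant_smul (w : (tangent X).sec U) (f : X.O U) (s : (D.twistDown E).toPMod.sec U) :
    σ.covariant w (f • s) = vderiv w f • s.1 + f • σ.covariant w s :=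
  σ.eq_covariant_of_eval fun V hV φ => by
    rw [map_add, E.res_smul, E.res_smul, PMod.Hom.eval_add, PMod.Hom.eval_smul, PMod.Hom.eval_smul,
      PMod.res_smul, ← vderiv_res, ← covariant_res, eval_covariant, eval_covariant, map_smul,
      C.smul_jetEval]
    have h1 : ∀ (a : X.O V) (b : (D.twistDown E).toPMod.sec V), PMod.Hom.eval φ (a • b).1 =
        a * PMod.Hom.eval φ b.1 := fun a b => PMod.Hom.eval_smul φ a b.1
    have h2 : E.res hV s.1 = ((D.twistDown E).toPMod.res hV s).1 := rfl
    rw [h1, vderiv_mul, h2]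
    simp only [smul_eq_mul]
    ring

theorem add_covariant (v w : (tangent X).sec U) (s : (D.twistDown E).toPMod.sec U) :
    σ.covariant (v + w) s = σ.covariant v s + σ.covariant w s :=
  σ.eq_covariant_of_eval fun V hV φ => by
    rw [map_add, map_add, PMod.Hom.eval_add, ← covariant_res, ← covariant_res, eval_covariant,
      eval_covariant, eval_covariant, PMod.vecComp_add_left, C.jetEval_add, vderiv_add]
    ring

theorem smul_covariant (a : X.O U) (w : (tangent X).sec U) (s : (D.twistDown E).toPMod.sec U) :
    σ.covariant (a • w) s = a • σ.covariant w s :=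
  σ.eq_covariant_of_eval fun V hV φ => by
    rw [PMod.res_smul, PMod.res_smul, PMod.Hom.eval_smul, ← covariant_res, eval_covariant,
      eval_covariant, PMod.vecComp_smul_left, C.jetEval_smul, vderiv_smul]
    simp only [smul_eq_mul]
    ring

/-- Write v ∘ φ = (v ∘ φ - φ ∘ ∇_v) + φ ∘ ∇_v. The first summand is a functional, on which σ(s) is
evaluation at s; the second lies in S¹(∇) and is killed by every transverse jet. -/
theorem covariant_foliation (v : F.T.sec U) (s : (D.twistDown E).toPMod.sec U) :
    σ.covariant v.1 s = C.nabla v s.1 :=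
  σ.eq_covariant_of_eval fun V hV φ => by
    have h1 : PMod.vecComp ((tangent X).res hV v.1) φ =
        PMod.ofHom (C.adLinear (F.T.res hV v) φ) + C.prolong φ (F.T.res hV v) :=
      PMod.dapp_ext fun W hW t => by
        rw [map_add, PMod.dapp_add]
        exact (sub_add_cancel _ _).symm
    have h2 : PMod.Hom.eval (C.adLinear (F.T.res hV v) φ) ((D.twistDown E).toPMod.res hV s).1 =
        vderiv ((tangent X).res hV v.1)
          (PMod.Hom.eval φ ((D.twistDown E).toPMod.res hV s).1) -
        PMod.Hom.eval φ (C.nabla (F.T.res le_rfl (F.T.res hV v))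
          ((D.twistDown E).toPMod.res hV s).1) := rfl
    rw [eval_covariant, h1, C.jetEval_add, C.jetEval_prolong, jetEval_ofHom, h2, PMod.res_id,
      ← C.nabla_res]
    have h3 : E.res hV s.1 = ((D.twistDown E).toPMod.res hV s).1 := rfl
    rw [h3]
    ring

/-- The meromorphic connection defined by `σ`. -/
noncomputable def connection : MeromorphicConnection D E :=
  MeromorphicConnection.ofProducts
    -- The Leibniz rule for f s, solved for f ∇_v(s).
    (fun U v s f => σ.covariant v (EffectiveDivisor.mulSection f s) - vderiv v f.1 • s)
    (fun U v s f g => by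
      rw [EffectiveDivisor.add_mulSection, covariant_add]
      refine (congrArg (fun a => _ - a • s) (vderiv_map_add v f.1 g.1)).trans ?_
      rw [add_smul]
      abel)
    (fun U v s c f => by
      rw [EffectiveDivisor.smul_mulSection, covariant_smul]
      refine (congrArg (fun a => _ - a • s) (vderiv_mul v c f.1)).trans ?_
      change vderiv v c • f.1 • s + _ - _ = _
      rw [add_smul, smul_sub, mul_smul, mul_smul, smul_comm f.1]
      abel)
    (fun U v w s f => by
      rw [add_covariant, vderiv_add, add_smul]
      abel)
    (fun U c v s f => by
      rw [smul_covariant, vderiv_smul, smul_sub, mul_smul])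
    (fun U v s t f => by
      rw [EffectiveDivisor.mulSection_add, covariant_add, smul_add]
      abel)
    (fun U v c s f => by
      rw [EffectiveDivisor.mulSection_smul, covariant_smul, smul_sub, smul_comm c]
      change vderiv v c • f.1 • s + _ - _ = _
      rw [smul_comm (vderiv v c)]
      abel)
    (fun U V h v s f => by
      rw [EffectiveDivisor.mulSection_res, covariant_res, map_sub, E.res_smul, ← vderiv_res]
      rfl)

theorem eval_nabla_connection (v : (tangent X).sec U) (s : E.sec U) (f : D.ideal.toPMod.sec U) :
    PMod.Hom.eval (σ.connection.nabla v s) f =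
      σ.covariant v (EffectiveDivisor.mulSection f s) - vderiv v f.1 • s :=
  MeromorphicConnection.eval_nabla_ofProducts _ _ _ _ _ _ _ _ v s f

theorem nabla_connection (v : (tangent X).sec U) (s : (D.twistDown E).toPMod.sec U) :
    σ.connection.nabla v s.1 = D.incl (σ.covariant v s) :=
  PMod.Hom.ext fun V hV f => by
    rw [← EffectiveDivisor.incl_res, EffectiveDivisor.eval_incl,
      ← MeromorphicConnection.nabla_res, eval_nabla_connection, ← covariant_res]
    -- As s already lies in E(-D), the product f s is also an 𝒪_X-multiple inside E(-D), so the
    -- Leibniz rule of `covariant` applies to it.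
    have h1 : EffectiveDivisor.mulSection f (E.res hV s.1) =
        (f.1 : X.O V) • (D.twistDown E).toPMod.res hV s := rfl
    rw [h1, covariant_smul]
    exact add_sub_cancel_left _ _

theorem lift_connection (hG : E.Glues) (v : (tangent X).sec U)
    (s : (D.twistDown E).toPMod.sec U) :
    σ.connection.lift hE hG v s = σ.covariant v s :=
  (MeromorphicConnection.lift_eq_iff _ hE hG _ _ _).2 (σ.nabla_connection v s)

/-- On f s in E(-D) the derivative along T_F is that of the partial connection, whose own Leibniz
rule removes v(f) s. -/
theorem connection_extends : σ.connection.Extends C := fun U v s =>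
  PMod.Hom.ext fun V hV f => by
    rw [← EffectiveDivisor.incl_res, EffectiveDivisor.eval_incl,
      ← MeromorphicConnection.nabla_res, eval_nabla_connection]
    have h1 := σ.covariant_foliation (F.T.res hV v) (EffectiveDivisor.mulSection f (E.res hV s))
    have h2 : C.nabla (F.T.res hV v) (EffectiveDivisor.mulSection f (E.res hV s)).1 =
        vderiv (F.T.res hV v).1 f.1 • E.res hV s + (f.1 : X.O V) • C.nabla (F.T.res hV v) (E.res hV s) :=
      C.nabla_smul _ _ _
    rw [h2, C.nabla_res] at h1
    refine (congrArg (· - _) h1).trans ?_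
    exact add_sub_cancel_left _ _

theorem ext_mor {σ τ : MeromorphicSplitting C hE D}
    (h : ∀ (U : X.Op) (s : (D.twistDown E).toPMod.sec U), σ.mor.app U s = τ.mor.app U s) :
    σ = τ := by
  obtain ⟨m, hm⟩ := σ
  obtain ⟨m', hm'⟩ := τ
  have : m = m' := PMod.Mor.ext (funext fun U => LinearMap.ext (h U))
  subst this
  rfl

/-- The values on functionals are already prescribed by the projection condition. -/
theorem ext_of_vecComp (hT : HasTangentFrames X) {σ τ : MeromorphicSplitting C hE D}
    (h : ∀ (U : X.Op) (s : (D.twistDown E).toPMod.sec U) (w : (tangent X).sec U)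
      (φ : E.dual.sec U), C.jetEval (σ.mor.app U s) (PMod.vecComp w φ) =
        C.jetEval (τ.mor.app U s) (PMod.vecComp w φ)) : σ = τ :=
  ext_mor fun U s => C.jet_ext hT
    (fun V hV φ => by
      rw [← σ.mor.map_res, ← τ.mor.map_res, jetEval_ofHom, jetEval_ofHom])
    (fun V hV w φ => by
      rw [← σ.mor.map_res, ← τ.mor.map_res, h])

end MeromorphicSplitting

/-! ## The correspondence -/

section Correspondence

variable {F : Foliation X} {E : PMod X} (C : PartialConnection F E) (hE : E.IsReflexive)
  (hG : E.Glues) (hT : HasTangentFrames X) (D : EffectiveDivisor X)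

/-- The correspondence between extensions of a partial connection and splittings. -/
noncomputable def extensionEquivSplitting :
    MeromorphicExtension C D ≃ MeromorphicSplitting C hE D where
  toFun N := N.conn.splitting hE hG hT N.isExtension
  invFun σ := ⟨σ.connection, σ.connection_extends⟩
  left_inv N := by
    obtain ⟨N, hN⟩ := N
    -- Both derivatives on E(-D) solve the same formula for φ(∇_v s), and functionals separate
    -- sections of E.
    have hcov : ∀ (U : X.Op) (v : (tangent X).sec U) (s : (D.twistDown E).toPMod.sec U),
        (N.splitting hE hG hT hN).covariant v s = N.lift hE hG v s := fun U v s =>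
      (N.splitting hE hG hT hN).eq_covariant_of_eval fun V hV φ => by
        rw [MeromorphicSplitting.eval_covariant, N.splitting_mor_app, N.jetEval_splitJet,
          N.splitVal_vecComp, N.lift_res]
        ring
    have : (N.splitting hE hG hT hN).connection = N :=
      MeromorphicConnection.ext_nabla fun U v s => PMod.Hom.ext fun V hV f => by
        rw [← MeromorphicConnection.nabla_res, ← MeromorphicConnection.nabla_res,
          MeromorphicSplitting.eval_nabla_connection, hcov, N.lift_mulSection]
        exact add_sub_cancel_left _ _
    have key : ∀ (N' : MeromorphicConnection D E) (hN' : N'.Extends C), N' = N →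
        (⟨N', hN'⟩ : MeromorphicExtension C D) = ⟨N, hN⟩ := by
      rintro _ _ rfl
      rfl
    exact key _ _ this
  -- Substituting one construction into the other gives w(φ(s)) - (w(φ(s)) - σ(s)(w ∘ φ)).
  right_inv σ := MeromorphicSplitting.ext_of_vecComp hT fun U s w φ => by
    rw [MeromorphicConnection.splitting_mor_app, MeromorphicConnection.jetEval_splitJet,
      MeromorphicConnection.splitVal_vecComp, σ.lift_connection, σ.eval_covariant]
    exact sub_sub_cancel _ _

theorem extensionEquivSplitting_apply (N : MeromorphicExtension C D) :
    extensionEquivSplitting C hE hG hT D N = N.conn.splitting hE hG hT N.isExtension := rfl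

variable {C D}

/-- A presentation ∑ ω_j ⊗ t_j of N(s) gives ∇_{e_i}(s) = ∑_j ω_j(e_i) t_j. Summing over i first
reassembles the symbol of P at t_j from its coordinates, and leaves ω_j of it. -/
theorem isAssociated_splitting (N : MeromorphicExtension C D) :
    (N.conn.splitting hE hG hT N.isExtension).IsAssociated N.conn := by
  intro U s n ω t hω P
  rw [MeromorphicConnection.splitting_mor_app, MeromorphicConnection.jetEval_splitJet]
  refine MeromorphicConnection.eq_of_frames hT fun V h e => ?_
  rw [MeromorphicConnection.resO_splitVal (e := e), map_sub, map_sum]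
  refine congrArg₂ _ (PMod.dapp_res h P s.1) ?_
  have hlift : ∀ i, N.conn.lift hE hG (e.vec i) ((D.twistDown E).toPMod.res h s) =
      ∑ j, PMod.Hom.eval ((Omega X).res h (ω j)) (e.vec i) • E.res h (t j) := fun i =>
    (N.conn.lift_eq_iff hE hG _ _ _).2 (hω V h (e.vec i))
  have h1 : ∀ i, PMod.Hom.eval (e.form i) (PMod.symbol ((PMod.Diff 1 E (PMod.unit X)).res h P)
      (N.conn.lift hE hG (e.vec i) ((D.twistDown E).toPMod.res h s))) =
      ∑ j, PMod.Hom.eval (e.form i) (PMod.symbol ((PMod.Diff 1 E (PMod.unit X)).res h P)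
        (E.res h (t j))) * PMod.Hom.eval ((Omega X).res h (ω j)) (e.vec i) := fun i => by
    rw [hlift, PMod.symbol_sum, PMod.Hom.eval_sum]
    refine Finset.sum_congr rfl fun j _ => ?_
    rw [PMod.symbol_map_smul, PMod.Hom.eval_smul]
    exact mul_comm _ _
  rw [Finset.sum_congr rfl fun i _ => h1 i, Finset.sum_comm]
  refine Finset.sum_congr rfl fun j _ => ?_
  refine Eq.trans ?_ (PMod.Hom.res_eval (G := PMod.unit X) h (ω j) _).symm
  rw [← PMod.symbol_res]
  conv_rhs => rw [e.expand' (PMod.symbol ((PMod.Diff 1 E (PMod.unit X)).res h P) (E.res h (t j)))]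
  rw [PMod.Hom.eval_sum]
  refine Finset.sum_congr rfl fun i _ => ?_
  rw [PMod.Hom.eval_smul]
  rfl

/-- Over an open set with a frame, N(s) always has the presentation ∑ e^i ⊗ ∇_{e_i}(s). Being
associated with N therefore fixes the values of a splitting locally, and this is the uniqueness in
the characterization. -/
theorem eq_splitting_of_isAssociated (N : MeromorphicExtension C D)
    {σ : MeromorphicSplitting C hE D} (hσ : σ.IsAssociated N.conn) :
    N.conn.splitting hE hG hT N.isExtension = σ := by
  refine MeromorphicSplitting.ext_of_vecComp hT fun U s w φ =>
    MeromorphicConnection.eq_of_frames hT fun V h e => ?_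
  rw [← MeromorphicSplitting.jetEval_res, ← MeromorphicSplitting.jetEval_res]
  set s' := (D.twistDown E).toPMod.res h s
  have hN : ∀ (W : X.Op) (hW : W ≤ V) (v : (tangent X).sec W),
      N.conn.nabla v (E.res hW s'.1) =
        D.incl (∑ i, PMod.Hom.eval ((Omega X).res hW (e.form i)) v •
          E.res hW (N.conn.lift hE hG (e.vec i) s')) := by
    intro W hW v
    have h1 := (N.conn.incl_lift hE hG v ((D.twistDown E).toPMod.res hW s')).symm
    refine h1.trans (congrArg _ ?_)
    conv_lhs => rw [e.expand W hW v]
    rw [MeromorphicConnection.sum_lift]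
    refine Finset.sum_congr rfl fun i _ => ?_
    rw [MeromorphicConnection.smul_lift, MeromorphicConnection.lift_res]
  have h1 := hσ V s' _ e.form _ hN ((PMod.Diff 1 E (PMod.unit X)).res h (PMod.vecComp w φ))
  have h2 := isAssociated_splitting hE hG hT N V s' _ e.form _ hN
    ((PMod.Diff 1 E (PMod.unit X)).res h (PMod.vecComp w φ))
  rw [h1, h2]

theorem extensionEquivSplitting_eq_iff (N : MeromorphicExtension C D)
    (σ : MeromorphicSplitting C hE D) :
    extensionEquivSplitting C hE hG hT D N = σ ↔ σ.IsAssociated N.conn :=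
  ⟨fun h => h ▸ isAssociated_splitting hE hG hT N, eq_splitting_of_isAssociated hE hG hT N⟩

end Correspondence

/-! ## Horizontal splittings -/

namespace PartialConnection

variable {F : Foliation X} {E : PMod X} (C : PartialConnection F E) {U V : X.Op}

theorem eval_adLinear (v : F.T.sec U) (φ : E.dual.sec U) (s : E.sec U) :
    PMod.Hom.eval (C.adLinear v φ) s =
      vderiv v.1 (PMod.Hom.eval φ s) - PMod.Hom.eval φ (C.nabla v s) := by
  have h : PMod.Hom.eval (C.adLinear v φ) s =
      vderiv v.1 (PMod.Hom.eval φ s) - PMod.Hom.eval φ (C.nabla (F.T.res le_rfl v) s) := rfl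
  rw [h, PMod.res_id]

/-- From v w φ - w φ ∇_v = [v,w] φ + w (v φ - φ ∇_v): the bracket with v stays among operators on
which the splitting is explicit. -/
theorem ad_vecComp (v : F.T.sec U) (w : (tangent X).sec U) (φ : E.dual.sec U) :
    C.ad v (PMod.vecComp w φ) =
      PMod.vecComp (bracket v.1 w) φ + PMod.vecComp w (C.adLinear v φ) :=
  PMod.dapp_ext fun V hV s => by
    rw [map_add, PMod.dapp_add]
    have h1 : PMod.dapp ((PMod.Diff 1 E (PMod.unit X)).res hV (C.ad v (PMod.vecComp w φ))) s =
        vderiv ((tangent X).res hV v.1)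
          (vderiv ((tangent X).res hV w) (PMod.Hom.eval (E.dual.res hV φ) s)) -
        vderiv ((tangent X).res hV w)
          (PMod.Hom.eval (E.dual.res hV φ) (C.nabla (F.T.res hV v) s)) := rfl
    have h2 : PMod.dapp ((PMod.Diff 1 E (PMod.unit X)).res hV
        (PMod.vecComp w (C.adLinear v φ))) s =
        vderiv ((tangent X).res hV w) (vderiv ((tangent X).res hV v.1)
          (PMod.Hom.eval (E.dual.res hV φ) s) -
            PMod.Hom.eval (E.dual.res hV φ) (C.nabla (F.T.res hV v) s)) := rfl
    rw [h1, h2, PMod.vecComp_res, PMod.dapp_vecComp, ← bracket_res, vderiv_bracket, vderiv_map_sub]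
    ring

theorem jetEval_jetNabla (hC : C.IsFlat) (v : F.T.sec U) (ξ : C.transverseJet.sec U)
    (P : (PMod.Diff 1 E (PMod.unit X)).sec U) :
    C.jetEval (C.jetNabla hC v ξ) P = vderiv v.1 (C.jetEval ξ P) - C.jetEval ξ (C.ad v P) := by
  have h : C.jetEval (C.jetNabla hC v ξ) P =
      vderiv v.1 (C.jetEval ξ P) - C.jetEval ξ (C.ad (F.T.res le_rfl v) P) := rfl
  rw [h, PMod.res_id]

theorem jetNabla_res (hC : C.IsFlat) (h : V ≤ U) (v : F.T.sec U) (ξ : C.transverseJet.sec U) :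
    C.jetNabla hC (F.T.res h v) (C.transverseJet.res h ξ) =
      C.transverseJet.res h (C.jetNabla hC v ξ) :=
  C.jet_ext_of_eval fun W hW P => by
    have h1 : C.jetEval (C.transverseJet.res hW
        (C.jetNabla hC (F.T.res h v) (C.transverseJet.res h ξ))) P =
        vderiv ((tangent X).res (hW.trans h) v.1) (C.jetEval (C.transverseJet.res (hW.trans h) ξ) P)
        - C.jetEval (C.transverseJet.res (hW.trans h) ξ) (C.ad (F.T.res hW (F.T.res h v)) P) := rfl
    have h2 : C.jetEval (C.transverseJet.res hW (C.transverseJet.res h (C.jetNabla hC v ξ))) P =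
        vderiv ((tangent X).res (hW.trans h) v.1) (C.jetEval (C.transverseJet.res (hW.trans h) ξ) P)
        - C.jetEval (C.transverseJet.res (hW.trans h) ξ) (C.ad (F.T.res (hW.trans h) v) P) := rfl
    rw [h1, h2, PMod.res_comp]

end PartialConnection

/-! ### The curvature is alternating and bilinear over 𝒪_X -/

namespace MeromorphicConnection

variable {D : EffectiveDivisor X} {E : PMod X} (N : MeromorphicConnection D E) {U V : X.Op}

/-- The curvature `∇_{[v,w]} - ∇_v ∘ ∇_w + ∇_w ∘ ∇_v` at `s`, multiplied with `f` and `g`. -/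
def curvature (v w : (tangent X).sec U) (s : E.sec U) (f g : D.ideal.toPMod.sec U) : E.sec U :=
  (g.1 : X.O U) • PMod.Hom.eval (N.nabla (bracket v w) s) f -
    (N.nablaTwist v (N.nabla w s) f g - N.nablaTwist w (N.nabla v s) f g)

theorem isFlat_iff : N.IsFlat ↔ ∀ (U : X.Op) (v w : (tangent X).sec U) (s : E.sec U)
    (f g : D.ideal.toPMod.sec U), N.curvature v w s f g = 0 :=
  ⟨fun h U v w s f g => sub_eq_zero.2 (h U v w s f g),
    fun h U v w s f g => sub_eq_zero.1 (h U v w s f g)⟩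

theorem eval_nabla_smul (v : (tangent X).sec U) (c : X.O U) (s : E.sec U)
    (f : D.ideal.toPMod.sec U) :
    PMod.Hom.eval (N.nabla v (c • s)) f =
      (f.1 * vderiv v c : X.O U) • s + c • PMod.Hom.eval (N.nabla v s) f := by
  rw [nabla_smul, PMod.Hom.add_eval, PMod.Hom.smul_eval, EffectiveDivisor.eval_incl, smul_smul]

theorem eval_add_nabla (v w : (tangent X).sec U) (s : E.sec U) (f : D.ideal.toPMod.sec U) :
    PMod.Hom.eval (N.nabla (v + w) s) f =
      PMod.Hom.eval (N.nabla v s) f + PMod.Hom.eval (N.nabla w s) f := by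
  rw [add_nabla, PMod.Hom.add_eval]

theorem eval_smul_nabla (c : X.O U) (v : (tangent X).sec U) (s : E.sec U)
    (f : D.ideal.toPMod.sec U) :
    PMod.Hom.eval (N.nabla (c • v) s) f = c • PMod.Hom.eval (N.nabla v s) f := by
  rw [smul_nabla, PMod.Hom.smul_eval]

theorem eval_nabla_add (v : (tangent X).sec U) (s t : E.sec U) (f : D.ideal.toPMod.sec U) :
    PMod.Hom.eval (N.nabla v (s + t)) f =
      PMod.Hom.eval (N.nabla v s) f + PMod.Hom.eval (N.nabla v t) f := by
  rw [nabla_add, PMod.Hom.add_eval]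

theorem curvature_res (h : V ≤ U) (v w : (tangent X).sec U) (s : E.sec U)
    (f g : D.ideal.toPMod.sec U) :
    E.res h (N.curvature v w s f g) =
      N.curvature ((tangent X).res h v) ((tangent X).res h w) (E.res h s)
        (D.ideal.toPMod.res h f) (D.ideal.toPMod.res h g) := by
  have h1 : ∀ (u : (tangent X).sec U) (t : E.sec U) (k : D.ideal.toPMod.sec U),
      E.res h (PMod.Hom.eval (N.nabla u t) k) =
        PMod.Hom.eval (N.nabla ((tangent X).res h u) (E.res h t)) (D.ideal.toPMod.res h k) := by
    intro u t k
    rw [PMod.Hom.res_eval, nabla_res]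
  have h2 : ∀ (u : (tangent X).sec U) (k : D.ideal.toPMod.sec U),
      X.resO h (vderiv u k.1) = vderiv ((tangent X).res h u) (D.ideal.toPMod.res h k).1 :=
    fun u k => (vderiv_res h u k.1).symm
  unfold curvature nablaTwist
  rw [map_sub, map_sub, map_sub, map_sub, E.res_smul, E.res_smul, E.res_smul, h1, h1, h1, h1, h1,
    h1, h1, h2, h2, bracket_res]
  rfl

theorem bracket_add_left (v v' w : (tangent X).sec U) :
    bracket (v + v') w = bracket v w + bracket v' w :=
  tangent_ext fun V hV f => by
    rw [map_add, vderiv_add, ← bracket_res, ← bracket_res, ← bracket_res, map_add, vderiv_bracket,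
      vderiv_bracket, vderiv_bracket, vderiv_add, vderiv_add, vderiv_map_add]
    ring

theorem bracket_smul_left (c : X.O U) (v w : (tangent X).sec U) :
    bracket (c • v) w + vderiv w c • v = c • bracket v w :=
  tangent_ext fun V hV f => by
    rw [map_add, vderiv_add, PMod.res_smul, PMod.res_smul, ← bracket_res, ← bracket_res,
      PMod.res_smul, ← vderiv_res, vderiv_smul, vderiv_smul, vderiv_bracket,
      vderiv_bracket, vderiv_smul, vderiv_smul, vderiv_mul]
    ring

theorem bracket_swap (v w : (tangent X).sec U) : bracket w v = (-1 : X.O U) • bracket v w :=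
  tangent_ext fun V hV f => by
    rw [PMod.res_smul, vderiv_smul, ← bracket_res, ← bracket_res, vderiv_bracket, vderiv_bracket,
      map_neg, map_one]
    ring

theorem curvature_add_left (v v' w : (tangent X).sec U) (s : E.sec U)
    (f g : D.ideal.toPMod.sec U) :
    N.curvature (v + v') w s f g = N.curvature v w s f g + N.curvature v' w s f g := by
  unfold curvature nablaTwist
  rw [bracket_add_left, eval_add_nabla, eval_add_nabla, eval_add_nabla, eval_add_nabla,
    eval_nabla_add, vderiv_add, add_smul, smul_add, smul_add]
  abel

/-- Two derivatives of c cancel: [c v, w] contributes -w(c) ∇_v s, and differentiating c ∇_v s along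
w contributes w(c) ∇_v s. -/
theorem curvature_smul_left (c : X.O U) (v w : (tangent X).sec U) (s : E.sec U)
    (f g : D.ideal.toPMod.sec U) :
    N.curvature (c • v) w s f g = c • N.curvature v w s f g := by
  have h1 : PMod.Hom.eval (N.nabla (bracket (c • v) w) s) f =
      c • PMod.Hom.eval (N.nabla (bracket v w) s) f -
        vderiv w c • PMod.Hom.eval (N.nabla v s) f := by
    rw [eq_sub_iff_add_eq, ← eval_smul_nabla, ← eval_smul_nabla, ← eval_add_nabla,
      bracket_smul_left]
  unfold curvature nablaTwist
  rw [h1, eval_smul_nabla, eval_smul_nabla, eval_smul_nabla, eval_nabla_smul, vderiv_smul]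
  module

theorem curvature_swap (v w : (tangent X).sec U) (s : E.sec U) (f g : D.ideal.toPMod.sec U) :
    N.curvature w v s f g = -N.curvature v w s f g := by
  unfold curvature
  rw [bracket_swap v w, eval_smul_nabla]
  module

theorem curvature_self (v : (tangent X).sec U) (s : E.sec U) (f g : D.ideal.toPMod.sec U) :
    N.curvature v v s f g = 0 := by
  unfold curvature
  -- The zero field is written as a multiple so that linearity in the vector field disposes of the
  -- bracket term.
  have h : bracket v v = (0 : X.O U) • v :=
    tangent_ext fun V hV f => by
      rw [PMod.res_smul, vderiv_smul, map_zero, zero_mul, ← bracket_res, vderiv_bracket, sub_self]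
  rw [h, eval_smul_nabla, zero_smul, smul_zero, sub_self, sub_self]

theorem curvature_sum_left {ι : Type*} (a : Finset ι) (c : ι → X.O U) (v : ι → (tangent X).sec U)
    (w : (tangent X).sec U) (s : E.sec U) (f g : D.ideal.toPMod.sec U) :
    N.curvature (∑ i ∈ a, c i • v i) w s f g = ∑ i ∈ a, c i • N.curvature (v i) w s f g := by
  have := map_sum (AddMonoidHom.mk' (fun u => N.curvature u w s f g)
    (fun u u' => N.curvature_add_left u u' w s f g)) (fun i => c i • v i) a
  refine this.trans (Finset.sum_congr rfl fun i _ => N.curvature_smul_left (c i) (v i) w s f g)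

/-- Linearity in the second argument follows from the first by antisymmetry, so pairs of frame
members suffice. -/
theorem curvature_eq_zero_of_frame (e : TangentFrame U) (s : E.sec U)
    (f g : D.ideal.toPMod.sec U)
    (he : ∀ i j, N.curvature (e.vec i) (e.vec j) s f g = 0) (v w : (tangent X).sec U) :
    N.curvature v w s f g = 0 := by
  have key : ∀ i, N.curvature (e.vec i) w s f g = 0 := fun i => by
    rw [curvature_swap, e.expand' w, curvature_sum_left, Finset.sum_eq_zero, neg_zero]
    intro j _
    rw [he, smul_zero]
  rw [e.expand' v, curvature_sum_left, Finset.sum_eq_zero]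
  intro i _
  rw [key, smul_zero]

end MeromorphicConnection

/-! ### Horizontality of the splitting and the curvature along the foliation -/

section Horizontal

variable {F : Foliation X} {E : PMod X} {C : PartialConnection F E} {hE : E.IsReflexive}
  (hG : E.Glues) (hT : HasTangentFrames X) {D : EffectiveDivisor X} (hD : D.IsInvariant F)
  {U V : X.Op}

/-- The restriction of `∇_v` to `E(-D)`, for `D` invariant. -/
def PartialConnection.nablaDown (C : PartialConnection F E) (v : F.T.sec U)
    (s : (D.twistDown E).toPMod.sec U) : (D.twistDown E).toPMod.sec U :=
  ⟨C.nabla v s.1, EffectiveDivisor.nabla_mem_twistDown hD C v s.2⟩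

theorem PartialConnection.nablaDown_res (h : V ≤ U) (v : F.T.sec U)
    (s : (D.twistDown E).toPMod.sec U) :
    C.nablaDown hD (F.T.res h v) ((D.twistDown E).toPMod.res h s) =
      (D.twistDown E).toPMod.res h (C.nablaDown hD v s) :=
  Subtype.ext (C.nabla_res h v s.1)

/-- The two jets to be compared agree on functionals without any assumption. On w ∘ φ their
difference is φ of the curvature expression on E(-D), and functionals detect sections of a reflexive
sheaf. -/
theorem isHorizontal_splitting_iff (hC : C.IsFlat) (N : MeromorphicExtension C D) :
    (N.conn.splitting hE hG hT N.isExtension).IsHorizontal hC hD ↔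
      ∀ (U : X.Op) (v : F.T.sec U) (w : (tangent X).sec U) (s : (D.twistDown E).toPMod.sec U),
        N.conn.lift hE hG (bracket v.1 w) s =
          C.nabla v (N.conn.lift hE hG w s) - N.conn.lift hE hG w (C.nablaDown hD v s) := by
  obtain ⟨N, hN⟩ := N
  change (N.splitting hE hG hT hN).IsHorizontal hC hD ↔ _
  -- Expanding with `ad_vecComp`, the second derivatives of φ(s) cancel against the bracket, and the
  -- derivatives of φ(∇_w s) and φ(∇_v s) cancel in pairs.
  have hvec : ∀ (U : X.Op) (v : F.T.sec U) (w : (tangent X).sec U)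
      (s : (D.twistDown E).toPMod.sec U) (φ : E.dual.sec U),
      C.jetEval (C.jetNabla hC v (N.splitJet hE hG hT hN s)) (PMod.vecComp w φ) -
        C.jetEval (N.splitJet hE hG hT hN (C.nablaDown hD v s)) (PMod.vecComp w φ) =
      PMod.Hom.eval φ (N.lift hE hG (bracket v.1 w) s) - PMod.Hom.eval φ
        (C.nabla v (N.lift hE hG w s) - N.lift hE hG w (C.nablaDown hD v s)) := by
    intro U v w s φ
    rw [C.jetEval_jetNabla, C.ad_vecComp, C.jetEval_add, N.jetEval_splitJet, N.jetEval_splitJet,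
      N.jetEval_splitJet, N.jetEval_splitJet, N.splitVal_vecComp, N.splitVal_vecComp,
      N.splitVal_vecComp, N.splitVal_vecComp, C.eval_adLinear, C.eval_adLinear, vderiv_bracket,
      vderiv_map_sub, vderiv_map_sub, PMod.Hom.eval_sub]
    have h1 : PMod.Hom.eval φ (C.nablaDown hD v s).1 = PMod.Hom.eval φ (C.nabla v s.1) := rfl
    rw [h1]
    ring
  constructor
  · intro h U v w s
    refine hE.ext fun V hV φ => sub_eq_zero.1 ?_
    have h1 := hvec V (F.T.res hV v) ((tangent X).res hV w) ((D.twistDown E).toPMod.res hV s) φ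
    have h2 := h V (F.T.res hV v) ((D.twistDown E).toPMod.res hV s)
    change N.splitJet hE hG hT hN (C.nablaDown hD _ _) =
      C.jetNabla hC _ (N.splitJet hE hG hT hN _) at h2
    rw [h2, sub_self, N.lift_res, C.nabla_res, C.nablaDown_res, N.lift_res, ← map_sub] at h1
    have h3 : bracket (F.T.res hV v).1 ((tangent X).res hV w) =
      (tangent X).res hV (bracket v.1 w) := rfl
    rw [h3, N.lift_res] at h1
    exact h1.symm
  · intro h U v s
    change N.splitJet hE hG hT hN (C.nablaDown hD v s) =
      C.jetNabla hC v (N.splitJet hE hG hT hN s)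
    refine C.jet_ext hT (fun V hV φ => ?_) (fun V hV w φ => ?_)
    · have h0 : C.ad (F.T.res hV v) (PMod.ofHom φ) = PMod.ofHom (C.adLinear (F.T.res hV v) φ) := rfl
      rw [← C.jetNabla_res, ← N.splitJet_res, ← N.splitJet_res, ← C.nablaDown_res hD,
        C.jetEval_jetNabla, h0, N.jetEval_splitJet, N.jetEval_splitJet, N.jetEval_splitJet,
        N.splitVal_ofHom, N.splitVal_ofHom, N.splitVal_ofHom, C.eval_adLinear]
      exact (sub_sub_cancel _ _).symm
    · rw [← C.jetNabla_res, ← N.splitJet_res, ← N.splitJet_res, ← C.nablaDown_res hD]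
      have h1 := hvec V (F.T.res hV v) w ((D.twistDown E).toPMod.res hV s) φ
      rw [h V (F.T.res hV v) w ((D.twistDown E).toPMod.res hV s), sub_self] at h1
      exact (sub_eq_zero.1 h1).symm

/-- Horizontality means that the curvature vanishes in the directions of `F`. -/
theorem isHorizontal_iff_curvature (hC : C.IsFlat) (N : MeromorphicExtension C D) :
    (N.conn.splitting hE hG hT N.isExtension).IsHorizontal hC hD ↔
      ∀ (U : X.Op) (v : F.T.sec U) (w : (tangent X).sec U) (s : E.sec U)
        (f g : D.ideal.toPMod.sec U), N.conn.curvature v.1 w s f g = 0 := by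
  rw [isHorizontal_splitting_iff]
  obtain ⟨N, hN⟩ := N
  change (∀ (U : X.Op) (v : F.T.sec U) (w : (tangent X).sec U)
    (s : (D.twistDown E).toPMod.sec U), N.lift hE hG (bracket v.1 w) s =
      C.nabla v (N.lift hE hG w s) - N.lift hE hG w (C.nablaDown hD v s)) ↔
      ∀ (U : X.Op) (v : F.T.sec U) (w : (tangent X).sec U) (s : E.sec U)
        (f g : D.ideal.toPMod.sec U), N.curvature v.1 w s f g = 0
  have hF : ∀ (U : X.Op) (v : F.T.sec U) (s : E.sec U) (f : D.ideal.toPMod.sec U),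
      PMod.Hom.eval (N.nabla v.1 s) f = (f.1 : X.O U) • C.nabla v s := fun U v s f => by
    rw [hN U v s, EffectiveDivisor.eval_incl]
  constructor
  · intro h U v w s f g
    have hvf : vderiv v.1 f.1 ∈ D.ideal.carrier U := hD U v f.1 f.2
    -- The hypothesis concerns E(-D), so it is applied to f s. What remains after the Leibniz terms
    -- cancel is the formula `h5` for f ∇_{[v,w]}(s).
    have h1 := h U v w (EffectiveDivisor.mulSection f s)
    have h2 : C.nablaDown hD v (EffectiveDivisor.mulSection f s) =
        EffectiveDivisor.mulSection (⟨vderiv v.1 f.1, hvf⟩ : D.ideal.toPMod.sec U) s +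
          EffectiveDivisor.mulSection f (C.nabla v s) :=
      Subtype.ext (C.nabla_smul v f.1 s)
    rw [h2, N.lift_add, N.lift_mulSection, N.lift_mulSection, N.lift_mulSection,
      N.lift_mulSection, C.nabla_add, C.nabla_smul, vderiv_bracket] at h1
    -- By invariance of D, v(f) lies in 𝒪_X(-D), so a section of E(D) may be evaluated on it and the
    -- factor exchanged with g.
    have h3 := EffectiveDivisor.smul_eval_comm (N.nabla w s) g
      (⟨vderiv v.1 f.1, hvf⟩ : D.ideal.toPMod.sec U)
    have h4 := EffectiveDivisor.smul_eval_comm (N.nabla w (C.nabla v s)) g f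
    change (g.1 : X.O U) • _ = vderiv v.1 f.1 • _ at h3
    have h5 : PMod.Hom.eval (N.nabla (bracket v.1 w) s) f =
        C.nabla v (PMod.Hom.eval (N.nabla w s) f) -
        PMod.Hom.eval (N.nabla w s) (⟨vderiv v.1 f.1, hvf⟩ : D.ideal.toPMod.sec U) -
        PMod.Hom.eval (N.nabla w (C.nabla v s)) f := by
      change (vderiv v.1 (vderiv w f.1) - vderiv w (vderiv v.1 f.1)) • s + _ =
        vderiv v.1 (vderiv w f.1) • s + vderiv w f.1 • C.nabla v s + _ -
        (vderiv w (vderiv v.1 f.1) • s + _ + (vderiv w f.1 • C.nabla v s + _)) at h1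
      rw [← sub_eq_zero] at h1 ⊢
      rw [← h1]
      module
    unfold MeromorphicConnection.curvature MeromorphicConnection.nablaTwist
    rw [hF, hF, hF, N.eval_nabla_smul, h5, smul_sub, smul_sub, h3, h4]
    module
  · intro h U v w s
    -- The curvature lives in E(2D): one factor f and one factor g of 𝒪_X(-D) are introduced in
    -- order to compare with it.
    refine EffectiveDivisor.section_ext hE hG D fun V hV f => ?_
    refine EffectiveDivisor.section_ext hE hG D fun W hW g => ?_
    rw [E.res_smul, E.res_smul, PMod.res_comp, PMod.res_comp, map_sub, ← C.nabla_res,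
      ← N.lift_res, ← N.lift_res, ← N.lift_res, ← C.nablaDown_res]
    set s' := (D.twistDown E).toPMod.res (hW.trans hV) s
    have h3 : (tangent X).res (hW.trans hV) (bracket v.1 w) =
      bracket (F.T.res (hW.trans hV) v).1 ((tangent X).res (hW.trans hV) w) := rfl
    rw [h3]
    set v' := F.T.res (hW.trans hV) v
    set w' := (tangent X).res (hW.trans hV) w
    have h4 : X.resO hW f.1 = (D.ideal.toPMod.res hW f).1 := rfl
    rw [h4]
    set f' := D.ideal.toPMod.res hW f
    have h1 := h W v' w' s'.1 f' g
    have hl : ∀ (u : (tangent X).sec W) (t : (D.twistDown E).toPMod.sec W)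
        (k : D.ideal.toPMod.sec W),
        PMod.Hom.eval (N.nabla u t.1) k = (k.1 : X.O W) • N.lift hE hG u t := fun u t k => by
      rw [← N.incl_lift hE hG, EffectiveDivisor.eval_incl]
    have hl' : PMod.Hom.eval (N.nabla w' (C.nabla v' s'.1)) g =
        (g.1 : X.O W) • N.lift hE hG w' (C.nablaDown hD v' s') := hl w' (C.nablaDown hD v' s') g
    unfold MeromorphicConnection.curvature MeromorphicConnection.nablaTwist at h1
    rw [hl, hl, hl, hF, hF, hF, N.eval_nabla_smul, hl', C.nabla_smul] at h1
    rw [← sub_eq_zero, ← h1]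
    module

end Horizontal

/-! ## Foliations of codimension one -/

variable (X) in
/-- Nonzero functions are invertible on some nonempty open subset, where `0 ≠ 1`. -/
structure GenericallyInvertible : Prop where
  exists_isUnit : ∀ {U : X.Op} (f : X.O U), f ≠ 0 →
    ∃ (V : X.Op) (h : V ≤ U), (∃ x, x ∈ V) ∧ IsUnit (X.resO h f)
  nontrivial : ∀ {U : X.Op}, (∃ x, x ∈ U) → Nontrivial (X.O U)

/-! ### Exchange of frame members, and frames adapted to a foliation -/

namespace TangentFrame

variable {U V : X.Op}

/-- Replacing the `i`-th field of a frame by `v`, if the `i`-th coordinate of `v` is invertible. -/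
def replace (e : TangentFrame U) (i : Fin e.n) (v : (tangent X).sec U) (u : X.O U)
    (hu : u * PMod.Hom.eval (e.form i) v = 1) : TangentFrame U where
  n := e.n
  -- This is v for j = i and e_j otherwise. The dual forms are u e^i for j = i and e^j - e^j(v) u
  -- e^i otherwise.
  vec j := e.vec j + (if i = j then (1 : X.O U) else 0) • (v - e.vec j)
  form j := e.form j -
    ((PMod.Hom.eval (e.form j) v - if i = j then (1 : X.O U) else 0) * u) • e.form i
  expand V h x := by
    have hx := e.expand V h x
    have hv := e.expand V h ((tangent X).res h v)
    have hres : ∀ (c : X.O U) (w : (tangent X).sec U),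
      (tangent X).res h (c • w) = X.resO h c • (tangent X).res h w := fun c w => PMod.res_smul _ _ _ _
    have hform : ∀ j, PMod.Hom.eval ((Omega X).res h (e.form j -
        ((PMod.Hom.eval (e.form j) v - if i = j then (1 : X.O U) else 0) * u) • e.form i)) x =
        PMod.Hom.eval ((Omega X).res h (e.form j)) x -
          (PMod.Hom.eval ((Omega X).res h (e.form j)) ((tangent X).res h v) -
            if i = j then (1 : X.O V) else 0) * X.resO h u *
              PMod.Hom.eval ((Omega X).res h (e.form i)) x := by
      intro j
      rw [map_sub, PMod.Hom.sub_eval, PMod.res_smul, PMod.Hom.smul_eval, map_mul, map_sub]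
      have h1 : X.resO h (PMod.Hom.eval (e.form j) v) =
        PMod.Hom.eval ((Omega X).res h (e.form j)) ((tangent X).res h v) :=
        PMod.Hom.res_eval (G := PMod.unit X) h (e.form j) v
      have h2 : X.resO h (if i = j then (1 : X.O U) else 0) = if i = j then (1 : X.O V) else 0 :=
        (apply_ite (X.resO h) _ _ _).trans (by rw [map_one, map_zero])
      rw [h1, h2]
      rfl
    have hone : X.resO h u * PMod.Hom.eval ((Omega X).res h (e.form i)) ((tangent X).res h v) =
        1 := by
      have h1 : X.resO h (PMod.Hom.eval (e.form i) v) =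
        PMod.Hom.eval ((Omega X).res h (e.form i)) ((tangent X).res h v) :=
        PMod.Hom.res_eval (G := PMod.unit X) h (e.form i) v
      rw [← h1, ← map_mul, hu, map_one]
    have hvec : ∀ j, (tangent X).res h (e.vec j +
        (if i = j then (1 : X.O U) else 0) • (v - e.vec j)) = (tangent X).res h (e.vec j) +
        (if i = j then (1 : X.O V) else 0) • ((tangent X).res h v - (tangent X).res h (e.vec j)) := by
      intro j
      have h2 : X.resO h (if i = j then (1 : X.O U) else 0) = if i = j then (1 : X.O V) else 0 :=
        (apply_ite (X.resO h) _ _ _).trans (by rw [map_one, map_zero])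
      rw [map_add, hres, map_sub, h2]
    refine Eq.trans ?_ (Finset.sum_congr rfl fun j _ => congrArg₂ (· • ·) (hform j) (hvec j)).symm
    generalize (tangent X).res h v = v' at *
    have hω : ∀ j, ∃ a : X.O V, PMod.Hom.eval ((Omega X).res h (e.form j)) x = a :=
      fun j => ⟨_, rfl⟩
    choose a ha using hω
    have hω : ∀ j, ∃ b : X.O V, PMod.Hom.eval ((Omega X).res h (e.form j)) v' = b :=
      fun j => ⟨_, rfl⟩
    choose b hb using hω
    have hε : ∀ j, ∃ w : (tangent X).sec V, (tangent X).res h (e.vec j) = w := fun j => ⟨_, rfl⟩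
    choose w hw using hε
    simp only [ha, hb, hw] at hx hv hone ⊢
    generalize X.resO h u = u' at *
    -- Here a and b are the coordinates of x and v. Summation over j gives x - (u a_i) v from the
    -- first two terms, and the term at j = i restores (u a_i) v; its last part vanishes because u
    -- b_i = 1.
    have h1 : ∀ j ∈ Finset.univ, (a j - (b j - if i = j then (1 : X.O V) else 0) * u' * a i) •
        (w j + (if i = j then (1 : X.O V) else 0) • (v' - w j)) =
        a j • w j - (u' * a i) • (b j • w j) +
          (if i = j then (u' * a i) • v' + (a i - b i * u' * a i) • (v' - w i) else 0) := by
      intro j _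
      split_ifs with hij
      · subst hij
        module
      · module
    rw [Finset.sum_congr rfl h1, Finset.sum_add_distrib, Finset.sum_sub_distrib,
      ← Finset.smul_sum, ← hx, ← hv, Finset.sum_ite_eq, if_pos (Finset.mem_univ i)]
    have h2 : a i - b i * u' * a i = 0 := by
      rw [mul_comm (b i), hone]
      ring
    rw [h2]
    module
  pair j k := by
    have hp := e.pair
    rw [PMod.Hom.eval_add, PMod.Hom.eval_smul, PMod.Hom.eval_sub, PMod.Hom.sub_eval,
      PMod.Hom.sub_eval, PMod.Hom.smul_eval, PMod.Hom.smul_eval, hp, hp]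
    simp only [smul_eq_mul]
    by_cases hik : i = k
    · subst hik
      have hji : (if j = i then (1 : X.O U) else 0) = if i = j then 1 else 0 :=
        if_congr eq_comm rfl rfl
      rw [if_pos rfl, hji]
      have h1 : ∀ b c d δ : X.O U, u * b = 1 → d - (c - δ) * u * 1 +
          1 * (c - (c - δ) * u * b - (d - (c - δ) * u * 1)) = δ := by
        intro b c d δ hb
        linear_combination (δ - c) * hb
      exact h1 _ _ _ _ hu
    · rw [if_neg hik]
      ring

theorem replace_vec_self (e : TangentFrame U) (i : Fin e.n) (v : (tangent X).sec U) (u : X.O U)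
    (hu : u * PMod.Hom.eval (e.form i) v = 1) : (e.replace i v u hu).vec i = v := by
  change e.vec i + (if i = i then (1 : X.O U) else 0) • (v - e.vec i) = v
  rw [if_pos rfl, one_smul, add_sub_cancel]

theorem replace_vec_of_ne (e : TangentFrame U) (i : Fin e.n) (v : (tangent X).sec U) (u : X.O U)
    (hu : u * PMod.Hom.eval (e.form i) v = 1) {j : Fin e.n} (hij : i ≠ j) :
    (e.replace i v u hu).vec j = e.vec j := by
  change e.vec j + (if i = j then (1 : X.O U) else 0) • (v - e.vec j) = e.vec j
  rw [if_neg hij, zero_smul, add_zero]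

/-- A frame is adapted to `F` along `S` if the members of `S` are tangent to `F` and the remaining
coordinates vanish on `T_F`. -/
def IsAdapted (e : TangentFrame U) (F : Foliation X) (S : Finset (Fin e.n)) : Prop :=
  (∀ i ∈ S, e.vec i ∈ F.sub.carrier U) ∧
    ∀ i ∉ S, ∀ (V : X.Op) (h : V ≤ U) (v : F.T.sec V),
      PMod.Hom.eval ((Omega X).res h (e.form i)) v.1 = 0

/-- As the i-th coordinate of v is invertible, v can take the place of e_i without disturbing the
members of S. The count is stated as a difference because it is the measure of the induction below.
-/
theorem exists_insert (e : TangentFrame U) (F : Foliation X) (S : Finset (Fin e.n))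
    (hS : ∀ i ∈ S, e.vec i ∈ F.sub.carrier U) {i : Fin e.n} (hi : i ∉ S) (v : F.T.sec U)
    (hv : IsUnit (PMod.Hom.eval (e.form i) v.1 : X.O U)) :
    ∃ (e' : TangentFrame U) (S' : Finset (Fin e'.n)), e'.n - S'.card = e.n - (S.card + 1) ∧
      ∀ i ∈ S', e'.vec i ∈ F.sub.carrier U := by
  obtain ⟨u, hu⟩ := hv.exists_left_inv
  have hcard : (insert i S).card = S.card + 1 := Finset.card_insert_of_notMem hi
  refine ⟨e.replace i v.1 u hu, (insert i S : Finset (Fin e.n)), congrArg (e.n - ·) hcard,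
    fun (j : Fin e.n) hj => ?_⟩
  by_cases hij : i = j
  · subst hij
    rw [replace_vec_self]
    exact v.2
  · rw [replace_vec_of_ne _ _ _ _ _ hij]
    exact hS j ((Finset.mem_insert.1 hj).resolve_left (Ne.symm hij))

/-- Adapted frames exist generically. -/
theorem exists_isAdapted (hX : GenericallyInvertible X) (F : Foliation X) (m : ℕ) :
    ∀ (U : X.Op), (∃ x, x ∈ U) → ∀ (e : TangentFrame U) (S : Finset (Fin e.n)),
      (∀ i ∈ S, e.vec i ∈ F.sub.carrier U) → e.n - S.card ≤ m →
      ∃ (V : X.Op) (_ : V ≤ U) (_ : ∃ x, x ∈ V) (e' : TangentFrame V) (S' : Finset (Fin e'.n)),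
        e'.IsAdapted F S' := by
  induction m with
  | zero =>
    intro U hU e S hS hm
    -- The truncated difference is zero only if S is the whole index set, which leaves no i outside
    -- S.
    refine ⟨U, le_rfl, hU, e, S, hS, fun i hi => ?_⟩
    have h1 : S.card < Fintype.card (Fin e.n) :=
      Finset.card_lt_card (s := S) (t := Finset.univ)
        ⟨Finset.subset_univ _, fun h => hi (h (Finset.mem_univ i))⟩
    rw [Fintype.card_fin] at h1
    omega
  | succ m ih =>
    intro U hU e S hS hm
    by_cases had : e.IsAdapted F S
    · exact ⟨U, le_rfl, hU, e, S, had⟩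
    · have h1 : ∃ i ∉ S, ∃ (V : X.Op) (h : V ≤ U) (v : F.T.sec V),
          PMod.Hom.eval ((Omega X).res h (e.form i)) v.1 ≠ 0 := by
        by_contra hcon
        push Not at hcon
        exact had ⟨hS, hcon⟩
      obtain ⟨i, hi, V, hV, v, hv⟩ := h1
      -- A coordinate outside S that does not vanish on T_F becomes invertible on a smaller nonempty
      -- open set. There v can be exchanged into the frame, and the measure drops.
      obtain ⟨W, hW, hne, hunit⟩ := hX.exists_isUnit _ hv
      have h2 : X.resO hW (PMod.Hom.eval ((Omega X).res hV (e.form i)) v.1) =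
          PMod.Hom.eval ((e.restrict (hW.trans hV)).form i) (F.T.res hW v).1 :=
        PMod.Hom.res_eval (G := PMod.unit X) hW ((Omega X).res hV (e.form i)) v.1
      rw [h2] at hunit
      obtain ⟨e₁, S₁, hcard, hS₁⟩ := (e.restrict (hW.trans hV)).exists_insert F S
        (fun j hj => F.sub.res_mem _ (hS j hj)) hi (F.T.res hW v) hunit
      have hm₁ : e₁.n - S₁.card ≤ m := by
        rw [hcard]
        change e.n - (S.card + 1) ≤ m
        omega
      obtain ⟨W', hW', hne', e', S', had'⟩ := ih W hne e₁ S₁ hS₁ hm₁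
      exact ⟨W', hW'.trans (hW.trans hV), hne', e', S', had'⟩

/-- In codimension one, at most one member of an adapted frame is transverse. -/
theorem IsAdapted.eq_of_notMem {e : TangentFrame U} {F : Foliation X} {S : Finset (Fin e.n)}
    (he : e.IsAdapted F S) [Nontrivial (X.O U)] (η : F.conormalSub.toPMod.sec U)
    (hη : Submodule.span (X.O U) (Set.range fun _ : Fin 1 => η) = ⊤) {i j : Fin e.n} (hi : i ∉ S)
    (hj : j ∉ S) : i = j := by
  by_contra hij
  -- Coordinate forms outside S vanish on T_F, so they are conormal and multiples of the generator
  -- η.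
  have hmem : ∀ k ∉ S, ∃ a : X.O U, e.form k = a • η.1 := by
    intro k hk
    have h1 : (⟨e.form k, fun V h v => he.2 k hk V h v⟩ : F.conormalSub.toPMod.sec U) ∈
        Submodule.span (X.O U) (Set.range fun _ : Fin 1 => η) := hη ▸ Submodule.mem_top
    rw [Set.range_const, Submodule.mem_span_singleton] at h1
    obtain ⟨a, ha⟩ := h1
    exact ⟨a, (congrArg Subtype.val ha).symm⟩
  obtain ⟨a, ha⟩ := hmem i hi
  obtain ⟨b, hb⟩ := hmem j hj
  have h1 := e.pair i i
  have h2 := e.pair i j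
  have h3 := e.pair j j
  rw [ha, PMod.Hom.smul_eval, if_pos rfl] at h1
  rw [ha, PMod.Hom.smul_eval, if_neg hij] at h2
  rw [hb, PMod.Hom.smul_eval, if_pos rfl] at h3
  simp only [smul_eq_mul] at h1 h2 h3
  -- From a η(e_i) = 1 and a η(e_j) = 0 one gets η(e_j) = 0, against b η(e_j) = 1: two dual forms
  -- cannot be proportional to one.
  have h4 : PMod.Hom.eval η.1 (e.vec j) = 0 := by
    calc PMod.Hom.eval η.1 (e.vec j) =
          (a * PMod.Hom.eval η.1 (e.vec i)) * PMod.Hom.eval η.1 (e.vec j) := by rw [h1, one_mul]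
      _ = PMod.Hom.eval η.1 (e.vec i) * (a * PMod.Hom.eval η.1 (e.vec j)) := by ring
      _ = 0 := by rw [h2, mul_zero]
  rw [h4, mul_zero] at h3
  exact zero_ne_one h3

end TangentFrame

/-! ### Flatness for foliations of codimension one -/

section CodimOne

variable {F : Foliation X} {E : PMod X}

/-- A section of a reflexive sheaf that vanishes generically is zero. -/
theorem PMod.IsReflexive.eq_zero_of_generic (hE : E.IsReflexive) (hX : GenericallyInvertible X)
    {U : X.Op} {s : E.sec U}
    (h : ∀ (V : X.Op) (hV : V ≤ U), (∃ x, x ∈ V) →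
      ∃ (W : X.Op) (hW : W ≤ V), (∃ x, x ∈ W) ∧ E.res (hW.trans hV) s = 0) : s = 0 := by
  refine hE.ext fun V hV φ => ?_
  rw [map_zero, PMod.Hom.eval_zero]
  by_contra hne
  -- A nonzero value φ(s) would be a unit on a nonempty open set, and would still be one on a
  -- smaller nonempty set where s vanishes.
  obtain ⟨V', hV', hV'ne, hu⟩ := hX.exists_isUnit _ hne
  obtain ⟨W, hW, hWne, hs⟩ := h V' (hV'.trans hV) hV'ne
  have h1 := hu.map (X.resO hW)
  have h2 : X.resO (hW.trans hV') (PMod.Hom.eval φ (E.res hV s)) =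
      PMod.Hom.eval (E.dual.res (hW.trans hV') φ) (E.res (hW.trans hV') (E.res hV s)) :=
    PMod.Hom.res_eval (G := PMod.unit X) _ φ _
  rw [X.resO_comp, h2, PMod.res_comp, hs, PMod.Hom.eval_zero] at h1
  have := hX.nontrivial hWne
  exact not_isUnit_zero h1

/-- For a foliation of codimension one, a connection is flat if its curvature vanishes in the
directions of the foliation. -/
theorem MeromorphicConnection.isFlat_of_curvature (hE : E.IsReflexive) (hT : HasTangentFrames X)
    (hX : GenericallyInvertible X) (hF : F.HasCodim 1) {D : EffectiveDivisor X}
    (N : MeromorphicConnection D E)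
    (h : ∀ (U : X.Op) (v : F.T.sec U) (w : (tangent X).sec U) (s : E.sec U)
        (f g : D.ideal.toPMod.sec U), N.curvature v.1 w s f g = 0) : N.IsFlat := by
  rw [N.isFlat_iff]
  intro U v w s f g
  refine hE.eq_zero_of_generic hX fun V hV hne => ?_
  obtain ⟨U₀, hdense, hU₀⟩ := hF
  obtain ⟨x, hxV, hx₀⟩ := hdense.inter_open_nonempty (V : Set X.toRingedSpace) V.2 hne
  obtain ⟨U₁, η, hx₁, hη⟩ := hU₀ x hx₀
  obtain ⟨U₂, hx₂, ⟨e₀⟩⟩ := hT x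
  -- Near a point of V where the conormal sheaf is free of rank one, the exchange process starts
  -- from an arbitrary frame with no member required to be tangent.
  obtain ⟨W, hW, hWne, e, S, he⟩ := TangentFrame.exists_isAdapted hX F e₀.n (V ⊓ U₁ ⊓ U₂)
    ⟨x, ⟨hxV, hx₁⟩, hx₂⟩ (e₀.restrict inf_le_right) ∅ (by simp) (Nat.sub_le _ _)
  have hWV : W ≤ V := hW.trans (inf_le_left.trans inf_le_left)
  have hW₁ : W ≤ U₁ := hW.trans (inf_le_left.trans inf_le_right)
  refine ⟨W, hWV, hWne, ?_⟩
  have := hX.nontrivial hWne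
  rw [N.curvature_res]
  refine N.curvature_eq_zero_of_frame e _ _ _ (fun i j => ?_) _ _
  -- Either one of the two members is tangent to F, or both are the only transverse member and the
  -- curvature vanishes because it is alternating.
  by_cases hi : i ∈ S
  · exact h W ⟨e.vec i, he.1 i hi⟩ _ _ _ _
  · by_cases hj : j ∈ S
    · rw [N.curvature_swap, h W ⟨e.vec j, he.1 j hj⟩, neg_zero]
    · have hspan := (hη W hW₁).2
      have heq : (fun i : Fin 1 => F.conormalSub.toPMod.res hW₁ (η i)) =
          fun _ : Fin 1 => F.conormalSub.toPMod.res hW₁ (η 0) :=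
        funext fun i => by rw [Subsingleton.elim i 0]
      have hij : i = j := he.eq_of_notMem (F.conormalSub.toPMod.res hW₁ (η 0))
        (by rw [← heq]; exact hspan) hi hj
      rw [hij, N.curvature_self]

variable {C : PartialConnection F E} {hE : E.IsReflexive}

/-- Flat implies horizontal by specializing one vector field to T_F; codimension one enters only in
the converse. -/
theorem isFlat_iff_isHorizontal (hG : E.Glues) (hT : HasTangentFrames X)
    (hX : GenericallyInvertible X) (hF : F.HasCodim 1) {D : EffectiveDivisor X} (hC : C.IsFlat)
    (hD : D.IsInvariant F) (N : MeromorphicExtension C D) :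
    N.conn.IsFlat ↔ (extensionEquivSplitting C hE hG hT D N).IsHorizontal hC hD := by
  rw [extensionEquivSplitting_apply, isHorizontal_iff_curvature]
  exact ⟨fun h U v w s f g => (N.conn.isFlat_iff.1 h) U v.1 w s f g,
    N.conn.isFlat_of_curvature hE hT hX hF⟩

end CodimOne

/-! ## A holomorphic Hadamard lemma -/

section Hadamard

open scoped ContDiff Topology
open MeasureTheory

variable {V F : Type} [NormedAddCommGroup V] [NormedSpace ℂ V]
  [NormedAddCommGroup F] [NormedSpace ℂ F]

/-- The weighted average of `H` along the segments issuing from `p`. -/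
noncomputable def segmentAverage (p : V) (k : ℕ) (H : V → F) (y : V) : F :=
  ∫ t in (0 : ℝ)..1, (t : ℂ) ^ k • H (p + (t : ℂ) • (y - p))

theorem segment_mem_ball {p y : V} {r : ℝ} (hy : y ∈ Metric.ball p r) {t : ℝ}
    (ht : t ∈ Set.Icc (0 : ℝ) 1) : p + (t : ℂ) • (y - p) ∈ Metric.ball p r := by
  rw [Metric.mem_ball, dist_eq_norm] at hy ⊢
  rw [add_sub_cancel_left, norm_smul, Complex.norm_real, Real.norm_of_nonneg ht.1]
  exact (mul_le_of_le_one_left (norm_nonneg _) ht.2).trans_lt hy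

theorem continuousOn_segment {p : V} {r : ℝ} {H : V → F} (hH : ContinuousOn H (Metric.ball p r))
    (k : ℕ) {y : V} (hy : y ∈ Metric.ball p r) :
    ContinuousOn (fun t : ℝ => (t : ℂ) ^ k • H (p + (t : ℂ) • (y - p))) (Set.Icc (0 : ℝ) 1) := by
  refine ContinuousOn.smul (by fun_prop) (hH.comp (by fun_prop) fun t ht => segment_mem_ball hy ht)

variable [FiniteDimensional ℂ V]

/-- Differentiation under the integral: the chain rule along p + t (y - p) produces a factor t, so
the weight rises from k to k + 1 and the derivative is again a segment average. -/
theorem hasFDerivAt_segmentAverage {p : V} {r : ℝ} {H : V → F}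
    (hH : ContDiffOn ℂ ∞ H (Metric.ball p r)) (k : ℕ) {y : V} (hy : y ∈ Metric.ball p r) :
    HasFDerivAt (segmentAverage p k H) (segmentAverage p (k + 1) (fderiv ℂ H) y) y := by
  have : ProperSpace V := FiniteDimensional.proper ℂ V
  have hH' : ContinuousOn (fderiv ℂ H) (Metric.ball p r) :=
    hH.continuousOn_fderiv_of_isOpen Metric.isOpen_ball (by simp)
  -- On a slightly smaller closed ball, compact in finite dimension, the derivative of H is bounded,
  -- which provides the dominating constant.
  obtain ⟨r', hyr', hr'⟩ := exists_between (Metric.mem_ball.1 hy)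
  have hsub : Metric.closedBall p r' ⊆ Metric.ball p r := Metric.closedBall_subset_ball hr'
  obtain ⟨B, hB⟩ := (isCompact_closedBall p r').exists_bound_of_continuousOn (hH'.mono hsub)
  have hIcc : ∀ t : ℝ, t ∈ Set.uIoc (0 : ℝ) 1 → t ∈ Set.Icc (0 : ℝ) 1 := fun t ht => by
    rw [Set.uIoc_of_le zero_le_one] at ht
    exact ⟨ht.1.le, ht.2⟩
  have hmeas : ∀ {G : Type} [NormedAddCommGroup G] {φ : ℝ → G},
      ContinuousOn φ (Set.Icc (0 : ℝ) 1) →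
      AEStronglyMeasurable φ (volume.restrict (Set.uIoc (0 : ℝ) 1)) := by
    intro G _ φ hφ
    rw [Set.uIoc_of_le zero_le_one]
    exact (hφ.mono Set.Ioc_subset_Icc_self).aestronglyMeasurable measurableSet_Ioc
  refine intervalIntegral.hasFDerivAt_integral_of_dominated_of_fderiv_le (𝕜 := ℂ)
    (F := fun y t => (t : ℂ) ^ k • H (p + (t : ℂ) • (y - p)))
    (F' := fun y t => (t : ℂ) ^ (k + 1) • fderiv ℂ H (p + (t : ℂ) • (y - p)))
    (s := Metric.ball p r') (bound := fun _ => B)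
    (Metric.isOpen_ball.mem_nhds (Metric.mem_ball.2 hyr')) ?_ ?_ ?_ ?_ ?_ ?_
  · filter_upwards [Metric.isOpen_ball.mem_nhds hy] with z hz
    exact hmeas (continuousOn_segment hH.continuousOn k hz)
  · refine ContinuousOn.intervalIntegrable ?_
    rw [Set.uIcc_of_le zero_le_one]
    exact continuousOn_segment hH.continuousOn k hy
  · exact hmeas (continuousOn_segment hH' (k + 1) hy)
  · refine Filter.Eventually.of_forall fun t ht z hz => ?_
    have ht' := hIcc t ht
    rw [norm_smul, norm_pow, Complex.norm_real, Real.norm_of_nonneg ht'.1]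
    refine (mul_le_of_le_one_left (norm_nonneg _) (pow_le_one₀ ht'.1 ht'.2)).trans ?_
    exact hB _ (Metric.ball_subset_closedBall (segment_mem_ball hz ht'))
  · exact intervalIntegrable_const
  · refine Filter.Eventually.of_forall fun t ht z hz => ?_
    have hmem := segment_mem_ball (Metric.ball_subset_ball hr'.le hz) (hIcc t ht)
    have h1 : HasFDerivAt H (fderiv ℂ H (p + (t : ℂ) • (z - p))) (p + (t : ℂ) • (z - p)) :=
      ((hH.contDiffAt (Metric.isOpen_ball.mem_nhds hmem)).differentiableAt
        (by simp)).hasFDerivAt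
    have h2 : HasFDerivAt (fun z : V => p + (t : ℂ) • (z - p))
        ((t : ℂ) • ContinuousLinearMap.id ℂ V) z :=
      (((hasFDerivAt_id z).sub_const p).const_smul (t : ℂ)).const_add p
    have h3 := (h1.comp z h2).const_smul ((t : ℂ) ^ k)
    convert! h3 using 1
    ext w
    simp [pow_succ, mul_smul]

/-- Induction on the order of differentiability. Target space, function and weight stay general
because passing to the derivative changes all three. -/
theorem contDiffOn_segmentAverage (m : ℕ) : ∀ {F : Type} [NormedAddCommGroup F] [NormedSpace ℂ F]
    {p : V} {r : ℝ} {H : V → F}, ContDiffOn ℂ ∞ H (Metric.ball p r) → ∀ k : ℕ,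
    ContDiffOn ℂ m (segmentAverage p k H) (Metric.ball p r) := by
  induction m with
  | zero =>
    intro F _ _ p r H hH k
    exact contDiffOn_zero.2 fun y hy =>
      (hasFDerivAt_segmentAverage hH k hy).continuousAt.continuousWithinAt
  | succ m ih =>
    intro F _ _ p r H hH k
    have hH' : ContDiffOn ℂ ∞ (fderiv ℂ H) (Metric.ball p r) :=
      hH.fderiv_of_isOpen Metric.isOpen_ball (by simp)
    have := (contDiffOn_succ_iff_hasFDerivWithinAt_of_uniqueDiffOn (𝕜 := ℂ) (n := m)
      (f := segmentAverage p k H) (Metric.isOpen_ball (x := p) (ε := r)).uniqueDiffOn).2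
      ⟨by simp, segmentAverage p (k + 1) (fderiv ℂ H), ih hH' (k + 1),
        fun y hy => (hasFDerivAt_segmentAverage hH k hy).hasFDerivWithinAt⟩
    exact_mod_cast this

/-- The fundamental theorem of calculus on the segment from p to y, with G the average of the
derivative of f. -/
theorem hadamard [CompleteSpace F] {p : V} {r : ℝ} {f : V → F}
    (hf : ContDiffOn ℂ ∞ f (Metric.ball p r)) :
    ∃ G : V → V →L[ℂ] F, ContDiffOn ℂ ∞ G (Metric.ball p r) ∧
      ∀ y ∈ Metric.ball p r, f y = f p + G y (y - p) := by
  have hf' : ContDiffOn ℂ ∞ (fderiv ℂ f) (Metric.ball p r) :=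
    hf.fderiv_of_isOpen Metric.isOpen_ball (by simp)
  refine ⟨segmentAverage p 0 (fderiv ℂ f),
    contDiffOn_infty.2 fun m => contDiffOn_segmentAverage m hf' 0, fun y hy => ?_⟩
  have hint : IntervalIntegrable
      (fun t : ℝ => (t : ℂ) ^ 0 • fderiv ℂ f (p + (t : ℂ) • (y - p))) volume 0 1 := by
    refine ContinuousOn.intervalIntegrable ?_
    rw [Set.uIcc_of_le zero_le_one]
    exact continuousOn_segment hf'.continuousOn 0 hy
  have h1 : ∫ t in (0 : ℝ)..1, ((t : ℂ) ^ 0 • fderiv ℂ f (p + (t : ℂ) • (y - p))) (y - p) =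
      f (p + ((1 : ℝ) : ℂ) • (y - p)) - f (p + ((0 : ℝ) : ℂ) • (y - p)) := by
    refine intervalIntegral.integral_eq_sub_of_hasDerivAt (f := fun t : ℝ => f (p + (t : ℂ) • (y - p)))
      (fun t ht => ?_) ?_
    · rw [Set.uIcc_of_le zero_le_one] at ht
      have h1 : HasFDerivAt f (fderiv ℂ f (p + (t : ℂ) • (y - p))) (p + (t : ℂ) • (y - p)) :=
        ((hf.contDiffAt (Metric.isOpen_ball.mem_nhds (segment_mem_ball hy ht))).differentiableAt
          (by simp)).hasFDerivAt
      have h2 : HasDerivAt (fun t : ℝ => p + (t : ℂ) • (y - p)) (y - p) t := by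
        simpa using ((Complex.ofRealCLM.hasDerivAt (x := t)).smul_const (y - p)).const_add p
      rw [pow_zero, one_smul]
      exact HasFDerivAt.comp_hasDerivAt (f := fun t : ℝ => p + (t : ℂ) • (y - p)) t
        (h1.restrictScalars ℝ) h2
    · refine ContinuousOn.intervalIntegrable ?_
      rw [Set.uIcc_of_le zero_le_one]
      exact (continuousOn_segment hf'.continuousOn 0 hy).clm_apply continuousOn_const
  have h2 := (ContinuousLinearMap.intervalIntegral_comp_comm
    (ContinuousLinearMap.apply ℂ F (y - p)) hint)
  have h3 : segmentAverage p 0 (fderiv ℂ f) y (y - p) = f y - f p := by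
    refine (Eq.trans ?_ h1).trans (by simp)
    exact h2.symm
  rw [h3]
  abel

end Hadamard

/-! ## Differentials of functions -/

section Differential

variable {U V W : X.Op}

/-- The differential of a function. -/
noncomputable def differential (f : X.O U) : (Omega X).sec U :=
  PMod.Hom.mk (E := tangent X) (G := PMod.unit X) (fun _ h v => vderiv v (X.resO h f))
    (fun _ _ v w => vderiv_add v w _) (fun _ _ c v => vderiv_smul c v _)
    (fun V W hV hW v => by
      rw [← X.resO_comp hV hW, vderiv_res]
      rfl)

theorem eval_res_differential (h : V ≤ U) (f : X.O U) (v : (tangent X).sec V) :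
    PMod.Hom.eval ((Omega X).res h (differential f)) v = vderiv v (X.resO h f) := rfl

theorem eval_differential (f : X.O U) (v : (tangent X).sec U) :
    PMod.Hom.eval (differential f) v = vderiv v f :=
  (eval_res_differential le_rfl f v).trans (by rw [X.resO_id])

theorem vderiv_sum {ι : Type*} (a : Finset ι) (v : ι → (tangent X).sec U) (f : X.O U) :
    vderiv (∑ i ∈ a, v i) f = ∑ i ∈ a, vderiv (v i) f :=
  map_sum (AddMonoidHom.mk' (fun u : (tangent X).sec U => vderiv u f)
    (fun u w => vderiv_add u w f)) v a

theorem vderiv_map_sum {ι : Type*} (a : Finset ι) (v : (tangent X).sec U) (f : ι → X.O U) :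
    vderiv v (∑ i ∈ a, f i) = ∑ i ∈ a, vderiv v (f i) :=
  map_sum (v.1.app U le_rfl) f a

theorem vderiv_expansion {ι : Type*} [Fintype ι] (v : (tangent X).sec U) (c : ℂ)
    (f g : ι → X.O U) (b : ι → ℂ) :
    vderiv v (X.const U c + ∑ i, (f i - X.const U (b i)) * g i) =
      ∑ i, ((f i - X.const U (b i)) * vderiv v (g i) + g i * vderiv v (f i)) := by
  rw [vderiv_map_add, vderiv_const, zero_add, vderiv_map_sum]
  refine Finset.sum_congr rfl fun i _ => ?_
  rw [vderiv_mul, vderiv_map_sub, vderiv_const, sub_zero]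

theorem vderiv_res_frame_sum {ι : Type*} [Fintype ι] (h : V ≤ U) (hW : W ≤ V)
    (f : ι → X.O U) (e : ι → (tangent X).sec U) (v : (tangent X).sec V) (g : X.O W) :
    vderiv ((tangent X).res hW
      (∑ i, PMod.Hom.eval ((Omega X).res h (differential (f i))) v • (tangent X).res h (e i))) g =
      ∑ i, vderiv ((tangent X).res hW v) (X.resO (hW.trans h) (f i)) *
        vderiv ((tangent X).res (hW.trans h) (e i)) g := by
  rw [map_sum, vderiv_sum]
  refine Finset.sum_congr rfl fun i _ => ?_
  rw [PMod.res_smul, vderiv_smul, (tangent X).res_comp h hW, eval_res_differential,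
    ← X.resO_comp h hW, vderiv_res]

end Differential

/-! ## Complex manifolds -/

namespace ComplexManifold

open scoped Manifold ContDiff Topology

variable {n : ℕ} {M : Type} [TopologicalSpace M] [ChartedSpace (EuclideanSpace ℂ (Fin n)) M]
  {U V : Opens M}

/-- A holomorphic function on `U` as a function on `M`, extended by zero. -/
noncomputable def extend (f : (ComplexRingedSpace.ofManifold n M).O U) (m : M) : ℂ :=
  open Classical in
  if h : m ∈ U then
    (show C^∞⟮𝓘(ℂ, EuclideanSpace ℂ (Fin n)), U; 𝓘(ℂ, ℂ), ℂ⟯ from f) ⟨m, h⟩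
  else 0

theorem extend_of_mem (f : (ComplexRingedSpace.ofManifold n M).O U) {m : M} (h : m ∈ U) :
    extend f m =
      (show C^∞⟮𝓘(ℂ, EuclideanSpace ℂ (Fin n)), U; 𝓘(ℂ, ℂ), ℂ⟯ from f) ⟨m, h⟩ :=
  dif_pos h

theorem extend_add (f g : (ComplexRingedSpace.ofManifold n M).O U) (m : M) :
    extend (f + g) m = extend f m + extend g m := by
  by_cases h : m ∈ U
  · rw [extend_of_mem _ h, extend_of_mem _ h, extend_of_mem _ h]; rfl
  · simp [extend, h]

theorem extend_mul (f g : (ComplexRingedSpace.ofManifold n M).O U) (m : M) :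
    extend (f * g) m = extend f m * extend g m := by
  by_cases h : m ∈ U
  · rw [extend_of_mem _ h, extend_of_mem _ h, extend_of_mem _ h]; rfl
  · simp [extend, h]

theorem extend_const (c : ℂ) {m : M} (h : m ∈ U) :
    extend ((ComplexRingedSpace.ofManifold n M).const U c) m = c := by
  rw [extend_of_mem _ h]; rfl

theorem extend_zero (m : M) : extend (0 : (ComplexRingedSpace.ofManifold n M).O U) m = 0 := by
  by_cases h : m ∈ U
  · rw [extend_of_mem _ h]; rfl
  · simp [extend, h]

theorem extend_one {m : M} (h : m ∈ U) :
    extend (1 : (ComplexRingedSpace.ofManifold n M).O U) m = 1 := by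
  rw [extend_of_mem _ h]; rfl

theorem extend_sum {ι : Type*} (a : Finset ι) (f : ι → (ComplexRingedSpace.ofManifold n M).O U)
    (m : M) : extend (∑ i ∈ a, f i) m = ∑ i ∈ a, extend (f i) m := by
  classical
  induction a using Finset.induction_on with
  | empty => exact extend_zero m
  | insert i a hi ih => rw [Finset.sum_insert hi, Finset.sum_insert hi, extend_add, ih]

theorem extend_resO (h : V ≤ U) (f : (ComplexRingedSpace.ofManifold n M).O U) {m : M}
    (hm : m ∈ V) : extend ((ComplexRingedSpace.ofManifold n M).resO h f) m = extend f m := by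
  rw [extend_of_mem _ hm, extend_of_mem _ (h hm)]; rfl

theorem extend_sub (a b : (ComplexRingedSpace.ofManifold n M).O V) (q : M) :
    extend (a - b) q = extend a q - extend b q := by
  have := extend_add (a - b) b q
  rw [sub_add_cancel] at this
  rw [this, add_sub_cancel_right]

theorem ext_of_extend {f g : (ComplexRingedSpace.ofManifold n M).O U}
    (h : ∀ m : M, m ∈ U → extend f m = extend g m) : f = g := by
  refine ContMDiffMap.ext (f := (show C^∞⟮𝓘(ℂ, EuclideanSpace ℂ (Fin n)), U;
    𝓘(ℂ, ℂ), ℂ⟯ from f)) (g := g) fun m => ?_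
  have := h m.1 m.2
  rwa [extend_of_mem _ m.2, extend_of_mem _ m.2] at this

theorem contMDiffAt_extend (f : (ComplexRingedSpace.ofManifold n M).O U) {m : M} (h : m ∈ U) :
    ContMDiffAt 𝓘(ℂ, EuclideanSpace ℂ (Fin n)) 𝓘(ℂ, ℂ) ∞ (extend f) m := by
  refine (contMDiffAt_subtype_iff (U := U) (x := ⟨m, h⟩)).1 ?_
  have h1 : (fun x : U => extend f x) =
      (show C^∞⟮𝓘(ℂ, EuclideanSpace ℂ (Fin n)), U; 𝓘(ℂ, ℂ), ℂ⟯ from f) :=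
    funext fun x => extend_of_mem f x.2
  rw [h1]
  exact (ContMDiffMap.contMDiff _).contMDiffAt

/-- A function that is holomorphic at the points of `U`, as a section of the structure sheaf. -/
def section_ (U : Opens M) (g : M → ℂ)
    (hg : ∀ m ∈ U, ContMDiffAt 𝓘(ℂ, EuclideanSpace ℂ (Fin n)) 𝓘(ℂ, ℂ) ∞ g m) :
    (ComplexRingedSpace.ofManifold n M).O U :=
  show C^∞⟮𝓘(ℂ, EuclideanSpace ℂ (Fin n)), U; 𝓘(ℂ, ℂ), ℂ⟯ from
    ⟨fun x => g x, fun x => contMDiffAt_subtype_iff.2 (hg x.1 x.2)⟩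

theorem extend_section (g : M → ℂ)
    (hg : ∀ m ∈ U, ContMDiffAt 𝓘(ℂ, EuclideanSpace ℂ (Fin n)) 𝓘(ℂ, ℂ) ∞ g m) {m : M} (h : m ∈ U) :
    extend (section_ U g hg) m = g m := by
  rw [extend_of_mem _ h]; rfl

theorem extend_vderiv_res (h : V ≤ U) (u : (tangent (ComplexRingedSpace.ofManifold n M)).sec U)
    (f : (ComplexRingedSpace.ofManifold n M).O U) {m : M} (hm : m ∈ V) :
    extend (vderiv ((tangent (ComplexRingedSpace.ofManifold n M)).res h u)
      ((ComplexRingedSpace.ofManifold n M).resO h f)) m = extend (vderiv u f) m := by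
  have h1 := extend_resO h (vderiv u f) hm
  have h2 := vderiv_res (X := ComplexRingedSpace.ofManifold n M) h u f
  exact (congrArg (fun g => extend (U := V) g m) h2).trans h1

/-- A function that is not zero has a nonzero value somewhere, hence by continuity on a
neighbourhood, where its inverse is holomorphic. Connectedness plays no role. -/
theorem exists_isUnit_resO (f : (ComplexRingedSpace.ofManifold n M).O U) (hf : f ≠ 0) :
    ∃ (V : Opens M) (h : V ≤ U), (∃ m : M, m ∈ V) ∧
      IsUnit ((ComplexRingedSpace.ofManifold n M).resO h f) := by
  have h1 : ∃ m ∈ U, extend f m ≠ 0 := by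
    by_contra hcon
    push Not at hcon
    exact hf (ext_of_extend fun m hm => (hcon m hm).trans (extend_zero m).symm)
  obtain ⟨m, hm, hne⟩ := h1
  have hev : ∀ᶠ q in 𝓝 m, extend f q ≠ 0 :=
    (contMDiffAt_extend f hm).continuousAt.eventually_ne hne
  obtain ⟨W, hW, hWo, hmW⟩ := eventually_nhds_iff.1 hev
  obtain ⟨V, hVU, hmV, hV⟩ : ∃ V : Opens M, V ≤ U ∧ m ∈ V ∧ ∀ q ∈ V, extend f q ≠ 0 :=
    ⟨U ⊓ ⟨W, hWo⟩, inf_le_left, ⟨hm, hmW⟩, fun q hq => hW q hq.2⟩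
  have hinv : ∀ q ∈ V, ContMDiffAt 𝓘(ℂ, EuclideanSpace ℂ (Fin n)) 𝓘(ℂ, ℂ) ∞
      (fun q => (extend f q)⁻¹) q := fun q hq => by
    have h1 : ContMDiffAt 𝓘(ℂ, ℂ) 𝓘(ℂ, ℂ) ∞ (fun z : ℂ => z⁻¹) (extend f q) :=
      (contDiffAt_inv ℂ (hV q hq)).contMDiffAt
    exact ContMDiffAt.comp q h1 (contMDiffAt_extend f (hVU hq))
  refine ⟨V, hVU, ⟨m, hmV⟩, isUnit_iff_exists_inv.2 ⟨section_ V _ hinv, ?_⟩⟩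
  refine ext_of_extend fun q hq => ?_
  rw [extend_mul, extend_resO _ _ hq, extend_section _ _ hq, extend_one hq]
  exact mul_inv_cancel₀ (hV q hq)

theorem nontrivial_of_mem {m : M} (hm : m ∈ U) :
    Nontrivial ((ComplexRingedSpace.ofManifold n M).O U) := by
  refine ⟨⟨0, 1, fun h => ?_⟩⟩
  have := congrArg (fun f => extend f m) h
  beta_reduce at this
  rw [extend_zero, extend_one hm] at this
  exact zero_ne_one this

theorem genericallyInvertible : GenericallyInvertible (ComplexRingedSpace.ofManifold n M) where
  exists_isUnit f hf := exists_isUnit_resO f hf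
  nontrivial := fun ⟨_, hm⟩ => nontrivial_of_mem (n := n) (M := M) hm

section Charts

variable (x : M)

/-- A function in the coordinates of the chart at `x`. -/
noncomputable def inChart (f : (ComplexRingedSpace.ofManifold n M).O U) :
    EuclideanSpace ℂ (Fin n) → ℂ :=
  fun y => extend f ((chartAt (EuclideanSpace ℂ (Fin n)) x).symm y)

/-- The domain of the chart at `x`. -/
def chartDomain : Opens M :=
  (⟨(chartAt (EuclideanSpace ℂ (Fin n)) x).source,
    (chartAt (EuclideanSpace ℂ (Fin n)) x).open_source⟩ : Opens M)

/-- The value at `m` of the derivative of `f` in the `i`-th coordinate direction. -/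
noncomputable def coordDeriv (i : Fin n) (f : (ComplexRingedSpace.ofManifold n M).O U) (m : M) :
    ℂ :=
  fderiv ℂ (inChart x f) (chartAt (EuclideanSpace ℂ (Fin n)) x m) (EuclideanSpace.single i 1)

variable {x}

/-- The derivative depends only on the germ at m. Restrictions, constants and coordinate functions
are all treated through this. -/
theorem coordDeriv_eq_of_eqOn (i : Fin n) (f : (ComplexRingedSpace.ofManifold n M).O U)
    {g : EuclideanSpace ℂ (Fin n) → ℂ} {m : M} (hx : m ∈ chartDomain (n := n) (M := M) x)
    (W : Opens M) (hm : m ∈ W)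
    (hfg : ∀ q ∈ W, q ∈ chartDomain (n := n) (M := M) x →
      extend f q = g (chartAt (EuclideanSpace ℂ (Fin n)) x q)) :
    coordDeriv x i f m = fderiv ℂ g (chartAt (EuclideanSpace ℂ (Fin n)) x m)
      (EuclideanSpace.single i 1) := by
  unfold coordDeriv
  congr 1
  refine Filter.EventuallyEq.fderiv_eq ?_
  set φ := chartAt (EuclideanSpace ℂ (Fin n)) x
  have hx' : m ∈ φ.source := hx
  have h1 : φ.symm ⁻¹' W ∈ 𝓝 (φ m) :=
    (φ.continuousAt_symm (φ.map_source hx')).preimage_mem_nhds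
      (by rw [φ.left_inv hx']; exact W.2.mem_nhds hm)
  filter_upwards [h1, φ.open_target.mem_nhds (φ.map_source hx')] with y hy hyt
  have h2 := hfg (φ.symm y) hy (φ.map_target hyt)
  rw [φ.right_inv hyt] at h2
  exact h2

theorem coordDeriv_resO (i : Fin n) (h : V ≤ U) (f : (ComplexRingedSpace.ofManifold n M).O U)
    {m : M} (hm : m ∈ V) (hx : m ∈ chartDomain (n := n) (M := M) x) :
    coordDeriv x i ((ComplexRingedSpace.ofManifold n M).resO h f) m = coordDeriv x i f m := by
  refine coordDeriv_eq_of_eqOn i _ (g := inChart x f) hx V hm fun q hq hqx => ?_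
  rw [extend_resO h f hq]
  exact congrArg (extend f) ((chartAt (EuclideanSpace ℂ (Fin n)) x).left_inv hqx).symm

theorem coordDeriv_const (i : Fin n) (c : ℂ) {m : M} (hm : m ∈ U)
    (hx : m ∈ chartDomain (n := n) (M := M) x) :
    coordDeriv x i ((ComplexRingedSpace.ofManifold n M).const U c) m = 0 := by
  rw [coordDeriv_eq_of_eqOn i _ (g := fun _ => c) hx U hm fun q hq _ => extend_const c hq]
  simp

variable [IsManifold 𝓘(ℂ, EuclideanSpace ℂ (Fin n)) ω M] (x)

theorem contDiffAt_inChart (f : (ComplexRingedSpace.ofManifold n M).O U) {m : M} (hm : m ∈ U)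
    (hx : m ∈ chartDomain (n := n) (M := M) x) :
    ContDiffAt ℂ ∞ (inChart x f) (chartAt (EuclideanSpace ℂ (Fin n)) x m) := by
  have hx' : m ∈ (chartAt (EuclideanSpace ℂ (Fin n)) x).source := hx
  have h1 := contMDiffOn_chart_symm (I := 𝓘(ℂ, EuclideanSpace ℂ (Fin n))) (n := ∞) (x := x)
  have h2 := h1.contMDiffAt ((chartAt (EuclideanSpace ℂ (Fin n)) x).open_target.mem_nhds
    ((chartAt (EuclideanSpace ℂ (Fin n)) x).map_source hx'))
  have h3 := contMDiffAt_extend f hm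
  rw [← (chartAt (EuclideanSpace ℂ (Fin n)) x).left_inv hx'] at h3
  exact (ContMDiffAt.comp _ h3 h2).contDiffAt

theorem contMDiffAt_comp_chart {g : EuclideanSpace ℂ (Fin n) → ℂ} {m : M}
    (hx : m ∈ chartDomain (n := n) (M := M) x)
    (hg : ContDiffAt ℂ ∞ g (chartAt (EuclideanSpace ℂ (Fin n)) x m)) :
    ContMDiffAt 𝓘(ℂ, EuclideanSpace ℂ (Fin n)) 𝓘(ℂ, ℂ) ∞
      (fun q => g (chartAt (EuclideanSpace ℂ (Fin n)) x q)) m := by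
  have h1 := contMDiffOn_chart (I := 𝓘(ℂ, EuclideanSpace ℂ (Fin n))) (n := ∞) (x := x)
  have h2 := h1.contMDiffAt ((chartAt (EuclideanSpace ℂ (Fin n)) x).open_source.mem_nhds hx)
  exact ContMDiffAt.comp m hg.contMDiffAt h2

variable {x}

theorem differentiableAt_inChart (f : (ComplexRingedSpace.ofManifold n M).O U) {m : M}
    (hm : m ∈ U) (hx : m ∈ chartDomain (n := n) (M := M) x) :
    DifferentiableAt ℂ (inChart x f) (chartAt (EuclideanSpace ℂ (Fin n)) x m) :=
  (contDiffAt_inChart x f hm hx).differentiableAt (by simp)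

theorem contMDiffAt_coordDeriv (i : Fin n) (f : (ComplexRingedSpace.ofManifold n M).O U) {m : M}
    (hm : m ∈ U) (hx : m ∈ chartDomain (n := n) (M := M) x) :
    ContMDiffAt 𝓘(ℂ, EuclideanSpace ℂ (Fin n)) 𝓘(ℂ, ℂ) ∞ (coordDeriv x i f) m := by
  have h1 : ContDiffAt ℂ ∞ (fun y => fderiv ℂ (inChart x f) y (EuclideanSpace.single i 1))
      (chartAt (EuclideanSpace ℂ (Fin n)) x m) :=
    ((contDiffAt_inChart x f hm hx).fderiv_right (by simp)).clm_apply contDiffAt_const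
  exact contMDiffAt_comp_chart x hx h1

theorem coordDeriv_add (i : Fin n) (f g : (ComplexRingedSpace.ofManifold n M).O U) {m : M}
    (hm : m ∈ U) (hx : m ∈ chartDomain (n := n) (M := M) x) :
    coordDeriv x i (f + g) m = coordDeriv x i f m + coordDeriv x i g m := by
  have h1 : inChart x (f + g) = inChart x f + inChart x g := funext fun y => extend_add f g _
  unfold coordDeriv
  rw [h1, fderiv_add (differentiableAt_inChart f hm hx) (differentiableAt_inChart g hm hx)]
  rfl

theorem coordDeriv_mul (i : Fin n) (f g : (ComplexRingedSpace.ofManifold n M).O U) {m : M}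
    (hm : m ∈ U) (hx : m ∈ chartDomain (n := n) (M := M) x) :
    coordDeriv x i (f * g) m =
      extend f m * coordDeriv x i g m + extend g m * coordDeriv x i f m := by
  have h1 : inChart x (f * g) = inChart x f * inChart x g := funext fun y => extend_mul f g _
  have h2 : ∀ k : (ComplexRingedSpace.ofManifold n M).O U,
      inChart x k (chartAt (EuclideanSpace ℂ (Fin n)) x m) = extend k m := fun k =>
    congrArg (extend k) ((chartAt (EuclideanSpace ℂ (Fin n)) x).left_inv hx)
  unfold coordDeriv
  rw [h1, fderiv_mul (differentiableAt_inChart f hm hx) (differentiableAt_inChart g hm hx), h2, h2]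
  rfl

/-- The coordinate functions. -/
noncomputable def coord (x : M) (i : Fin n) :
    (ComplexRingedSpace.ofManifold n M).O (chartDomain (n := n) (M := M) x) :=
  section_ (n := n) (M := M) (chartDomain (n := n) (M := M) x) (fun q => chartAt (EuclideanSpace ℂ (Fin n)) x q i)
    fun m hm => contMDiffAt_comp_chart (g := fun y => y i) x hm (by fun_prop)

theorem extend_coord (i : Fin n) {m : M} (hx : m ∈ chartDomain (n := n) (M := M) x) :
    extend (coord x i) m = chartAt (EuclideanSpace ℂ (Fin n)) x m i :=
  extend_section (n := n) (M := M) _ _ hx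

theorem coordDeriv_coord (i j : Fin n) {m : M} (hx : m ∈ chartDomain (n := n) (M := M) x) :
    coordDeriv x j (coord x i) m = if i = j then 1 else 0 := by
  rw [coordDeriv_eq_of_eqOn j _ (g := fun y => y i) hx (chartDomain (n := n) (M := M) x) hx
    fun q hq _ => extend_coord i hq]
  have h1 : HasFDerivAt (fun y : EuclideanSpace ℂ (Fin n) => y i)
      (EuclideanSpace.proj i : EuclideanSpace ℂ (Fin n) →L[ℂ] ℂ)
      (chartAt (EuclideanSpace ℂ (Fin n)) x m) :=
    (EuclideanSpace.proj i : EuclideanSpace ℂ (Fin n) →L[ℂ] ℂ).hasFDerivAt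
  rw [h1.fderiv]
  simp

/-- The partial derivative as a section of the structure sheaf. -/
noncomputable def partialDeriv (i : Fin n) (h : U ≤ chartDomain (n := n) (M := M) x)
    (f : (ComplexRingedSpace.ofManifold n M).O U) : (ComplexRingedSpace.ofManifold n M).O U :=
  section_ U (coordDeriv x i f) fun _ hm => contMDiffAt_coordDeriv i f hm (h hm)

theorem extend_partialDeriv (i : Fin n) (h : U ≤ chartDomain (n := n) (M := M) x)
    (f : (ComplexRingedSpace.ofManifold n M).O U) {m : M} (hm : m ∈ U) :
    extend (partialDeriv i h f) m = coordDeriv x i f m := extend_section _ _ hm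

theorem partialDeriv_add (i : Fin n) (h : U ≤ chartDomain (n := n) (M := M) x)
    (f g : (ComplexRingedSpace.ofManifold n M).O U) :
    partialDeriv i h (f + g) = partialDeriv i h f + partialDeriv i h g :=
  ext_of_extend fun m hm => by
    rw [extend_add, extend_partialDeriv i h _ hm, extend_partialDeriv i h _ hm,
      extend_partialDeriv i h _ hm, coordDeriv_add i f g hm (h hm)]

theorem partialDeriv_mul (i : Fin n) (h : U ≤ chartDomain (n := n) (M := M) x)
    (f g : (ComplexRingedSpace.ofManifold n M).O U) :
    partialDeriv i h (f * g) = f * partialDeriv i h g + g * partialDeriv i h f :=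
  ext_of_extend fun m hm => by
    rw [extend_add, extend_mul, extend_mul, extend_partialDeriv i h _ hm,
      extend_partialDeriv i h _ hm, extend_partialDeriv i h _ hm, coordDeriv_mul i f g hm (h hm)]

theorem partialDeriv_const (i : Fin n) (h : U ≤ chartDomain (n := n) (M := M) x) (c : ℂ) :
    partialDeriv i h ((ComplexRingedSpace.ofManifold n M).const U c) = 0 :=
  ext_of_extend fun m hm => by
    rw [extend_zero, extend_partialDeriv i h _ hm, coordDeriv_const i c hm (h hm)]

theorem partialDeriv_resO (i : Fin n) (h : U ≤ chartDomain (n := n) (M := M) x) (hV : V ≤ U)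
    (f : (ComplexRingedSpace.ofManifold n M).O U) :
    partialDeriv i (hV.trans h) ((ComplexRingedSpace.ofManifold n M).resO hV f) =
      (ComplexRingedSpace.ofManifold n M).resO hV (partialDeriv i h f) :=
  ext_of_extend fun m hm => by
    rw [extend_resO _ _ hm, extend_partialDeriv i _ _ hm, extend_partialDeriv i _ _ (hV hm),
      coordDeriv_resO i hV f hm (h (hV hm))]

theorem partialDeriv_const_mul (i : Fin n) (h : U ≤ chartDomain (n := n) (M := M) x) (c : ℂ)
    (f : (ComplexRingedSpace.ofManifold n M).O U) :
    partialDeriv i h ((ComplexRingedSpace.ofManifold n M).const U c * f) =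
      (ComplexRingedSpace.ofManifold n M).const U c * partialDeriv i h f := by
  rw [partialDeriv_mul, partialDeriv_const, mul_zero, add_zero]

/-- The coordinate vector fields. -/
noncomputable def coordVec (x : M) (i : Fin n) :
    (tangent (ComplexRingedSpace.ofManifold n M)).sec (chartDomain (n := n) (M := M) x) :=
  ⟨{ app := fun (V : Opens M) h => AddMonoidHom.mk' (partialDeriv (U := V) (x := x) i h)
        (partialDeriv_add (U := V) (x := x) i h)
     map_const := fun (V : Opens M) h c f => partialDeriv_const_mul (U := V) (x := x) i h c f
     map_res := fun {V W : Opens M} hV hW f =>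
      partialDeriv_resO (U := V) (V := W) (x := x) i hV hW f },
    fun (V : Opens M) h f g => partialDeriv_mul (U := V) (x := x) i h f g⟩

theorem extend_vderiv_coordVec (i : Fin n) (h : V ≤ chartDomain (n := n) (M := M) x)
    (f : (ComplexRingedSpace.ofManifold n M).O V) {m : M} (hm : m ∈ V) :
    extend (vderiv ((tangent (ComplexRingedSpace.ofManifold n M)).res h (coordVec x i)) f) m =
      coordDeriv x i f m := by
  have := extend_partialDeriv i h f hm
  exact this

/-- The first order Taylor expansion with holomorphic coefficients. -/
theorem exists_expansion (h : U ≤ chartDomain (n := n) (M := M) x)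
    (f : (ComplexRingedSpace.ofManifold n M).O U) {m : M} (hm : m ∈ U) :
    ∃ (V : Opens M) (hV : V ≤ U) (_ : m ∈ V)
      (g : Fin n → (ComplexRingedSpace.ofManifold n M).O V),
      (ComplexRingedSpace.ofManifold n M).resO hV f =
        (ComplexRingedSpace.ofManifold n M).const V (extend f m) +
        ∑ i, ((ComplexRingedSpace.ofManifold n M).resO (hV.trans h) (coord x i) -
          (ComplexRingedSpace.ofManifold n M).const V (extend (coord x i) m)) * g i := by
  set φ := chartAt (EuclideanSpace ℂ (Fin n)) x with hφ
  have hx : m ∈ φ.source := h hm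
  have hnhds : φ.target ∩ φ.symm ⁻¹' U ∈ 𝓝 (φ m) :=
    Filter.inter_mem (φ.open_target.mem_nhds (φ.map_source hx))
      ((φ.continuousAt_symm (φ.map_source hx)).preimage_mem_nhds
        (by rw [φ.left_inv hx]; exact U.2.mem_nhds hm))
  -- The Hadamard lemma integrates along segments from the centre, so a coordinate ball inside the
  -- chart image of U is needed.
  obtain ⟨r, hr, hball⟩ := Metric.mem_nhds_iff.1 hnhds
  have hcont : ContDiffOn ℂ ∞ (inChart x f) (Metric.ball (φ m) r) := by
    intro y hy
    have h1 := contDiffAt_inChart x f (hball hy).2 (φ.map_target (hball hy).1)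
    rw [← hφ, φ.right_inv (hball hy).1] at h1
    exact h1.contDiffWithinAt
  obtain ⟨G, hG, hGf⟩ := hadamard hcont
  let W : Opens M := ⟨φ.source ∩ φ ⁻¹' Metric.ball (φ m) r,
    φ.isOpen_inter_preimage Metric.isOpen_ball⟩
  let V : Opens M := U ⊓ W
  have hVU : V ≤ U := inf_le_left
  have hVb : ∀ q : M, q ∈ V → φ q ∈ Metric.ball (φ m) r := fun q hq => hq.2.2
  have hGi : ∀ i : Fin n, ∀ q : M, q ∈ V →
      ContMDiffAt 𝓘(ℂ, EuclideanSpace ℂ (Fin n)) 𝓘(ℂ, ℂ) ∞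
        (fun q => G (φ q) (EuclideanSpace.single i 1)) q := fun i q hq => by
    have h1 : ContDiffAt ℂ ∞ (fun y => G y (EuclideanSpace.single i 1)) (φ q) :=
      (hG.contDiffAt (Metric.isOpen_ball.mem_nhds (hVb q hq))).clm_apply contDiffAt_const
    exact contMDiffAt_comp_chart x (h (hVU hq)) h1
  refine ⟨V, hVU, ⟨hm, hx, Metric.mem_ball_self hr⟩, fun i => section_ V _ (hGi i), ?_⟩
  refine ext_of_extend fun q hq => ?_
  rw [extend_add, extend_resO _ _ hq, extend_const _ hq, extend_sum]
  have h1 := hGf (φ q) (hVb q hq)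
  have h2 : ∀ p : M, p ∈ φ.source → inChart x f (φ p) = extend f p := fun p hp =>
    congrArg (extend f) (φ.left_inv hp)
  rw [h2 q (h (hVU hq)), h2 m hx] at h1
  rw [h1]
  congr 1
  -- Expanding the increment in the standard basis splits G into the coefficients g_i.
  have h3 : φ q - φ m = ∑ i, (φ q i - φ m i) • EuclideanSpace.single i (1 : ℂ) := by
    ext j
    simp [Pi.single_apply]
  rw [h3, map_sum]
  refine Finset.sum_congr rfl fun i _ => ?_
  have hsub : ∀ a b : (ComplexRingedSpace.ofManifold n M).O V,
      extend (a - b) q = extend a q - extend b q := fun a b => by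
    have := extend_add (a - b) b q
    rw [sub_add_cancel] at this
    rw [this, add_sub_cancel_right]
  rw [extend_mul, extend_section _ _ hq, hsub, extend_resO _ _ hq, extend_const _ hq, map_smul]
  have h4 : ∀ p : M, p ∈ φ.source → extend (coord x i) p = φ p i := fun p hp =>
    extend_section _ _ hp
  rw [h4 q (h (hVU hq)), h4 m hx]
  rfl

/-- A derivation of the sheaf is determined by its values on the coordinates. Applied to the Taylor
expansion at m, the terms containing x_i - x_i(m) vanish at m, which leaves ∑ u(x_i)(m) g_i(m), and
g_i(m) is the i-th partial derivative. -/
theorem extend_vderiv_eq (h : U ≤ chartDomain (n := n) (M := M) x)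
    (u : (tangent (ComplexRingedSpace.ofManifold n M)).sec U)
    (f : (ComplexRingedSpace.ofManifold n M).O U) {m : M} (hm : m ∈ U) :
    extend (vderiv u f) m = ∑ i, extend (vderiv u
      ((ComplexRingedSpace.ofManifold n M).resO h (coord x i))) m * coordDeriv x i f m := by
  obtain ⟨V, hV, hmV, g, hg⟩ := exists_expansion h f hm
  have key : ∀ u : (tangent (ComplexRingedSpace.ofManifold n M)).sec V,
      extend (vderiv u ((ComplexRingedSpace.ofManifold n M).resO hV f)) m =
        ∑ i, extend (vderiv u ((ComplexRingedSpace.ofManifold n M).resO (hV.trans h) (coord x i)))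
          m * extend (g i) m := by
    intro u
    rw [hg]
    refine (congrArg (fun k => extend (U := V) k m) (vderiv_expansion u _ _ _ _)).trans ?_
    rw [extend_sum]
    refine Finset.sum_congr rfl fun i _ => ?_
    rw [extend_add, extend_mul, extend_mul, extend_sub, extend_resO _ _ hmV, extend_const _ hmV]
    ring
  have h1 := key ((tangent (ComplexRingedSpace.ofManifold n M)).res hV u)
  rw [extend_vderiv_res hV u f hmV] at h1
  rw [h1]
  refine Finset.sum_congr rfl fun i _ => ?_
  rw [← extend_vderiv_res hV u _ hmV]
  -- The same identity for the i-th coordinate field identifies g_i(m).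
  have h2 := key ((tangent (ComplexRingedSpace.ofManifold n M)).res (hV.trans h) (coordVec x i))
  rw [extend_vderiv_coordVec _ _ _ hmV, coordDeriv_resO i hV f hmV (h hm)] at h2
  have h3 := (ComplexRingedSpace.ofManifold n M).resO_comp h hV (coord x i)
  rw [h2, Finset.sum_eq_single i]
  · rw [extend_vderiv_coordVec _ _ _ hmV, coordDeriv_resO _ _ _ hmV (h hm),
      coordDeriv_coord _ _ (h hm), if_pos rfl, one_mul]
    exact congrArg (fun k => extend (U := V) (vderiv
      ((tangent (ComplexRingedSpace.ofManifold n M)).res hV u) k) m * extend (g i) m) h3.symm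
  · intro j _ hj
    rw [extend_vderiv_coordVec _ _ _ hmV, coordDeriv_resO _ _ _ hmV (h hm),
      coordDeriv_coord _ _ (h hm), if_neg hj, zero_mul]
  · intro hi
    exact absurd (Finset.mem_univ i) hi

/-- The differentials of the coordinate functions. -/
noncomputable def coordForm (x : M) (i : Fin n) :
    (Omega (ComplexRingedSpace.ofManifold n M)).sec (chartDomain (n := n) (M := M) x) :=
  differential (coord x i)

/-- The frame of coordinate vector fields. -/
noncomputable def coordFrame (x : M) : TangentFrame (X := ComplexRingedSpace.ofManifold n M)
    (chartDomain (n := n) (M := M) x) where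
  n := n
  vec := coordVec x
  form := coordForm x
  expand := fun (V : Opens M) h v => tangent_ext fun (W : Opens M) hW f => by
    refine ext_of_extend (U := W) fun m hm => ?_
    have h1 := extend_vderiv_eq (x := x) (hW.trans h)
      ((tangent (ComplexRingedSpace.ofManifold n M)).res hW v) f hm
    refine h1.trans ?_
    have h2 := vderiv_res_frame_sum (X := ComplexRingedSpace.ofManifold n M) h hW (coord x)
      (coordVec x) v f
    refine Eq.trans ?_ (congrArg (fun k => extend (U := W) k m) h2).symm
    rw [extend_sum]
    refine Finset.sum_congr rfl fun i _ => ?_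
    rw [extend_mul]
    exact congrArg _ (extend_vderiv_coordVec i (hW.trans h) f hm).symm
  pair := fun i j => by
    refine ext_of_extend (U := chartDomain x) fun m hm => ?_
    have h1 := extend_vderiv_coordVec j le_rfl (coord x i) hm
    rw [coordDeriv_coord _ _ hm] at h1
    have h2 := eval_differential (coord x i) (coordVec x j)
    refine (congrArg (fun k => extend (U := chartDomain x) k m) h2).trans (h1.trans ?_)
    split_ifs with hij
    · exact (extend_one hm).symm
    · exact (extend_zero m).symm

theorem hasTangentFrames : HasTangentFrames (ComplexRingedSpace.ofManifold n M) :=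
  fun (x : M) => ⟨chartDomain (n := n) (M := M) x, mem_chart_source _ x, ⟨coordFrame x⟩⟩

end Charts

end ComplexManifold

/-! ## Extending derivations from the functions on an affine open set -/

section ExtendDerivation

/-- The functions on every open subset of `V` are locally quotients of functions on `V`, and
functions on `V` are determined by their restrictions to nonempty open sets. -/
structure IsLocallyFraction (V : X.Op) : Prop where
  exists_fraction : ∀ {W : X.Op} (h : W ≤ V) (g : X.O W), ∀ x ∈ W, ∃ (W' : X.Op) (hW : W' ≤ W)
    (a b : X.O V), x ∈ W' ∧ IsUnit (X.resO (hW.trans h) b) ∧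
      X.resO hW g * X.resO (hW.trans h) b = X.resO (hW.trans h) a
  resO_injective : ∀ {W : X.Op} (h : W ≤ V), (∃ x, x ∈ W) → Function.Injective (X.resO h)

variable {V W : X.Op}

/-- From f b = a and the product rule, b v(f) = v(a) - f v(b) with b a unit, so v is determined by
its values on functions coming from V. -/
theorem tangent_ext_of_isLocallyFraction (hV : IsLocallyFraction V) (h : W ≤ V)
    {v w : (tangent X).sec W} (hvw : ∀ a : X.O V, vderiv v (X.resO h a) = vderiv w (X.resO h a)) :
    v = w := by
  refine tangent_ext fun W₁ h₁ f => PMod.glues_unit.eq_of_locally_eq fun x hx => ?_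
  obtain ⟨W₂, h₂, a, b, hx₂, hb, hab⟩ := hV.exists_fraction (h₁.trans h) f x hx
  refine ⟨W₂, h₂, hx₂, ?_⟩
  have key : ∀ c : X.O V, vderiv ((tangent X).res (h₂.trans h₁) v) (X.resO ((h₂.trans h₁).trans h) c)
      = vderiv ((tangent X).res (h₂.trans h₁) w) (X.resO ((h₂.trans h₁).trans h) c) := fun c => by
    rw [← X.resO_comp h (h₂.trans h₁), vderiv_res, vderiv_res, hvw]
  have hv : ∀ u : (tangent X).sec W, X.resO h₂ (vderiv ((tangent X).res h₁ u) f) =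
      vderiv ((tangent X).res (h₂.trans h₁) u) (X.resO h₂ f) := fun u => by
    rw [← vderiv_res, (tangent X).res_comp h₁ h₂]
  change X.resO h₂ _ = X.resO h₂ _
  rw [hv, hv]
  have h3 := key a
  rw [← hab, vderiv_mul, vderiv_mul, key b] at h3
  exact hb.mul_left_cancel (add_left_cancel h3)

variable (D : X.O V →+ X.O V)

/-- `r` is the derivative of `g` with respect to the extension of the derivation `D`. -/
def IsDerivative (h : W ≤ V) (g r : X.O W) : Prop :=
  ∀ (W' : X.Op) (hW : W' ≤ W) (a b : X.O V),
    X.resO hW g * X.resO (hW.trans h) b = X.resO (hW.trans h) a →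
    X.resO hW r * X.resO (hW.trans h) b + X.resO hW g * X.resO (hW.trans h) (D b) =
      X.resO (hW.trans h) (D a)

variable {D} {h : W ≤ V}

theorem IsDerivative.restrict {g r : X.O W} (hr : IsDerivative D h g r) {W' : X.Op}
    (hW : W' ≤ W) : IsDerivative D (hW.trans h) (X.resO hW g) (X.resO hW r) := by
  intro W₂ h₂ a b hab
  rw [X.resO_comp] at hab ⊢
  rw [X.resO_comp]
  exact hr W₂ (h₂.trans hW) a b hab

theorem IsDerivative.unique (hV : IsLocallyFraction V) {g r r' : X.O W}
    (hr : IsDerivative D h g r) (hr' : IsDerivative D h g r') : r = r' := by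
  refine PMod.glues_unit.eq_of_locally_eq fun x hx => ?_
  obtain ⟨W₂, h₂, a, b, hx₂, hb, hab⟩ := hV.exists_fraction h g x hx
  refine ⟨W₂, h₂, hx₂, ?_⟩
  change X.resO h₂ r = X.resO h₂ r'
  have h1 := hr W₂ h₂ a b hab
  rw [← hr' W₂ h₂ a b hab] at h1
  exact hb.mul_right_cancel (add_right_cancel h1)

theorem IsDerivative.of_locally {g r : X.O W} (hr : ∀ x ∈ W, ∃ (W' : X.Op) (hW : W' ≤ W),
    x ∈ W' ∧ IsDerivative D (hW.trans h) (X.resO hW g) (X.resO hW r)) : IsDerivative D h g r := by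
  intro W₁ h₁ a b hab
  refine PMod.glues_unit.eq_of_locally_eq fun x hx => ?_
  obtain ⟨W₂, h₂, hx₂, h3⟩ := hr x (h₁ hx)
  have hi : W₁ ⊓ W₂ ≤ W₁ := inf_le_left
  refine ⟨W₁ ⊓ W₂, hi, ⟨hx, hx₂⟩, ?_⟩
  change X.resO hi _ = X.resO hi _
  have h4 := h3 (W₁ ⊓ W₂) inf_le_right a b
  rw [X.resO_comp, X.resO_comp] at h4
  have h5 := congrArg (X.resO hi) hab
  rw [map_mul, X.resO_comp, X.resO_comp, X.resO_comp] at h5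
  rw [map_add, map_mul, map_mul, X.resO_comp, X.resO_comp, X.resO_comp, X.resO_comp, X.resO_comp]
  exact h4 h5

/-- One presentation g = a/b suffices. If also g = c/d on a smaller nonempty open set, then a d = c
b holds already on V by injectivity of restriction, and applying D to it gives the quotient rule for
c/d. -/
theorem IsDerivative.of_fraction (hV : IsLocallyFraction V)
    (hD : ∀ a b, D (a * b) = a * D b + b * D a) {g r : X.O W} {a b : X.O V}
    (hb : IsUnit (X.resO h b)) (hab : g * X.resO h b = X.resO h a)
    (hr : r * X.resO h b + g * X.resO h (D b) = X.resO h (D a)) : IsDerivative D h g r := by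
  intro W₁ h₁ c d hcd
  refine PMod.glues_unit.eq_of_locally_eq fun x hx => ⟨W₁, le_rfl, hx, congrArg _ ?_⟩
  have h1 := congrArg (X.resO h₁) hab
  have h2 := congrArg (X.resO h₁) hr
  have h3 := hb.map (X.resO h₁)
  rw [map_mul, X.resO_comp, X.resO_comp] at h1
  rw [map_add, map_mul, map_mul, X.resO_comp, X.resO_comp, X.resO_comp] at h2
  rw [X.resO_comp] at h3
  have h4 : a * d = c * b := by
    refine hV.resO_injective (h₁.trans h) ⟨x, hx⟩ ?_
    rw [map_mul, map_mul]
    linear_combination X.resO (h₁.trans h) b * hcd - X.resO (h₁.trans h) d * h1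
  have h5 := congrArg (fun z => X.resO (h₁.trans h) (D z)) h4
  beta_reduce at h5
  rw [hD, hD, map_add, map_add, map_mul, map_mul, map_mul, map_mul] at h5
  refine h3.mul_right_cancel ?_
  linear_combination X.resO (h₁.trans h) d * h2 + h5 + X.resO (h₁.trans h) (D d) * h1 -
    X.resO (h₁.trans h) (D b) * hcd

/-- The quotient rule gives local derivatives; they are unique, hence glue. -/
theorem exists_isDerivative (hV : IsLocallyFraction V)
    (hD : ∀ a b, D (a * b) = a * D b + b * D a) (h : W ≤ V) (g : X.O W) :
    ∃ r, IsDerivative D h g r := by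
  have hloc : ∀ x ∈ W, ∃ (W' : X.Op) (hW : W' ≤ W) (s : (PMod.unit X).sec W'), x ∈ W' ∧
      IsDerivative D (hW.trans h) (X.resO hW g) s := by
    intro x hx
    obtain ⟨W₂, h₂, a, b, hx₂, hb, hab⟩ := hV.exists_fraction h g x hx
    obtain ⟨u, hu⟩ := isUnit_iff_exists_inv.1 hb
    refine ⟨W₂, h₂, u * (X.resO (h₂.trans h) (D a) - X.resO h₂ g * X.resO (h₂.trans h) (D b)),
      hx₂, IsDerivative.of_fraction hV hD hb hab ?_⟩
    linear_combination (X.resO (h₂.trans h) (D a) -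
      X.resO h₂ g * X.resO (h₂.trans h) (D b)) * hu
  obtain ⟨t, ht⟩ := PMod.glues_unit.exists_of_locally
    (fun W' hW s => IsDerivative D (hW.trans h) (X.resO hW g) s)
    (fun W₁ W₂ h₁ h₂ s hs => by
      have := hs.restrict h₂
      rw [X.resO_comp] at this
      exact this)
    (fun W' hW s s' hs hs' => hs.unique hV hs') hloc
  refine ⟨t, IsDerivative.of_locally fun x hx => ?_⟩
  obtain ⟨W', hW, s, hx', hs⟩ := hloc x hx
  refine ⟨W', hW, hx', ?_⟩
  have := ht W' hW s hs
  change X.resO hW t = s at this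
  rw [this]
  exact hs

/-- Two functions have local fraction expressions on a common neighbourhood. -/
theorem IsLocallyFraction.exists_fractions (hV : IsLocallyFraction V) (h : W ≤ V) (f g : X.O W)
    (x : X.toRingedSpace) (hx : x ∈ W) : ∃ (W' : X.Op) (hW : W' ≤ W) (a b c d : X.O V), x ∈ W' ∧
      IsUnit (X.resO (hW.trans h) b) ∧ IsUnit (X.resO (hW.trans h) d) ∧
      X.resO hW f * X.resO (hW.trans h) b = X.resO (hW.trans h) a ∧
      X.resO hW g * X.resO (hW.trans h) d = X.resO (hW.trans h) c := by
  obtain ⟨W₁, h₁, a, b, hx₁, hb, hab⟩ := hV.exists_fraction h f x hx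
  obtain ⟨W₂, h₂, c, d, hx₂, hd, hcd⟩ := hV.exists_fraction (h₁.trans h) (X.resO h₁ g) x hx₁
  have hb' := hb.map (X.resO h₂)
  have hab' := congrArg (X.resO h₂) hab
  rw [X.resO_comp] at hb' hcd
  rw [map_mul, X.resO_comp, X.resO_comp, X.resO_comp] at hab'
  exact ⟨W₂, h₂.trans h₁, a, b, c, d, hx₂, hb', hd, hab', hcd⟩

theorem IsDerivative.add (hV : IsLocallyFraction V) (hD : ∀ a b, D (a * b) = a * D b + b * D a)
    {f g r s : X.O W} (hr : IsDerivative D h f r) (hs : IsDerivative D h g s) :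
    IsDerivative D h (f + g) (r + s) := by
  refine IsDerivative.of_locally fun x hx => ?_
  obtain ⟨W', hW, a, b, c, d, hx', hb, hd, hab, hcd⟩ := hV.exists_fractions h f g x hx
  refine ⟨W', hW, hx', IsDerivative.of_fraction hV hD (a := a * d + c * b) (b := b * d) ?_ ?_ ?_⟩
  · rw [map_mul]; exact hb.mul hd
  · simp only [map_add, map_mul]
    linear_combination X.resO (hW.trans h) d * hab + X.resO (hW.trans h) b * hcd
  · have h1 := hr W' hW a b hab
    have h2 := hs W' hW c d hcd
    simp only [map_add, map_mul, hD]
    linear_combination X.resO (hW.trans h) d * h1 + X.resO (hW.trans h) b * h2 +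
      X.resO (hW.trans h) (D d) * hab + X.resO (hW.trans h) (D b) * hcd

theorem IsDerivative.mul (hV : IsLocallyFraction V) (hD : ∀ a b, D (a * b) = a * D b + b * D a)
    {f g r s : X.O W} (hr : IsDerivative D h f r) (hs : IsDerivative D h g s) :
    IsDerivative D h (f * g) (f * s + g * r) := by
  refine IsDerivative.of_locally fun x hx => ?_
  obtain ⟨W', hW, a, b, c, d, hx', hb, hd, hab, hcd⟩ := hV.exists_fractions h f g x hx
  refine ⟨W', hW, hx', IsDerivative.of_fraction hV hD (a := a * c) (b := b * d) ?_ ?_ ?_⟩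
  · rw [map_mul]; exact hb.mul hd
  · simp only [map_mul]
    linear_combination X.resO hW g * X.resO (hW.trans h) d * hab + X.resO (hW.trans h) a * hcd
  · have h1 := hr W' hW a b hab
    have h2 := hs W' hW c d hcd
    simp only [map_add, map_mul, hD]
    rw [← h1, ← h2, ← hab, ← hcd]
    ring

theorem IsDerivative.resO (hV : IsLocallyFraction V) (hD : ∀ a b, D (a * b) = a * D b + b * D a)
    (h : W ≤ V) (a : X.O V) : IsDerivative D h (X.resO h a) (X.resO h (D a)) := by
  have h1 : D 1 = 0 := by
    have := hD 1 1
    rw [one_mul, one_mul] at this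
    exact left_eq_add.1 this
  refine IsDerivative.of_fraction hV hD (a := a) (b := 1) ?_ ?_ ?_
  · rw [map_one]; exact isUnit_one
  · rw [map_one, mul_one]
  · rw [h1, map_one, mul_one, map_zero, mul_zero, add_zero]

/-- The derivative of a function with respect to the extension of `D`. -/
noncomputable def derivative (hV : IsLocallyFraction V)
    (hD : ∀ a b, D (a * b) = a * D b + b * D a) (h : W ≤ V) (g : X.O W) : X.O W :=
  (exists_isDerivative hV hD h g).choose

theorem isDerivative_derivative (hV : IsLocallyFraction V)
    (hD : ∀ a b, D (a * b) = a * D b + b * D a) (h : W ≤ V) (g : X.O W) :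
    IsDerivative D h g (derivative hV hD h g) :=
  (exists_isDerivative hV hD h g).choose_spec

/-- Additivity, the product rule and compatibility with restriction all follow from uniqueness of
the derivative; that D kills constants makes the extension ℂ-linear. -/
theorem exists_tangent_of_derivation (hV : IsLocallyFraction V)
    (hD : ∀ a b, D (a * b) = a * D b + b * D a) (hc : ∀ c, D (X.const V c) = 0) :
    ∃ v : (tangent X).sec V, ∀ a, vderiv v a = D a := by
  have hmul : ∀ (W : X.Op) (h : W ≤ V) (f g : X.O W), derivative hV hD h (f * g) =
      f * derivative hV hD h g + g * derivative hV hD h f := fun W h f g =>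
    (isDerivative_derivative hV hD h _).unique hV
      ((isDerivative_derivative hV hD h f).mul hV hD (isDerivative_derivative hV hD h g))
  have hres : ∀ (W : X.Op) (h : W ≤ V) (a : X.O V),
      derivative hV hD h (X.resO h a) = X.resO h (D a) := fun W h a =>
    (isDerivative_derivative hV hD h _).unique hV (IsDerivative.resO hV hD h a)
  refine ⟨⟨{
    app := fun W h => AddMonoidHom.mk' (derivative hV hD h) fun f g =>
      (isDerivative_derivative hV hD h _).unique hV
        ((isDerivative_derivative hV hD h f).add hV hD (isDerivative_derivative hV hD h g))
    map_const := fun W h c f => ?_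
    map_res := fun {W W'} h hW f => ?_ }, hmul⟩, fun a => ?_⟩
  · have h1 := hres W h (X.const V c)
    have h2 : X.resO h (X.const V c) = X.const W c := X.const_res h c
    rw [hc, map_zero, h2] at h1
    refine (hmul W h _ f).trans ?_
    rw [h1, mul_zero, add_zero]
    rfl
  · exact (isDerivative_derivative hV hD (hW.trans h) _).unique hV
      ((isDerivative_derivative hV hD h f).restrict hW)
  · have h1 := hres V le_rfl a
    rw [X.resO_id, X.resO_id] at h1
    exact h1

/-- Coordinates on `V` with dual derivations give a frame of the tangent sheaf. -/
theorem nonempty_tangentFrame {n : ℕ} (hV : IsLocallyFraction V) (x : Fin n → X.O V)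
    (D : Fin n → X.O V →+ X.O V) (hD : ∀ i a b, D i (a * b) = a * D i b + b * D i a)
    (hc : ∀ i c, D i (X.const V c) = 0) (hx : ∀ i j, D j (x i) = if i = j then 1 else 0)
    (hexp : ∀ (W : X.Op) (h : W ≤ V) (v : (tangent X).sec W) (a : X.O V),
      vderiv v (X.resO h a) = ∑ i, vderiv v (X.resO h (x i)) * X.resO h (D i a)) :
    Nonempty (TangentFrame V) := by
  choose e he using fun i => exists_tangent_of_derivation hV (hD i) (hc i)
  refine ⟨⟨n, e, fun i => differential (x i), fun W h v => ?_, fun i j => ?_⟩⟩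
  · refine tangent_ext_of_isLocallyFraction hV h fun a => ?_
    have h1 := vderiv_res_frame_sum h le_rfl x e v (X.resO h a)
    rw [(tangent X).res_id, (tangent X).res_id] at h1
    rw [h1, hexp W h v a]
    refine Finset.sum_congr rfl fun i _ => ?_
    rw [vderiv_res, he]
  · rw [eval_differential, he, hx]

end ExtendDerivation

/-! ## Derivations of standard smooth algebras -/

/-- The Kähler module of a standard smooth algebra is free on the differentials of the generators
not matched with a relation. The D_i are the dual derivations, and the expansion of d is the
universal property applied to the expansion of da in this basis. The target B is arbitrary so that
derivations followed by restriction to a smaller open set are covered. -/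
theorem RingHom.IsStandardSmooth.exists_dual {R A : Type} [CommRing R] [CommRing A] {φ : R →+* A}
    (hφ : φ.IsStandardSmooth) : ∃ (n : ℕ) (x : Fin n → A) (D : Fin n → A →+ A),
      (∀ i a b, D i (a * b) = a * D i b + b * D i a) ∧ (∀ i r, D i (φ r) = 0) ∧
      (∀ i j, D j (x i) = if i = j then 1 else 0) ∧
      ∀ {B : Type} [CommRing B] (ρ : A →+* B) (d : A →+ B),
        (∀ a b, d (a * b) = ρ a * d b + ρ b * d a) → (∀ r, d (φ r) = 0) →
        ∀ a, d a = ∑ i, d (x i) * ρ (D i a) := by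
  algebraize [φ]
  obtain ⟨ι, σ, _, _, ⟨P⟩⟩ := ‹Algebra.IsStandardSmooth R A›.out
  let e : ((Set.range P.map)ᶜ : Set ι) ≃ Fin (Nat.card ((Set.range P.map)ᶜ : Set ι)) :=
    Finite.equivFin _
  let b := P.basisKaehler.reindex e
  have hb : ∀ i, b i = KaehlerDifferential.D R A (P.val (e.symm i)) := fun i =>
    (P.basisKaehler.reindex_apply e i).trans (P.basisKaehler_apply _)
  let D : Fin _ → Derivation R A A := fun i => (b.coord i).compDer (KaehlerDifferential.D R A)
  refine ⟨_, fun i => P.val (e.symm i), fun i => (D i).toLinearMap.toAddMonoidHom,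
    fun i a b => (D i).leibniz a b, fun i r => (D i).map_algebraMap r, fun i j => ?_, ?_⟩
  · change b.coord j (KaehlerDifferential.D R A (P.val (e.symm i))) = _
    rw [← hb, Module.Basis.coord_apply, Module.Basis.repr_self, Finsupp.single_apply]
  · intro B _ ρ d hd hr a
    algebraize [ρ, ρ.comp φ]
    let d' : Derivation R A B := Derivation.mk'
      { toFun := d
        map_add' := map_add d
        map_smul' := fun r a => by
          rw [Algebra.smul_def, hd]
          change ρ (φ r) * d a + ρ a * d (φ r) = _
          rw [hr, mul_zero, add_zero]
          rfl } fun a b => hd a b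
    have h1 : ∀ a, d a = d'.liftKaehlerDifferential (KaehlerDifferential.D R A a) := fun a =>
      (d'.liftKaehlerDifferential_comp_D a).symm
    rw [h1 a]
    conv_lhs => rw [← b.sum_repr (KaehlerDifferential.D R A a), map_sum]
    refine Finset.sum_congr rfl fun i _ => ?_
    rw [map_smul, hb, ← h1, Algebra.smul_def, mul_comm]
    rfl

/-! ## Smooth schemes -/

namespace SmoothScheme

open AlgebraicGeometry

variable {Y : Scheme.{0}} {f : Y ⟶ Spec (CommRingCat.of ℂ)}

/-- A function is invertible on its basic open set, which on an integral scheme is empty only for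
the zero function. -/
theorem genericallyInvertible [IsIntegral Y] :
    GenericallyInvertible (ComplexRingedSpace.ofScheme Y f) where
  exists_isUnit := fun {U : Y.Opens} (g : Γ(Y, U)) hg => by
    refine ⟨Y.basicOpen g, Y.basicOpen_le g, ?_, RingedSpace.isUnit_res_basicOpen _ g⟩
    by_contra hcon
    refine hg ((basicOpen_eq_bot_iff g).1 (Opens.ext (Set.eq_empty_iff_forall_notMem.2 ?_)))
    exact fun x hx => hcon ⟨x, hx⟩
  nontrivial := fun {U : Y.Opens} ⟨x, hx⟩ => by
    have : Nonempty U := ⟨⟨x, hx⟩⟩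
    exact inferInstanceAs (Nontrivial Γ(Y, U))

/-- Basic open sets form a basis of an affine open set, and functions on them are fractions with
powers of b as denominators. Restriction to nonempty open sets is injective by integrality. -/
theorem isLocallyFraction [IsIntegral Y] {V : Y.Opens} (hV : IsAffineOpen V) :
    IsLocallyFraction (X := ComplexRingedSpace.ofScheme Y f) V where
  exists_fraction := fun {W : Y.Opens} h (g : Γ(Y, W)) x hx => by
    obtain ⟨b, hbW, hxb⟩ := hV.exists_basicOpen_le ⟨x, hx⟩ (h hx)
    have := hV.isLocalization_basicOpen b
    obtain ⟨⟨a, ⟨_, k, rfl⟩⟩, hab⟩ := IsLocalization.surj (Submonoid.powers b)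
      (Y.presheaf.map (homOfLE hbW).op g)
    refine ⟨Y.basicOpen b, hbW, a, b ^ k, hxb, ?_, ?_⟩
    · have h1 : IsUnit (Y.presheaf.map (homOfLE (hbW.trans h)).op b) :=
        RingedSpace.isUnit_res_basicOpen _ b
      have h2 := h1.pow k
      rw [← map_pow] at h2
      exact h2
    · exact hab
  resO_injective := fun {W : Y.Opens} h ⟨x, hx⟩ => by
    have : Nonempty W := ⟨⟨x, hx⟩⟩
    exact map_injective_of_isIntegral Y (homOfLE h)

theorem appLE_constant {V : Y.Opens} (e : V ≤ f ⁻¹ᵁ ⊤) (c : ℂ) :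
    f.appLE ⊤ V e ((Scheme.ΓSpecIso (CommRingCat.of ℂ)).inv c) =
      (ComplexRingedSpace.ofScheme Y f).const V c := rfl

/-- The spectrum of ℂ is a point, so a nonempty V can only map into the whole of it. -/
theorem eq_top_of_le_preimage {U : (Spec (CommRingCat.of ℂ)).Opens} {V : Y.Opens} {x : Y}
    (hx : x ∈ V) (e : V ≤ f ⁻¹ᵁ U) : U = ⊤ := by
  refine Opens.ext (Set.eq_univ_of_forall fun y => ?_)
  have : y = f x := Subsingleton.elim (α := PrimeSpectrum ℂ) _ _
  rw [this]
  exact e hx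

/-- On an affine neighbourhood standard smooth over ℂ, the algebraic coordinates and dual
derivations of the ring of functions extend to a frame of the sheaf. -/
theorem hasTangentFrames [IsIntegral Y] [Smooth f] :
    HasTangentFrames (ComplexRingedSpace.ofScheme Y f) := fun (x : Y) => by
  obtain ⟨U, -, V, hV, hx, e, hf⟩ := Smooth.exists_isStandardSmooth f x
  obtain rfl := eq_top_of_le_preimage hx e
  obtain ⟨n, t, D, hD, hD0, ht, hexp⟩ := hf.exists_dual
  refine ⟨V, hx, nonempty_tangentFrame (isLocallyFraction hV) t D hD (fun i c => ?_) ht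
    fun W h v a => ?_⟩
  · exact (congrArg _ (appLE_constant e c).symm).trans (hD0 i _)
  -- A vector field over W defines a derivation a ↦ v(a|_W) along the restriction map from functions
  -- on V to functions on W.
  · refine hexp ((ComplexRingedSpace.ofScheme Y f).resO h)
      ((v.1.app W le_rfl).comp ((ComplexRingedSpace.ofScheme Y f).resO h).toAddMonoidHom)
      (fun a b => ?_) (fun r => ?_) a
    · exact (congrArg (vderiv v) (map_mul ((ComplexRingedSpace.ofScheme Y f).resO h) a b)).trans
        (vderiv_mul v _ _)
    · obtain ⟨c, rfl⟩ : ∃ c, (Scheme.ΓSpecIso (CommRingCat.of ℂ)).inv c = r :=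
        ⟨(Scheme.ΓSpecIso (CommRingCat.of ℂ)).hom r, by simp⟩
      have h1 : vderiv v ((ComplexRingedSpace.ofScheme Y f).resO h
          ((ComplexRingedSpace.ofScheme Y f).const V c)) = 0 := by
        have h2 : (ComplexRingedSpace.ofScheme Y f).resO h
          ((ComplexRingedSpace.ofScheme Y f).const V c) =
            (ComplexRingedSpace.ofScheme Y f).const W c :=
          (ComplexRingedSpace.ofScheme Y f).const_res h c
        rw [h2, vderiv_const]
      exact h1

end SmoothScheme

/-! ### Both settings together, and the theorem -/

theorem SmoothComplexVariety.hasTangentFrames (X : SmoothComplexVariety) :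
    HasTangentFrames X.space := by
  cases X with
  | algebraic X f => exact SmoothScheme.hasTangentFrames
  | analytic n M => exact ComplexManifold.hasTangentFrames

theorem SmoothComplexVariety.genericallyInvertible (X : SmoothComplexVariety) :
    GenericallyInvertible X.space := by
  cases X with
  | algebraic X f => exact SmoothScheme.genericallyInvertible
  | analytic n M => exact ComplexManifold.genericallyInvertible

/-- Meromorphic extensions of a flat partial connection correspond to meromorphic splittings of the
sequence of the first transverse jet; for codimension one and `D` invariant, the flat extensions
correspond to the horizontal splittings. -/
theorem theoremA (X : SmoothComplexVariety) (F : Foliation X.space)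
    (E : SheafOfModules.{0} X.space.ringSheaf) (hcoh : E.toPMod.IsCoherent)
    (hE : E.toPMod.IsReflexive)
    (C : PartialConnection F E.toPMod) (hC : C.IsFlat) (D : EffectiveDivisor X.space) :
    ∃ Φ : MeromorphicExtension C D ≃ MeromorphicSplitting C hE D,
      (∀ (N : MeromorphicExtension C D) (σ : MeromorphicSplitting C hE D),
        Φ N = σ ↔ σ.IsAssociated N.conn) ∧
      (F.HasCodim 1 → ∀ (hD : D.IsInvariant F) (N : MeromorphicExtension C D),
        N.conn.IsFlat ↔ (Φ N).IsHorizontal hC hD) := by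
  have hG : E.toPMod.Glues := SheafOfModules.glues E
  have hT := X.hasTangentFrames
  exact ⟨extensionEquivSplitting C hE hG hT D,
    fun N σ => extensionEquivSplitting_eq_iff hE hG hT N σ,
    fun hF hD N => isFlat_iff_isHorizontal hG hT X.genericallyInvertible hF hC hD N⟩
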